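/- Let $\lambda>0$, $\rho_c=\frac{\lambda}{1+\lambda}$ and $a=\frac{\sqrt\lambda}{1+\lambda}$. For $N\ge 1$ consider activated random walk on the complete graph with $N+1$ vertices, one of which is the boundary. Each of the other $N$ vertices is empty or hosts one particle, which is active or asleep; at time $0$ each of them hosts an active particle. If a configuration has no active particle, it no longer changes. Otherwise one step consists in choosing an active particle uniformly at random. With probability $\frac{\lambda}{1+\lambda}$ it falls asleep; with probability $\frac{1}{1+\lambda}$ it leaves its vertex and performs simple random walk on the complete graph until it reaches a vertex without a particle, where it stays (active), or the boundary, where it is removed; all sleeping particles on its path become active. Let $X_t$ be the number of particles and $Y_t$ the number of active particles after $t$ steps, let $P_N$ be the law of the process, $\mathcal F_t=\sigma((X_s,Y_s):0\le s\le t)$, and $$S_t=Y_t-\big((1+\lambda)X_t-\lambda N\big),\qquad \tau=\inf\{t\ge 0: Y_t=0\},\qquad \sigma_2=\inf\{t\ge 0: S_t\ge N^{1/2}\}.$$ For a stopping time $T$ of $(\mathcal F_t)$ write $\tau(T)=\tau\circ\theta_T$ and $\sigma_2(T)=\sigma_2\circ\theta_T$, where $\theta_t$ is the shift of time by $t$.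 (i) For every $\varepsilon>0$ there is $\eta_1=\eta_1(\varepsilon)>0$ and, for every $\lambda>0$, a constant $c=c(\lambda,\varepsilon)>0$ such that for every $N$ with $\sqrt N>4\lambda+2$ and every stopping time $t_2$, almost surely on the event that $t_2<\infty$, $$\rho_cN+(a-2\varepsilon)\sqrt{N\log N}\le X_{t_2}\le\rho_cN+(a-\varepsilon)\sqrt{N\log N}\quad\text{and}\quad S_{t_2}\le 4\lambda+2,$$ we have $$P_N\big[\tau(t_2)<\sigma_2(t_2)\,\big|\,\mathcal F_{t_2}\big]\ \ge\ c\,N^{-1/2+\eta_1}.$$ (ii) For every $\varepsilon>0$ there is $\eta_2=\eta_2(\varepsilon)>0$ and, for every $\lambda>0$ and every real $A$, a constant $C=C(\lambda,\varepsilon,A)>0$ such that for every $N\ge1$ and every stopping time $\bar t_2$, almost surely on the event that $\bar t_2<\infty$, $$\rho_cN+(a+\varepsilon)\sqrt{N\log N}\le X_{\bar t_2}\le\rho_cN+(2A+1)\sqrt{N\log N},$$ $$S_{\bar t_2}\le 4\lambda+2\quad\text{and}\quad Y_{\bar t_2}\ge(1+\lambda)\Big(a+\frac{\varepsilon}{2}\Big)\sqrt{N\log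 N},$$ we have $$P_N\big[\tau(\bar t_2)<\sigma_2(\bar t_2)\,\big|\,\mathcal F_{\bar t_2}\big]\ \le\ C\,N^{-1/2-\eta_2}.$$ -/

import Mathlib

open MeasureTheory ProbabilityTheory
open scoped ENNReal NNReal

noncomputable section

namespace ARW

/-- The status of a non-boundary vertex: no particle, a sleeping particle, an active particle. -/
inductive Site : Type
  | empty : Site
  | asleep : Site
  | active : Site
  deriving DecidableEq

instance : Fintype Site where
  elems := {Site.empty, Site.asleep, Site.active}
  complete := fun x => by cases x <;> simp

instance : MeasurableSpace Site := ⊤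

instance : DiscreteMeasurableSpace Site := ⟨fun _ => trivial⟩

/-- Configurations on the `N` non-boundary vertices of the complete graph on `N + 1` vertices. -/
abbrev Config (N : ℕ) : Type := Fin N → Site

/-- Vertices of the complete graph on `N + 1` vertices: `none` is the boundary vertex and
`some y` are the `N` other vertices. -/
abbrev Vertex (N : ℕ) : Type := Option (Fin N)

lemma others_nonempty {N : ℕ} (x : Fin N) :
    (Finset.univ.erase (some x) : Finset (Vertex N)).Nonempty := ⟨none, by simp⟩

/-- One jump of simple random walk on the complete graph from the vertex `x`: the new position is
uniform over all the vertices different from `x`. -/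
def jump {N : ℕ} (x : Fin N) : PMF (Vertex N) :=
  PMF.uniformOfFinset (Finset.univ.erase (some x)) (others_nonempty x)

/-- A particle stands at `x`; the configuration of all the *other* particles is `ζ`. The particle
performs simple random walk until it reaches the boundary (then it is removed) or a vertex that is
unoccupied (then it stays there and is active); sleeping particles on its path are woken up.
`walk n x ζ` is the law of the outcome after at most `n` jumps: `some ζ'` if the
particle has stopped by then and `ζ'` is the resulting configuration, `none` if it has not. -/
def walk {N : ℕ} : ℕ → Fin N → Config N → PMF (Option (Config N))
  | 0, _, _ => PMF.pure none
  | n + 1, x, ζ => (jump x).bind fun w =>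
      match w with
      | none => PMF.pure (some ζ)
      | some y =>
        match ζ y with
        | Site.empty => PMF.pure (some (Function.update ζ y Site.active))
        | Site.asleep => walk n y (Function.update ζ y Site.active)
        | Site.active => walk n y ζ

lemma walk_mono {N : ℕ} (n : ℕ) : ∀ (x : Fin N) (ζ ζ' : Config N),
    walk n x ζ (some ζ') ≤ walk (n + 1) x ζ (some ζ') := by
  induction n with
  | zero => intro x ζ ζ'; simp [walk]
  | succ n ih =>
    intro x ζ ζ'
    rw [walk, walk, PMF.bind_apply, PMF.bind_apply]
    refine ENNReal.tsum_le_tsum fun w => mul_le_mul_right ?_ _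
    rcases w with _ | y
    · exact le_rfl
    · dsimp only
      cases ζ y
      · exact le_rfl
      · exact ih _ _ _
      · exact ih _ _ _

lemma jump_none {N : ℕ} (x : Fin N) : jump x none = (N : ℝ≥0∞)⁻¹ := by
  rw [jump, PMF.uniformOfFinset_apply_of_mem _ (by simp)]
  simp

lemma walk_none_le {N : ℕ} (n : ℕ) : ∀ (x : Fin N) (ζ : Config N),
    walk n x ζ none ≤ (1 - (N : ℝ≥0∞)⁻¹) ^ n := by
  induction n with
  | zero => intro x ζ; simp [walk]
  | succ n ih =>
    intro x ζ
    rw [walk, PMF.bind_apply, tsum_fintype, Fintype.sum_option]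
    have hsum : ∑ y : Fin N, jump x (some y) = 1 - (N : ℝ≥0∞)⁻¹ := by
      have h := (jump x).tsum_coe
      rw [tsum_fintype, Fintype.sum_option, jump_none] at h
      have hN : (N : ℝ≥0∞)⁻¹ ≠ ⊤ := by
        have := x.pos
        simp only [ne_eq, ENNReal.inv_eq_top, Nat.cast_eq_zero]
        omega
      rw [← h, ENNReal.add_sub_cancel_left hN]
    have h0 : (PMF.pure (some ζ) : PMF (Option (Config N))) none = 0 := by simp
    dsimp only
    rw [h0, mul_zero, zero_add, pow_succ', ← hsum, Finset.sum_mul]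
    refine Finset.sum_le_sum fun y _ => mul_le_mul_right ?_ _
    cases ζ y
    · simp
    · exact (ih _ _).trans (by rw [hsum])
    · exact (ih _ _).trans (by rw [hsum])

/-- The walking particle stops almost surely. -/
lemma walk_total {N : ℕ} (x : Fin N) (ζ : Config N) :
    ∑ ζ' : Config N, ⨆ n, walk n x ζ (some ζ') = 1 := by
  rw [ENNReal.finsetSum_iSup_of_monotone
    (fun ζ' => monotone_nat_of_le_succ fun n => walk_mono n x ζ ζ')]
  have hs : ∀ n, walk n x ζ none + ∑ ζ' : Config N, walk n x ζ (some ζ') = 1 := by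
    intro n
    have h := (walk n x ζ).tsum_coe
    rwa [tsum_fintype, Fintype.sum_option] at h
  apply le_antisymm
  · exact iSup_le fun n => by rw [← hs n]; exact le_add_self
  · have hr : (1 - (N : ℝ≥0∞)⁻¹) < 1 := by
      refine ENNReal.sub_lt_self (by simp) (by simp) (by simp)
    have ht := ENNReal.tendsto_pow_atTop_nhds_zero_of_lt_one hr
    refine ENNReal.le_of_forall_pos_le_add fun ε hε _ => ?_
    obtain ⟨n, hn⟩ := (ht.eventually (Iic_mem_nhds
      (show (0 : ℝ≥0∞) < ε by exact_mod_cast hε))).exists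
    rw [← hs n, add_comm]
    exact add_le_add (le_iSup (fun n => ∑ ζ' : Config N, walk n x ζ (some ζ')) n)
      ((walk_none_le n x ζ).trans hn)

/-- The law of the configuration that results when the particle at `x` moves: it leaves `x` and
walks, with no bound on the number of jumps, until it stops. -/
def move {N : ℕ} (η : Config N) (x : Fin N) : PMF (Config N) :=
  PMF.ofFintype (fun η' => ⨆ n, walk n x (Function.update η x Site.empty) (some η'))
    (walk_total _ _)

/-- The coin that shows `true` (fall asleep) with probability `λ / (1 + λ)` and `false` (move)
with probability `1 / (1 + λ)`. -/
def sleepCoin (lam : ℝ≥0) : PMF Bool :=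
  PMF.ofFintype (fun b => ((if b then lam / (1 + lam) else 1 / (1 + lam) : ℝ≥0) : ℝ≥0∞)) (by
    rw [Fintype.sum_bool, ← ENNReal.coe_add, ← ENNReal.coe_one, ENNReal.coe_inj]
    simp only [if_true, Bool.false_eq_true, if_false]
    rw [← add_div, add_comm lam 1, div_self (by positivity)])

/-- The set of vertices that host an active particle. -/
def activeSites {N : ℕ} (η : Config N) : Finset (Fin N) :=
  Finset.univ.filter fun x => η x = Site.active

/-- The set of vertices that host a particle. -/
def occupiedSites {N : ℕ} (η : Config N) : Finset (Fin N) :=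
  Finset.univ.filter fun x => η x ≠ Site.empty

open Classical in
/-- One update of activated random walk: a configuration without active particles does not change;
otherwise a uniformly chosen active particle falls asleep with probability `λ / (1 + λ)` and
moves with probability `1 / (1 + λ)`. -/
def step {N : ℕ} (lam : ℝ≥0) (η : Config N) : PMF (Config N) :=
  if h : (activeSites η).Nonempty then
    (PMF.uniformOfFinset (activeSites η) h).bind fun x =>
      (sleepCoin lam).bind fun b =>
        if b then PMF.pure (Function.update η x Site.asleep) else move η x
  else PMF.pure η

/-- Trajectories of the particle system, indexed by discrete time. -/
abbrev Path (N : ℕ) : Type := ℕ → Config N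

/-- The transition kernel of the particle system, as a kernel from the past up to time `t` to the
configuration at time `t + 1`; it uses the configuration at time `t` only. -/
def stepKernel (N : ℕ) (lam : ℝ≥0) (t : ℕ) :
    Kernel ((i : Finset.Iic t) → (fun _ : ℕ => Config N) i) (Config N) :=
  Kernel.ofFunOfCountable fun past => (step lam (past ⟨t, by simp⟩)).toMeasure

instance (N : ℕ) (lam : ℝ≥0) (t : ℕ) : IsMarkovKernel (stepKernel N lam t) :=
  ⟨fun past => PMF.toMeasure.isProbabilityMeasure (step lam (past ⟨t, by simp⟩))⟩

/-- The law of the Markov chain of configurations with update rule `step lam`, started with an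
active particle at each of the `N` vertices. -/
def law (N : ℕ) (lam : ℝ≥0) : Measure (Path N) :=
  Kernel.trajMeasure (X := fun _ : ℕ => Config N)
    (Measure.dirac fun _ : Fin N => Site.active) (stepKernel N lam)

instance (N : ℕ) (lam : ℝ≥0) : IsProbabilityMeasure (law N lam) := by
  unfold law; infer_instance

/-- The total number `X_t` of particles. -/
def X {N : ℕ} (t : ℕ) (ω : Path N) : ℕ := (occupiedSites (ω t)).card

/-- The number `Y_t` of active particles. -/
def Y {N : ℕ} (t : ℕ) (ω : Path N) : ℕ := (activeSites (ω t)).card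

/-- The deviation `S_t = Y_t - ((1 + λ) X_t - λ N)`. -/
def S {N : ℕ} (lam : ℝ≥0) (t : ℕ) (ω : Path N) : ℝ :=
  (Y t ω : ℝ) - ((1 + (lam : ℝ)) * (X t ω : ℝ) - (lam : ℝ) * (N : ℝ))

lemma measurable_XY {N : ℕ} (t : ℕ) : Measurable fun ω : Path N => (X t ω, Y t ω) :=
  (measurable_of_countable fun η : Config N =>
    ((occupiedSites η).card, (activeSites η).card)).comp (measurable_pi_apply t)

/-- The canonical filtration `F_t = σ((X_s, Y_s) : 0 ≤ s ≤ t)` of the chain of particle counts. -/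
def canonicalFiltration (N : ℕ) : Filtration ℕ (inferInstance : MeasurableSpace (Path N)) :=
  Filtration.natural (fun t (ω : Path N) => (X t ω, Y t ω))
    fun t => (measurable_XY t).stronglyMeasurable

/-- `τ = inf {t ≥ 0 : Y_t = 0}`, which is `⊤` if there is no such `t`. -/
def tau {N : ℕ} (ω : Path N) : ℕ∞ := ⨅ (t : ℕ) (_ : Y t ω = 0), (t : ℕ∞)

/-- `σ₂ = inf {t ≥ 0 : S_t ≥ √N}`, which is `⊤` if there is no such `t`. -/
def sigma2 {N : ℕ} (lam : ℝ≥0) (ω : Path N) : ℕ∞ :=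
  ⨅ (t : ℕ) (_ : √(N : ℝ) ≤ S lam t ω), (t : ℕ∞)

/-- The time shift by `t`. -/
def shift {N : ℕ} (t : ℕ) (ω : Path N) : Path N := fun s => ω (t + s)

/-- The event `{T < ∞, τ(T) < σ₂(T)}` that, after the time `T`, the chain is absorbed (`Y` hits
`0`) before `S` reaches `√N`; here `τ(T)` and `σ₂(T)` are `τ` and `σ₂` of the path shifted
by `T`. -/
def absorbedFirst {N : ℕ} (lam : ℝ≥0) (T : Path N → WithTop ℕ) : Set (Path N) :=
  {ω | ∃ t : ℕ, T ω = (t : WithTop ℕ) ∧ tau (shift t ω) < sigma2 lam (shift t ω)}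

/-- The conditional probability `P_N[τ(T) < σ₂(T) | F_T]`, for a stopping time `T`. -/
def condProbAbsorbedFirst {N : ℕ} (lam : ℝ≥0) {T : Path N → WithTop ℕ}
    (hT : IsStoppingTime (canonicalFiltration N) T) : Path N → ℝ :=
  (law N lam)[(absorbedFirst lam T).indicator (fun _ => (1 : ℝ)) | hT.measurableSpace]

/-- The critical density `ρ_c = λ / (1 + λ)`. -/
def rhoc (lam : ℝ≥0) : ℝ := (lam : ℝ) / (1 + (lam : ℝ))

/-- The constant `a = √λ / (1 + λ)`. -/
def aConst (lam : ℝ≥0) : ℝ := √(lam : ℝ) / (1 + (lam : ℝ))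

end ARW

end

noncomputable section

namespace ARW

/-! Put `U = S / √N` and let `b = ((1 + λ) X - λ N) / √N`. Near the critical line a step has mean
change of `S` close to `-S / N` and second moment close to `2 λ`. So, with `N` steps as unit of
time, `U` resembles the Ornstein-Uhlenbeck process `dU = -U ds + √(2λ) dW`, whose scale function
`scaleFun λ` is the primitive of `exp (w² / (2λ))`. Absorption means `Y = 0`, that is `U = -b`. From
`U` near `0` the level `-b` is reached before `1` with probability `exp (-b² / (2λ))`, up to factors
`N ^ o(1)`. For `X = ρ_c N + α √(N log N)` this is `N ^ (-(α / a)² / 2)`, because `(1 + λ) a = √λ`;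
the exponent crosses `1/2` at `α = a`.

The rigorous version uses supermartingales for the discrete chain. A Taylor expansion shows that
`scaleFun` of `U` is harmonic up to relative errors of order `log N / √N`. Moving the centre by `σ =
±1`, i.e. using `w = U - σ`, creates a drift of definite sign, of relative size `1`, that absorbs
all errors (`exists_drift_nonpos`). The shift costs only `exp (O(√(log N))) = N ^ o(1)`.

For (i), `σ = 1` and the truncated function `min (scaleFun w) 0`, suitably normalised, dominates the
probability of not being absorbed (`exists_ev_step_min_le`, `exists_le_absorbProb`). Losing
particles does no harm: `U` stays above `-b` for the initial `b`. For (ii), `σ = -1`, and lost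
particles do matter, since they bring the absorbing level closer. The function `max (scaleFun 3 -
scaleFun w) 0` therefore carries a weight `exp (γ (x₀ - x))`, which compensates for them by
convexity of the square and whose cost is small because a step loses a particle with probability of
order `1 / N` only (`exists_ev_step_max_le`, `exists_absorbProb_le`).

The one-step estimates rest on `ev_step_le`, which solves the recursion for the number of sleepers
woken by a walk, with a quadratic main part and an exponential error. All bounds hold for every
configuration with the given counts. The Markov property of configurations thus suffices to pass to
stopping times of the coarser filtration (`real_inter_absorbedWithin`, `condProb_le`,
`le_condProb`). -/

/-- The expectation of a real function under a probability mass function on a finite type. -/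
def ev {α : Type*} [Fintype α] (p : PMF α) (f : α → ℝ) : ℝ := ∑ a, (p a).toReal * f a

/-! ### Expectations on finite types -/

section ev

variable {α β : Type*} [Fintype α] [Fintype β]

lemma sum_toReal_eq_one (p : PMF α) : ∑ a, (p a).toReal = 1 := by
  rw [← ENNReal.toReal_sum (fun a _ => p.apply_ne_top a), ← tsum_fintype (L := .unconditional _),
    p.tsum_coe, ENNReal.toReal_one]

lemma ev_pure (a : α) (f : α → ℝ) : ev (PMF.pure a) f = f a := by
  classical
  rw [ev, Finset.sum_eq_single a]
  · simp
  · intro b _ hb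
    simp [PMF.pure_apply, hb]
  · simp

lemma ev_bind (p : PMF α) (q : α → PMF β) (f : β → ℝ) :
    ev (p.bind q) f = ev p fun a => ev (q a) f := by
  have h : ∀ b, ((p.bind q) b).toReal = ∑ a, (p a).toReal * (q a b).toReal := by
    intro b
    rw [PMF.bind_apply, tsum_fintype, ENNReal.toReal_sum]
    · simp [ENNReal.toReal_mul]
    · exact fun a _ => ENNReal.mul_ne_top (p.apply_ne_top a) ((q a).apply_ne_top b)
  simp only [ev, h, Finset.sum_mul, Finset.mul_sum]
  rw [Finset.sum_comm]
  simp only [mul_assoc]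

lemma ev_mono (p : PMF α) {f g : α → ℝ} (h : ∀ a, f a ≤ g a) : ev p f ≤ ev p g :=
  Finset.sum_le_sum fun a _ => mul_le_mul_of_nonneg_left (h a) ENNReal.toReal_nonneg

lemma ev_const (p : PMF α) (c : ℝ) : ev p (fun _ => c) = c := by
  rw [ev, ← Finset.sum_mul, sum_toReal_eq_one, one_mul]

lemma ev_add (p : PMF α) (f g : α → ℝ) : ev p (fun a => f a + g a) = ev p f + ev p g := by
  simp only [ev, mul_add, Finset.sum_add_distrib]

lemma ev_sub (p : PMF α) (f g : α → ℝ) : ev p (fun a => f a - g a) = ev p f - ev p g := by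
  simp only [ev, mul_sub, Finset.sum_sub_distrib]

lemma ev_mul_left (p : PMF α) (c : ℝ) (f : α → ℝ) : ev p (fun a => c * f a) = c * ev p f := by
  rw [ev, ev, Finset.mul_sum]
  exact Finset.sum_congr rfl fun a _ => by ring

lemma ev_nonneg (p : PMF α) {f : α → ℝ} (h : ∀ a, 0 ≤ f a) : 0 ≤ ev p f :=
  Finset.sum_nonneg fun a _ => mul_nonneg ENNReal.toReal_nonneg (h a)

lemma ev_le_of_forall_le (p : PMF α) {f : α → ℝ} {c : ℝ} (h : ∀ a, f a ≤ c) : ev p f ≤ c :=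
  (ev_mono p h).trans_eq (ev_const p c)

lemma ev_uniformOfFinset (s : Finset α) (hs : s.Nonempty) (f : α → ℝ) :
    ev (PMF.uniformOfFinset s hs) f = (∑ a ∈ s, f a) / s.card := by
  classical
  rw [ev, Finset.sum_div, ← Finset.sum_subset (Finset.subset_univ s)]
  · refine Finset.sum_congr rfl fun a ha => ?_
    rw [PMF.uniformOfFinset_apply_of_mem _ ha, ENNReal.toReal_inv, ENNReal.toReal_natCast]
    ring
  · intro a _ ha
    rw [PMF.uniformOfFinset_apply_of_notMem _ ha]
    simp

end ev

/-! ### Particle counts and absorption within a finite horizon -/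

/-- The number of particles of a configuration. -/
def occ {N : ℕ} (η : Config N) : ℕ := (occupiedSites η).card

/-- The number of active particles of a configuration. -/
def act {N : ℕ} (η : Config N) : ℕ := (activeSites η).card

/-- The deviation of `y` active particles from the line `y = (1 + λ) x - λ N`. -/
def dev (lam : ℝ≥0) (N x y : ℕ) : ℝ :=
  (y : ℝ) - ((1 + (lam : ℝ)) * (x : ℝ) - (lam : ℝ) * (N : ℝ))

/-- The probability that, from the configuration `η`, the chain loses its last active particle within
`n` steps and before its deviation reaches `√N`. -/
def absorbProb {N : ℕ} (lam : ℝ≥0) : ℕ → Config N → ℝ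
  | 0, η => if √(N : ℝ) ≤ dev lam N (occ η) (act η) then 0 else if act η = 0 then 1 else 0
  | n + 1, η => if √(N : ℝ) ≤ dev lam N (occ η) (act η) then 0 else if act η = 0 then 1 else
      ev (step lam η) (absorbProb lam n)

lemma absorbProb_nonneg {N : ℕ} (lam : ℝ≥0) (n : ℕ) (η : Config N) : 0 ≤ absorbProb lam n η := by
  induction n generalizing η with
  | zero => rw [absorbProb]; split_ifs <;> norm_num
  | succ n ih =>
    rw [absorbProb]; split_ifs
    · norm_num
    · norm_num
    · exact ev_nonneg _ ih

lemma absorbProb_le_one {N : ℕ} (lam : ℝ≥0) (n : ℕ) (η : Config N) : absorbProb lam n η ≤ 1 := by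
  induction n generalizing η with
  | zero => rw [absorbProb]; split_ifs <;> norm_num
  | succ n ih =>
    rw [absorbProb]; split_ifs
    · norm_num
    · norm_num
    · exact ev_le_of_forall_le _ ih

/-- The event that, after time `t`, absorption occurs within `n` steps and before the deviation
reaches `√N`. -/
def absorbedWithin {N : ℕ} (lam : ℝ≥0) (n t : ℕ) : Set (Path N) :=
  {ω | ∃ j ≤ n, act (ω (t + j)) = 0 ∧
    ∀ i ≤ j, dev lam N (occ (ω (t + i))) (act (ω (t + i))) < √(N : ℝ)}

/-! ### The Markov property of the configuration chain -/

section markov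

variable {N : ℕ} {lam : ℝ≥0}

lemma measurable_comp_coord {α : Type*} [MeasurableSpace α] (f : Config N → α) (t : ℕ) :
    Measurable fun ω : Path N => f (ω t) :=
  (measurable_of_countable f).comp (measurable_pi_apply t)

lemma integrable_comp_coord (f : Config N → ℝ) (t : ℕ) :
    Integrable (fun ω : Path N => f (ω t)) (law N lam) := by
  refine Integrable.of_bound (measurable_comp_coord f t).aestronglyMeasurable
    (∑ η, ‖f η‖) (Filter.Eventually.of_forall fun ω => ?_)
  exact Finset.single_le_sum (f := fun η => ‖f η‖) (fun _ _ => norm_nonneg _) (Finset.mem_univ _)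

lemma measurableSet_coord (p : Config N → Prop) (t : ℕ) :
    MeasurableSet {ω : Path N | p (ω t)} :=
  measurable_comp_coord p t (measurableSet_setOfPred.2 measurable_id)

lemma absorbedWithin_eq (n t : ℕ) :
    absorbedWithin (N := N) lam n t = ⋃ j ∈ Finset.Iic n, {ω | act (ω (t + j)) = 0} ∩
      ⋂ i ∈ Finset.Iic j, {ω | dev lam N (occ (ω (t + i))) (act (ω (t + i))) < √(N : ℝ)} := by
  ext ω
  simp only [absorbedWithin, Set.mem_ofPred_eq, Set.mem_iUnion, Set.mem_inter_iff, Set.mem_iInter,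
    Finset.mem_Iic, exists_prop]

lemma measurableSet_absorbedWithin (n t : ℕ) :
    MeasurableSet (absorbedWithin (N := N) lam n t) := by
  rw [absorbedWithin_eq]
  refine Finset.measurableSet_biUnion _ fun j _ => MeasurableSet.inter
    (measurableSet_coord (fun η => act η = 0) (t + j)) (Finset.measurableSet_biInter _ fun i _ =>
      measurableSet_coord (fun η => dev lam N (occ η) (act η) < √(N : ℝ)) (t + i))

lemma absorbedWithin_mono {m n : ℕ} (h : m ≤ n) (t : ℕ) :
    absorbedWithin (N := N) lam m t ⊆ absorbedWithin lam n t :=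
  fun _ ⟨j, hj, hω⟩ => ⟨j, hj.trans h, hω⟩

lemma mem_absorbedWithin_succ {n t : ℕ} {ω : Path N} :
    ω ∈ absorbedWithin lam (n + 1) t ↔
      dev lam N (occ (ω t)) (act (ω t)) < √(N : ℝ) ∧
        (act (ω t) = 0 ∨ ω ∈ absorbedWithin lam n (t + 1)) := by
  constructor
  · rintro ⟨j, hj, h0, hS⟩
    refine ⟨by simpa using hS 0 (Nat.zero_le j), ?_⟩
    rcases j with _ | j
    · exact Or.inl (by simpa using h0)
    · refine Or.inr ⟨j, by omega, ?_, fun i hi => ?_⟩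
      · rwa [add_assoc, add_comm 1 j]
      · rw [add_assoc, add_comm 1 i]
        exact hS (i + 1) (by omega)
  · rintro ⟨hS, h | ⟨j, hj, h0, hS'⟩⟩
    · refine ⟨0, by omega, by simpa using h, fun i hi => ?_⟩
      obtain rfl : i = 0 := by omega
      simpa using hS
    · refine ⟨j + 1, by omega, ?_, fun i hi => ?_⟩
      · rwa [add_comm j 1, ← add_assoc]
      · rcases i with _ | i
        · simpa using hS
        · rw [add_comm i 1, ← add_assoc]
          exact hS' i (by omega)

/-- The one-step Markov property. -/
lemma setIntegral_next (t : ℕ) {A : Set ((i : Finset.Iic t) → (fun _ : ℕ => Config N) i)}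
    (hA : MeasurableSet A) (g : Config N → ℝ) :
    ∫ ω in Preorder.frestrictLe t ⁻¹' A, g (ω (t + 1)) ∂(law N lam) =
      ∫ ω in Preorder.frestrictLe t ⁻¹' A, ev (step lam (ω t)) g ∂(law N lam) := by
  have hkey := Kernel.map_frestrictLe_trajMeasure_compProd_eq_map_trajMeasure
    (X := fun _ : ℕ => Config N) (κ := stepKernel N lam)
    (μ₀ := Measure.dirac fun _ : Fin N => Site.active) (a := t)
  change Measure.map _ (law N lam) ⊗ₘ _ = Measure.map _ (law N lam) at hkey
  have hm1 : Measurable (Preorder.frestrictLe (π := fun _ : ℕ => Config N) t) := by fun_prop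
  have hm2 : Measurable fun x : Path N => (Preorder.frestrictLe (π := fun _ : ℕ => Config N) t x,
    x (t + 1)) := by fun_prop
  have hgm : Measurable fun x : ((i : Finset.Iic t) → (fun _ : ℕ => Config N) i) × Config N =>
      g x.2 := (measurable_of_countable g).comp measurable_snd
  have hprod : MeasurableSet (A ×ˢ (Set.univ : Set (Config N))) := hA.prod MeasurableSet.univ
  have h1 : ∫ x in A ×ˢ Set.univ, g x.2
      ∂(Measure.map (fun x : Path N => (Preorder.frestrictLe (π := fun _ : ℕ => Config N) t x,
        x (t + 1))) (law N lam)) =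
      ∫ ω in Preorder.frestrictLe t ⁻¹' A, g (ω (t + 1)) ∂(law N lam) := by
    rw [setIntegral_map hprod hgm.aestronglyMeasurable hm2.aemeasurable]
    congr 2
    ext ω
    simp
  have : IsProbabilityMeasure (Measure.map (Preorder.frestrictLe
    (π := fun _ : ℕ => Config N) t) (law N lam)) := Measure.isProbabilityMeasure_map hm1.aemeasurable
  rw [← h1, ← hkey, Measure.setIntegral_compProd hA MeasurableSet.univ, setIntegral_map hA]
  · refine integral_congr_ae (Filter.Eventually.of_forall fun ω => ?_)
    simp only [setIntegral_univ]
    have : (stepKernel N lam t) (Preorder.frestrictLe t ω) = (step lam (ω t)).toMeasure := rfl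
    rw [this, PMF.integral_eq_sum]
    rfl
  · exact (measurable_of_countable _).aestronglyMeasurable
  · exact hm1.aemeasurable
  · refine (Integrable.of_bound hgm.aestronglyMeasurable
      (∑ η, ‖g η‖) (Filter.Eventually.of_forall fun x => ?_)).integrableOn
    exact Finset.single_le_sum (f := fun η => ‖g η‖) (fun _ _ => norm_nonneg _) (Finset.mem_univ _)

/-- The events that are determined by the configurations up to time `t`. -/
abbrev past (N t : ℕ) : MeasurableSpace (Path N) :=
  MeasurableSpace.comap (Preorder.frestrictLe (π := fun _ : ℕ => Config N) t) inferInstance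

lemma past_le (t : ℕ) : past N t ≤ (inferInstance : MeasurableSpace (Path N)) :=
  Measurable.comap_le (by fun_prop)

lemma measurableSet_past_coord (p : Config N → Prop) {s t : ℕ} (h : s ≤ t) :
    MeasurableSet[past N t] {ω : Path N | p (ω s)} := by
  refine ⟨{x | p (x ⟨s, Finset.mem_Iic.2 h⟩)}, ?_, rfl⟩
  have hm : Measurable fun x : (i : Finset.Iic t) → (fun _ : ℕ => Config N) i =>
      p (x ⟨s, Finset.mem_Iic.2 h⟩) := measurable_of_countable _
  exact measurableSet_setOfPred.2 hm

lemma past_mono {s t : ℕ} (h : s ≤ t) : past N s ≤ past N t := by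
  have : Preorder.frestrictLe (π := fun _ : ℕ => Config N) s =
      Preorder.frestrictLe₂ h ∘ Preorder.frestrictLe t := rfl
  rw [past, past, this, ← MeasurableSpace.comap_comp]
  refine MeasurableSpace.comap_mono ?_
  exact Measurable.comap_le (by fun_prop)

/-- The Markov property for the absorption events. -/
lemma real_inter_absorbedWithin (n t : ℕ) {B : Set (Path N)} (hB : MeasurableSet[past N t] B) :
    (law N lam).real (B ∩ absorbedWithin lam n t) =
      ∫ ω in B, absorbProb lam n (ω t) ∂(law N lam) := by
  induction n generalizing t B with
  | zero =>
    have h0 : absorbedWithin lam 0 t = {ω : Path N | ¬ √(N : ℝ) ≤ dev lam N (occ (ω t)) (act (ω t)) ∧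
        act (ω t) = 0} := by
      ext ω
      simp [absorbedWithin, and_comm]
    have h1 : (fun ω : Path N => absorbProb lam 0 (ω t)) =
        (absorbedWithin lam 0 t).indicator fun _ => (1 : ℝ) := by
      ext ω
      rw [h0]
      simp only [absorbProb, Set.indicator, Set.mem_ofPred_eq]
      split_ifs <;> first | rfl | tauto
    rw [h1, setIntegral_indicator (measurableSet_absorbedWithin 0 t), setIntegral_const]
    simp
  | succ n ih =>
    set D : Set (Path N) := {ω | ¬ √(N : ℝ) ≤ dev lam N (occ (ω t)) (act (ω t)) ∧ act (ω t) = 0}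
    set C : Set (Path N) := {ω | ¬ √(N : ℝ) ≤ dev lam N (occ (ω t)) (act (ω t)) ∧ ¬ act (ω t) = 0}
    have hDm : MeasurableSet[past N t] D := measurableSet_past_coord
      (fun η => ¬ √(N : ℝ) ≤ dev lam N (occ η) (act η) ∧ act η = 0) le_rfl
    have hCm : MeasurableSet[past N t] C := measurableSet_past_coord
      (fun η => ¬ √(N : ℝ) ≤ dev lam N (occ η) (act η) ∧ ¬ act η = 0) le_rfl
    have hBm := past_le t _ hB
    have hD := past_le t _ hDm
    have hC := past_le t _ hCm
    have hBC : MeasurableSet[past N t] (B ∩ C) := MeasurableSet.inter hB hCm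
    have hsplit : B ∩ absorbedWithin lam (n + 1) t =
        (B ∩ D) ∪ ((B ∩ C) ∩ absorbedWithin lam n (t + 1)) := by
      ext ω
      simp only [Set.mem_inter_iff, mem_absorbedWithin_succ, Set.mem_union, D, C, Set.mem_ofPred_eq,
        not_le]
      tauto
    have hdisj : Disjoint (B ∩ D) ((B ∩ C) ∩ absorbedWithin lam n (t + 1)) := by
      rw [Set.disjoint_left]
      rintro ω ⟨_, hω⟩ ⟨⟨_, hω'⟩, _⟩
      exact hω'.2 hω.2
    have h1 : (fun ω : Path N => absorbProb lam (n + 1) (ω t)) =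
        fun ω => D.indicator (fun _ => (1 : ℝ)) ω +
          C.indicator (fun ω => ev (step lam (ω t)) (absorbProb lam n)) ω := by
      ext ω
      simp only [absorbProb, Set.indicator, Set.mem_ofPred_eq, C, D]
      split_ifs <;> first | (simp; done) | tauto
    have hI : Integrable (fun ω : Path N => ev (step lam (ω t)) (absorbProb lam n)) (law N lam) :=
      integrable_comp_coord (fun η => ev (step lam η) (absorbProb lam n)) t
    rw [hsplit, measureReal_union hdisj
      ((hBm.inter hC).inter (measurableSet_absorbedWithin n (t + 1))),
      ih (t + 1) (past_mono (Nat.le_succ t) _ hBC), h1, integral_add, setIntegral_indicator hD,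
      setIntegral_indicator hC, setIntegral_const, smul_eq_mul, mul_one]
    · congr 1
      obtain ⟨A, hA, hAB⟩ := hBC
      rw [← hAB]
      exact setIntegral_next t hA (absorbProb lam n)
    · exact ((integrable_const _).indicator hD).integrableOn
    · exact (hI.indicator hC).integrableOn

end markov

/-! ### Pointwise bounds on conditional expectations from set integrals -/

section condexp

variable {Ω : Type*} {m m0 : MeasurableSpace Ω} {μ : Measure Ω} [IsFiniteMeasure μ]

/-- The part of `s` where the conditional expectation exceeds `c` is itself `m`-measurable; testing
the hypothesis on it shows that it is null. -/
lemma condExp_le_of_setIntegral_le (hm : m ≤ m0) {f : Ω → ℝ} (hf : Integrable f μ) {c : ℝ}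
    {s : Set Ω} (hs : MeasurableSet[m] s)
    (h : ∀ B, MeasurableSet[m] B → B ⊆ s → ∫ x in B, f x ∂μ ≤ c * μ.real B) :
    ∀ᵐ x ∂μ, x ∈ s → (μ[f|m]) x ≤ c := by
  set B : Set Ω := s ∩ {x | c < (μ[f|m]) x}
  have hB : MeasurableSet[m] B :=
    MeasurableSet.inter hs (stronglyMeasurable_condExp.measurable measurableSet_Ioi)
  have h1 := h B hB Set.inter_subset_left
  rw [← setIntegral_condExp hm hf hB] at h1
  have hint : IntegrableOn (fun x => (μ[f|m]) x - c) B μ :=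
    (integrable_condExp.sub (integrable_const c)).integrableOn
  have h2 : ∫ x in B, ((μ[f|m]) x - c) ∂μ ≤ 0 := by
    rw [integral_sub integrable_condExp.integrableOn (integrable_const c), setIntegral_const,
      smul_eq_mul]
    linarith
  have hpos : ∀ x ∈ B, 0 < (μ[f|m]) x - c := fun x hx => sub_pos.2 hx.2
  have hμ : μ B = 0 := by
    by_contra hne
    have := (setIntegral_pos_iff_support_of_nonneg_ae
      ((ae_restrict_iff' (hm _ hB)).2 (Filter.Eventually.of_forall fun x hx => (hpos x hx).le))
      hint).2 (by
        refine lt_of_lt_of_le (pos_iff_ne_zero.2 hne) (measure_mono fun x hx => ⟨?_, hx⟩)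
        exact (hpos x hx).ne')
    linarith
  filter_upwards [measure_eq_zero_iff_ae_notMem.1 hμ] with x hx hxs
  by_contra hlt
  exact hx ⟨hxs, not_le.1 hlt⟩

lemma le_condExp_of_le_setIntegral (hm : m ≤ m0) {f : Ω → ℝ} (hf : Integrable f μ) {c : ℝ}
    {s : Set Ω} (hs : MeasurableSet[m] s)
    (h : ∀ B, MeasurableSet[m] B → B ⊆ s → c * μ.real B ≤ ∫ x in B, f x ∂μ) :
    ∀ᵐ x ∂μ, x ∈ s → c ≤ (μ[f|m]) x := by
  have h1 := condExp_le_of_setIntegral_le hm hf.neg (c := -c) hs fun B hB hBs => by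
    have := h B hB hBs
    simp only [Pi.neg_apply, integral_neg]
    linarith
  filter_upwards [h1, condExp_neg f m (μ := μ)] with x hx hneg hxs
  have := hx hxs
  rw [hneg, Pi.neg_apply] at this
  linarith

end condexp

/-! ### Passage to stopping times -/

section stopped

variable {N : ℕ} {lam : ℝ≥0}

/-- The Markov property is available for the past of the configurations. Through this inclusion it
applies to events of the counts, without showing that the counts form a Markov chain. -/
lemma canonicalFiltration_le_past (t : ℕ) : canonicalFiltration N t ≤ past N t := by
  change (⨆ j, ⨆ (_ : j ≤ t), MeasurableSpace.comap _ _) ≤ _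
  refine iSup₂_le fun j hj => ?_
  rintro _ ⟨B, _, rfl⟩
  exact measurableSet_past_coord (fun η => (occ η, act η) ∈ B) hj

lemma measurableSet_canonicalFiltration (K : ℕ → ℕ → Prop) (t : ℕ) :
    MeasurableSet[canonicalFiltration N t] {ω : Path N | K (X t ω) (Y t ω)} := by
  refine (le_iSup₂_of_le t le_rfl le_rfl :
    MeasurableSpace.comap (fun ω : Path N => (X t ω, Y t ω)) _ ≤ canonicalFiltration N t) _ ?_
  exact ⟨{q | K q.1 q.2}, MeasurableSet.of_discrete, rfl⟩

lemma mem_iUnion_absorbedWithin {t : ℕ} {ω : Path N} :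
    ω ∈ ⋃ n, absorbedWithin lam n t ↔ tau (shift t ω) < sigma2 lam (shift t ω) := by
  constructor
  · intro h
    obtain ⟨n, j, _, h0, hS⟩ := Set.mem_iUnion.1 h
    refine lt_of_le_of_lt (iInf₂_le j h0) (lt_of_lt_of_le (b := ((j + 1 : ℕ) : ℕ∞)) ?_ ?_)
    · exact_mod_cast Nat.lt_succ_self j
    · refine le_iInf₂ fun i hi => ?_
      have : j < i := by
        by_contra hle
        exact absurd hi (not_le.2 (hS i (not_lt.1 hle)))
      exact_mod_cast this
  · intro h
    rw [tau, iInf_lt_iff] at h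
    obtain ⟨j, h⟩ := h
    rw [iInf_lt_iff] at h
    obtain ⟨h0, h⟩ := h
    refine Set.mem_iUnion.2 ⟨j, j, le_rfl, h0, fun i hi => ?_⟩
    by_contra hle
    have h1 : sigma2 lam (shift t ω) ≤ (i : ℕ∞) := iInf₂_le (f := fun (s : ℕ) (_ : √(N : ℝ) ≤ S lam s (shift t ω)) => (s : ℕ∞)) i
      (not_lt.1 hle)
    have h2 : (i : ℕ∞) ≤ j := by exact_mod_cast hi
    exact absurd h (not_lt.2 (h1.trans h2))

lemma measurableSet_absorbedFirst {T : Path N → WithTop ℕ}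
    (hT : IsStoppingTime (canonicalFiltration N) T) : MeasurableSet (absorbedFirst lam T) := by
  have : absorbedFirst lam T = ⋃ t : ℕ, {ω | T ω = t} ∩ ⋃ n, absorbedWithin lam n t := by
    ext ω
    simp only [absorbedFirst, Set.mem_ofPred_eq, Set.mem_iUnion (s := fun t : ℕ => _ ∩ _),
      Set.mem_inter_iff, mem_iUnion_absorbedWithin]
  rw [this]
  exact MeasurableSet.iUnion fun t => MeasurableSet.inter
    ((canonicalFiltration N).le t _ (hT.measurableSet_eq t))
    (MeasurableSet.iUnion fun n => measurableSet_absorbedWithin n t)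

/-- On `{T = t}` the absorption event is the increasing union of its finite-horizon versions, and
the Markov property evaluates each of these. -/
lemma setIntegral_absorbedFirst {T : Path N → WithTop ℕ}
    (hT : IsStoppingTime (canonicalFiltration N) T) {t : ℕ} {B : Set (Path N)}
    (hB : MeasurableSet[canonicalFiltration N t] B) (hBT : B ⊆ {ω | T ω = t}) :
    Filter.Tendsto (fun n => ∫ ω in B, absorbProb lam n (ω t) ∂(law N lam)) Filter.atTop
      (nhds (∫ ω in B, (absorbedFirst lam T).indicator (fun _ => (1 : ℝ)) ω ∂(law N lam))) := by
  have h1 : B ∩ absorbedFirst lam T = ⋃ n, B ∩ absorbedWithin lam n t := by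
    rw [← Set.inter_iUnion]
    ext ω
    refine and_congr_right fun hω => ?_
    rw [mem_iUnion_absorbedWithin]
    have hT' : T ω = t := hBT hω
    constructor
    · rintro ⟨s, hs, h⟩
      have : s = t := by exact_mod_cast hs.symm.trans hT'
      rwa [← this]
    · exact fun h => ⟨t, hT', h⟩
  rw [setIntegral_indicator (measurableSet_absorbedFirst hT), setIntegral_const, smul_eq_mul,
    mul_one, h1]
  simp_rw [← real_inter_absorbedWithin _ t (canonicalFiltration_le_past t _ hB)]
  refine (ENNReal.tendsto_toReal (measure_ne_top _ _)).comp
    (tendsto_measure_iUnion_atTop fun m n hmn => ?_)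
  exact Set.inter_subset_inter_right _ (absorbedWithin_mono hmn t)

lemma ae_restrict_condProb {T : Path N → WithTop ℕ}
    (hT : IsStoppingTime (canonicalFiltration N) T) (t : ℕ) :
    ∀ᵐ ω ∂(law N lam), T ω = t → condProbAbsorbedFirst lam hT ω =
      ((law N lam)[(absorbedFirst lam T).indicator (fun _ => (1 : ℝ)) |
        canonicalFiltration N t]) ω := by
  have h := condExp_stopping_time_ae_eq_restrict_eq_of_countable (μ := law N lam)
    (f := (absorbedFirst lam T).indicator (fun _ => (1 : ℝ))) hT t
  rwa [Filter.EventuallyEq, ae_restrict_iff'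
    ((canonicalFiltration N).le t _ (hT.measurableSet_eq t))] at h

/-- On `{T = t}` conditioning on the stopped σ-algebra agrees with conditioning on time `t`, where a
bound uniform over configurations can be integrated. -/
lemma condProb_le {T : Path N → WithTop ℕ} (hT : IsStoppingTime (canonicalFiltration N) T)
    {K : ℕ → ℕ → Prop} {c : ℝ}
    (h : ∀ n (η : Config N), K (occ η) (act η) → absorbProb lam n η ≤ c) (t : ℕ) :
    ∀ᵐ ω ∂(law N lam), T ω = t → K (X t ω) (Y t ω) → condProbAbsorbedFirst lam hT ω ≤ c := by
  have hs : MeasurableSet[canonicalFiltration N t]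
      ({ω : Path N | T ω = t} ∩ {ω | K (X t ω) (Y t ω)}) :=
    MeasurableSet.inter (hT.measurableSet_eq t) (measurableSet_canonicalFiltration K t)
  have hf : Integrable ((absorbedFirst lam T).indicator (fun _ => (1 : ℝ))) (law N lam) :=
    (integrable_const _).indicator (measurableSet_absorbedFirst hT)
  have key := condExp_le_of_setIntegral_le (c := c) ((canonicalFiltration N).le t) hf hs
    fun B hB hBs => by
      refine le_of_tendsto' (setIntegral_absorbedFirst hT hB fun ω hω => (hBs hω).1) fun n => ?_
      have hBm := (canonicalFiltration N).le t _ hB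
      calc ∫ ω in B, absorbProb lam n (ω t) ∂(law N lam) ≤ ∫ _ in B, c ∂(law N lam) :=
            setIntegral_mono_on (integrable_comp_coord _ t).integrableOn
              (integrable_const c) hBm fun ω hω => h n _ (hBs hω).2
        _ = c * (law N lam).real B := by rw [setIntegral_const, smul_eq_mul, mul_comm]
  filter_upwards [key, ae_restrict_condProb hT t] with ω h1 h2 hTω hK
  rw [h2 hTω]
  exact h1 ⟨hTω, hK⟩

/-- The lower bound may depend on the horizon `n`: the available one falls short by the probability
that the chain is still running after `n` steps. -/
lemma le_condProb {T : Path N → WithTop ℕ} (hT : IsStoppingTime (canonicalFiltration N) T)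
    {K : ℕ → ℕ → Prop} {c : ℝ} {a : ℕ → ℝ} (ha : Filter.Tendsto a Filter.atTop (nhds c))
    (h : ∀ᶠ n in Filter.atTop, ∀ η : Config N, K (occ η) (act η) → a n ≤ absorbProb lam n η)
    (t : ℕ) :
    ∀ᵐ ω ∂(law N lam), T ω = t → K (X t ω) (Y t ω) → c ≤ condProbAbsorbedFirst lam hT ω := by
  have hs : MeasurableSet[canonicalFiltration N t]
      ({ω : Path N | T ω = t} ∩ {ω | K (X t ω) (Y t ω)}) :=
    MeasurableSet.inter (hT.measurableSet_eq t) (measurableSet_canonicalFiltration K t)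
  have hf : Integrable ((absorbedFirst lam T).indicator (fun _ => (1 : ℝ))) (law N lam) :=
    (integrable_const _).indicator (measurableSet_absorbedFirst hT)
  have key := le_condExp_of_le_setIntegral (c := c) ((canonicalFiltration N).le t) hf hs
    fun B hB hBs => by
      refine le_of_tendsto_of_tendsto (ha.mul_const _)
        (setIntegral_absorbedFirst hT hB fun ω hω => (hBs hω).1) ?_
      filter_upwards [h] with n hn
      have hBm := (canonicalFiltration N).le t _ hB
      calc a n * (law N lam).real B = ∫ _ in B, a n ∂(law N lam) := by
            rw [setIntegral_const, smul_eq_mul, mul_comm]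
        _ ≤ ∫ ω in B, absorbProb lam n (ω t) ∂(law N lam) :=
            setIntegral_mono_on (integrable_const _)
              (integrable_comp_coord _ t).integrableOn hBm fun ω hω => hn _ (hBs hω).2
  filter_upwards [key, ae_restrict_condProb hT t] with ω h1 h2 hTω hK
  rw [h2 hTω]
  exact h1 ⟨hTω, hK⟩

end stopped

/-! ### Effect of single updates on the counts -/

section counts

variable {N : ℕ} {η : Config N} {x : Fin N}

lemma occ_update_of_ne_empty {a : Site} (hx : η x ≠ Site.empty) (ha : a ≠ Site.empty) :
    occ (Function.update η x a) = occ η := by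
  unfold occ
  congr 1
  ext y
  by_cases h : y = x
  · subst h; simp [occupiedSites, hx, ha]
  · simp [occupiedSites, h]

lemma occ_update_of_empty {a : Site} (hx : η x = Site.empty) (ha : a ≠ Site.empty) :
    occ (Function.update η x a) = occ η + 1 := by
  have : occupiedSites (Function.update η x a) = insert x (occupiedSites η) := by
    ext y
    by_cases h : y = x
    · subst h; simp [occupiedSites, ha]
    · simp [occupiedSites, h]
  rw [occ, this, Finset.card_insert_of_notMem (by simp [occupiedSites, hx]), occ]

lemma occ_update_empty (hx : η x ≠ Site.empty) :
    occ (Function.update η x Site.empty) + 1 = occ η := by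
  have h := occ_update_of_empty (η := Function.update η x Site.empty) (x := x) (a := η x)
    (by simp) hx
  rw [← h]
  simp

lemma act_update_active (hx : η x ≠ Site.active) :
    act (Function.update η x Site.active) = act η + 1 := by
  have : activeSites (Function.update η x Site.active) = insert x (activeSites η) := by
    ext y
    by_cases h : y = x
    · subst h; simp [activeSites]
    · simp [activeSites, h]
  rw [act, this, Finset.card_insert_of_notMem (by simp [activeSites, hx]), act]

lemma act_update_of_active {a : Site} (hx : η x = Site.active) (ha : a ≠ Site.active) :
    act (Function.update η x a) + 1 = act η := by
  have h := act_update_active (η := Function.update η x a) (x := x) (by simpa using ha)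
  rw [← h]
  simp [← hx]

lemma act_le_occ (η : Config N) : act η ≤ occ η :=
  Finset.card_le_card fun y hy => by
    simp only [activeSites, occupiedSites, Finset.mem_filter, Finset.mem_univ, true_and] at hy ⊢
    simp [hy]

lemma occ_le (η : Config N) : occ η ≤ N :=
  (Finset.card_le_univ _).trans_eq (Fintype.card_fin N)

lemma sum_site (η : Config N) (v : Site → ℝ) :
    ∑ y, v (η y) = ((N : ℝ) - occ η) * v Site.empty + ((occ η : ℝ) - act η) * v Site.asleep +
      (act η : ℝ) * v Site.active := by
  have h1 : ∀ y, v (η y) = v Site.empty +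
      (if η y ≠ Site.empty then v Site.asleep - v Site.empty else 0) +
      (if η y = Site.active then v Site.active - v Site.asleep else 0) := by
    intro y
    cases η y <;> simp
  simp_rw [h1, Finset.sum_add_distrib, ← Finset.sum_filter, Finset.sum_const, nsmul_eq_mul]
  simp only [Finset.card_univ, Fintype.card_fin]
  change _ + (occ η : ℝ) * _ + (act η : ℝ) * _ = _
  ring

/-- The jump has `N` equally likely targets, so `N` times the mean is a sum over all sites, grouped
by status, plus the boundary and minus the vertex that is left. -/
lemma ev_jump_le (η : Config N) (x : Fin N) {f : Vertex N → ℝ} {a : ℝ} {v : Site → ℝ}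
    (h0 : f none ≤ a) (h : ∀ y, y ≠ x → f (some y) ≤ v (η y)) :
    N * ev (jump x) f ≤ a + ((N : ℝ) - occ η) * v Site.empty +
      ((occ η : ℝ) - act η) * v Site.asleep + (act η : ℝ) * v Site.active - v (η x) := by
  have hN : (N : ℝ) ≠ 0 := by
    have := x.pos
    positivity
  have hc : ((Finset.univ.erase (some x) : Finset (Vertex N)).card : ℝ) = N := by
    rw [Finset.card_erase_of_mem (Finset.mem_univ _)]
    simp
  have h1 : ∑ w ∈ (Finset.univ.erase (some x) : Finset (Vertex N)), f w ≤
      a + (∑ y, v (η y) - v (η x)) := by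
    have hle : ∀ w ∈ (Finset.univ.erase (some x) : Finset (Vertex N)),
        f w ≤ Option.elim w a fun y => v (η y) := by
      rintro (_ | y) hw
      · exact h0
      · exact h y fun hyx => by simp [hyx] at hw
    refine (Finset.sum_le_sum hle).trans_eq ?_
    have h2 := Finset.add_sum_erase Finset.univ (fun w : Vertex N => Option.elim w a fun y => v (η y))
      (Finset.mem_univ (some x))
    rw [Fintype.sum_option] at h2
    simp only [Option.elim_none, Option.elim_some] at h2
    linarith
  rw [jump, ev_uniformOfFinset, hc, mul_div_cancel₀ _ hN]
  rw [sum_site] at h1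
  linarith

end counts

/-! ### Supersolutions for the walk of a moving particle -/

section walk

variable {N : ℕ} {G : ℕ → ℕ → ℝ} {Φ : ℕ → ℝ} {o m : ℕ} {C : ℝ}

/-- A function of the particle counts on the outcomes of a walk, with value `-C` for a walk that has
not stopped. -/
def outcomeValue (G : ℕ → ℕ → ℝ) (C : ℝ) (r : Option (Config N)) : ℝ :=
  r.elim (-C) fun ζ => G (occ ζ) (act ζ)

/-- A supersolution of the recursion for a walk that starts at an active site bounds the expectation
of the outcome. -/
lemma ev_walk_le (hC : ∀ k, m + k ≤ o → -C ≤ Φ k)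
    (hΦ : ∀ k, m + k ≤ o → G o (m + k) + ((N : ℝ) - o) * G (o + 1) (m + k + 1) +
      ((o : ℝ) - (m + k)) * Φ (k + 1) + ((m : ℝ) + k - 1) * Φ k ≤ N * Φ k) (n : ℕ) :
    ∀ (k : ℕ) (x : Fin N) (ζ : Config N), ζ x = Site.active → occ ζ = o → act ζ = m + k →
      ev (walk n x ζ) (outcomeValue G C) ≤ Φ k := by
  induction n with
  | zero =>
    intro k x ζ _ ho hm
    rw [walk, ev_pure]
    exact hC k (by rw [← ho, ← hm]; exact act_le_occ ζ)
  | succ n ih =>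
    intro k x ζ hx ho hm
    have hmo : m + k ≤ o := by rw [← ho, ← hm]; exact act_le_occ ζ
    have hN : (0 : ℝ) < N := by exact_mod_cast x.pos
    rw [walk, ev_bind]
    refine le_of_mul_le_mul_left ((ev_jump_le ζ x (a := G o (m + k)) (v := fun c => match c with
      | Site.empty => G (o + 1) (m + k + 1)
      | Site.asleep => Φ (k + 1)
      | Site.active => Φ k) ?_ ?_).trans ?_) hN
    · dsimp only
      rw [ev_pure, outcomeValue, Option.elim_some, ho, hm]
    · intro y _
      dsimp only
      cases hy : ζ y with
      | empty =>
        dsimp only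
        rw [ev_pure, outcomeValue, Option.elim_some, occ_update_of_empty hy (by simp),
          act_update_active (by simp [hy]), ho, hm]
      | asleep =>
        exact ih (k + 1) y _ (by simp)
          (by rw [occ_update_of_ne_empty (by simp [hy]) (by simp), ho])
          (by rw [act_update_active (by simp [hy]), hm, add_assoc])
      | active => exact ih k y ζ hy ho hm
    · have h := hΦ k hmo
      rw [hx, ho, hm]
      push_cast
      linarith

lemma tendsto_walk_none (x : Fin N) (ζ : Config N) :
    Filter.Tendsto (fun n => (walk n x ζ none).toReal) Filter.atTop (nhds 0) := by
  have hr : (1 - (N : ℝ≥0∞)⁻¹) < 1 := ENNReal.sub_lt_self (by simp) (by simp) (by simp)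
  have h := tendsto_of_tendsto_of_tendsto_of_le_of_le tendsto_const_nhds
    (ENNReal.tendsto_pow_atTop_nhds_zero_of_lt_one hr) (fun _ => zero_le)
    (fun n => walk_none_le n x ζ)
  have h' := (ENNReal.tendsto_toReal ENNReal.zero_ne_top).comp h
  rwa [ENNReal.toReal_zero] at h'

/-- Unfinished walks have probability tending to `0`, so the artificial value `-C` disappears in the
limit. -/
lemma ev_move_le_of_walk {η : Config N} {x : Fin N} {c : ℝ}
    (h : ∀ n, ev (walk (n + 1) x (Function.update η x Site.empty)) (outcomeValue G C) ≤ c) :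
    ev (move η x) (fun ζ => G (occ ζ) (act ζ)) ≤ c := by
  set ζ := Function.update η x Site.empty
  have h1 : ∀ ζ', Filter.Tendsto (fun n => (walk n x ζ (some ζ')).toReal) Filter.atTop
      (nhds ((move η x) ζ').toReal) := fun ζ' => by
    refine (ENNReal.tendsto_toReal ((move η x).apply_ne_top ζ')).comp ?_
    exact tendsto_atTop_iSup (monotone_nat_of_le_succ fun n => walk_mono n x ζ ζ')
  have h2 : Filter.Tendsto (fun n => ev (walk n x ζ) (outcomeValue G C)) Filter.atTop
      (nhds (0 * (-C) + ev (move η x) (fun ζ => G (occ ζ) (act ζ)))) := by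
    simp only [ev, Fintype.sum_option]
    exact ((tendsto_walk_none x ζ).mul_const _).add
      (tendsto_finsetSum _ fun ζ' _ => (h1 ζ').mul_const _)
  rw [zero_mul, zero_add] at h2
  exact le_of_tendsto' ((Filter.tendsto_add_atTop_iff_nat 1).2 h2) h

/-- The first jump is special. The vertex just left is empty but cannot be a target, so only `N - o
- 1` empty targets remain, and all `m` active particles are other ones. -/
lemma ev_move_le {η : Config N} {x : Fin N} (hx : η x = Site.active) (ho : occ η = o + 1)
    (hm : act η = m + 1)
    (hΦ : ∀ k, m + k ≤ o → G o (m + k) + ((N : ℝ) - o) * G (o + 1) (m + k + 1) +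
      ((o : ℝ) - (m + k)) * Φ (k + 1) + ((m : ℝ) + k - 1) * Φ k ≤ N * Φ k) :
    N * ev (move η x) (fun ζ => G (occ ζ) (act ζ)) ≤ G o m +
      ((N : ℝ) - o - 1) * G (o + 1) (m + 1) + ((o : ℝ) - m) * Φ 1 + m * Φ 0 := by
  have hN : (0 : ℝ) < N := by exact_mod_cast x.pos
  -- Any common bound for the finitely many relevant `|Φ k|` serves as the penalty of an unfinished
  -- walk.
  set C := ∑ k ∈ Finset.range (o + 1), |Φ k|
  have hC : ∀ k, m + k ≤ o → -C ≤ Φ k := fun k hk => by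
    have : |Φ k| ≤ C := Finset.single_le_sum (f := fun k => |Φ k|) (fun _ _ => abs_nonneg _)
      (Finset.mem_range.2 (by omega))
    linarith [neg_abs_le (Φ k)]
  rw [← le_div_iff₀' hN]
  refine ev_move_le_of_walk (C := C) fun n => ?_
  rw [le_div_iff₀' hN]
  set ζ := Function.update η x Site.empty
  have hζx : ζ x = Site.empty := by simp [ζ]
  have hoζ : occ ζ = o := by
    have := occ_update_empty (η := η) (x := x) (by simp [hx])
    change occ ζ + 1 = _ at this
    omega
  have hmζ : act ζ = m := by
    have := act_update_of_active (a := Site.empty) hx (by simp)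
    change act ζ + 1 = _ at this
    omega
  rw [walk, ev_bind]
  refine (ev_jump_le ζ x (a := G o m) (v := fun c => match c with
      | Site.empty => G (o + 1) (m + 1)
      | Site.asleep => Φ 1
      | Site.active => Φ 0) ?_ ?_).trans ?_
  · dsimp only
    rw [ev_pure, outcomeValue, Option.elim_some, hoζ, hmζ]
  · intro y _
    dsimp only
    cases hy : ζ y with
    | empty =>
      dsimp only
      rw [ev_pure, outcomeValue, Option.elim_some, occ_update_of_empty hy (by simp),
        act_update_active (by simp [hy]), hoζ, hmζ]
    | asleep =>
      exact ev_walk_le hC hΦ n 1 y _ (by simp)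
        (by rw [occ_update_of_ne_empty (by simp [hy]) (by simp), hoζ])
        (by rw [act_update_active (by simp [hy]), hmζ])
    | active => exact ev_walk_le hC hΦ n 0 y ζ hy hoζ (by rw [hmζ, add_zero])
  · rw [hζx, hoζ, hmζ]
    linarith

end walk

/-! ### One step of the chain -/

section step

variable {N : ℕ} {lam : ℝ≥0}

lemma ev_sleepCoin (f : Bool → ℝ) :
    ev (sleepCoin lam) f = (lam : ℝ) / (1 + lam) * f true + 1 / (1 + lam) * f false := by
  simp [ev, sleepCoin]

lemma ev_step_le_of_forall {η : Config N} (hη : act η ≠ 0) {f : Config N → ℝ} {a b : ℝ}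
    (ha : ∀ x, η x = Site.active → f (Function.update η x Site.asleep) ≤ a)
    (hb : ∀ x, η x = Site.active → ev (move η x) f ≤ b) :
    ev (step lam η) f ≤ (lam : ℝ) / (1 + lam) * a + 1 / (1 + lam) * b := by
  have hne : (activeSites η).Nonempty := Finset.card_ne_zero.1 hη
  rw [step, dif_pos hne, ev_bind, ev_uniformOfFinset, div_le_iff₀ (by exact_mod_cast hne.card_pos)]
  refine (Finset.sum_le_card_nsmul _ _ ((lam : ℝ) / (1 + lam) * a + 1 / (1 + lam) * b)
    fun x hx => ?_).trans_eq (by rw [nsmul_eq_mul, mul_comm])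
  have hx' : η x = Site.active := by simpa [activeSites] using hx
  rw [ev_bind, ev_sleepCoin]
  simp only [if_true, Bool.false_eq_true, if_false, ev_pure]
  have := ha x hx'
  have := hb x hx'
  gcongr

/-- The mean of the change of the number of active particles in a step that does not lose a particle
at the boundary, for `o + 1` particles of which `m + 1` are active. -/
def stepMean (lam : ℝ≥0) (N o m : ℕ) : ℝ :=
  -((lam : ℝ) / (1 + lam)) + 1 / (1 + lam) *
    (((o : ℝ) - m) * (N + 1) / (N * ((N : ℝ) - o + 2)))

/-- The second moment that belongs to `stepMean`. -/
def stepSecondMoment (lam : ℝ≥0) (N o m : ℕ) : ℝ :=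
  (lam : ℝ) / (1 + lam) + 1 / (1 + lam) * ((((o : ℝ) - m) / ((N : ℝ) - o + 2) +
    2 * ((o : ℝ) - m) * ((o : ℝ) - m - 1) / (((N : ℝ) - o + 2) * ((N : ℝ) - o + 3))) *
      ((N + 1) / N))

/-- A bound for one step of the chain on functions of the particle counts with a quadratic majorant,
up to an exponentially growing error. -/
lemma ev_step_le {η : Config N} {o m : ℕ} (ho : occ η = o + 1) (hm : act η = m + 1)
    {G : ℕ → ℕ → ℝ} {T0 T1 T2 R D z : ℝ} (hR : 0 ≤ R) (hD : 0 ≤ D) (hz : 1 ≤ z)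
    (hs : 2 * ((o : ℝ) - m) * (z - 1) ≤ (N : ℝ) - o + 1)
    (hsleep : G (o + 1) m ≤ T0 - T1 + T2 / 2 + R)
    (hland : ∀ k : ℕ, m + k ≤ o →
      G (o + 1) (m + k + 1) ≤ T0 + T1 * k + T2 / 2 * (k : ℝ) ^ 2 + R * z ^ k)
    (hexit : ∀ k : ℕ, m + k ≤ o →
      G o (m + k) ≤ T0 + T1 * k + T2 / 2 * (k : ℝ) ^ 2 + (R + D) * z ^ k) :
    ev (step lam η) (fun η => G (occ η) (act η)) ≤
      T0 + T1 * stepMean lam N o m + T2 / 2 * stepSecondMoment lam N o m + 4 * R +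
        4 * D / ((N : ℝ) - o + 1) := by
  have hoN : o + 1 ≤ N := ho ▸ occ_le η
  have hmo : m ≤ o := by have := act_le_occ η; omega
  have hoN' : (o : ℝ) + 1 ≤ N := by exact_mod_cast hoN
  have hN : (1 : ℝ) ≤ N := by linarith [(Nat.cast_nonneg o : (0 : ℝ) ≤ o)]
  set t : ℝ := (N : ℝ) - o + 1 with ht
  have ht2 : 2 ≤ t := by linarith
  -- Of the `t = N - o + 1` ways to stop, one is the boundary, so the extra error `D` counts with
  -- weight `1 / t`. The factor `2` leaves room for the growth of `z ^ k`.
  set W : ℝ := 2 * R + 2 * D / t with hW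
  have hW0 : 0 ≤ W := by positivity
  have hWt : t * W = 2 * (t * R + D) := by rw [hW]; field_simp
  -- `Ψ k` is the exact mean of the quadratic when `k` sleepers are already awake. The remaining
  -- sleepers and the `t` stopping vertices are met in uniformly random order, so a sleeper precedes
  -- all stops with probability `1 / (t + 1)` and two of them do with probability `2 / ((t + 1) (t +
  -- 2))`.
  set Ψ : ℝ → ℝ := fun k => T0 + T1 * (k + ((o : ℝ) - m - k) / (t + 1)) + T2 / 2 * (k ^ 2 +
    2 * k * ((o : ℝ) - m - k) / (t + 1) + (((o : ℝ) - m - k) / (t + 1) +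
      2 * ((o : ℝ) - m - k) * ((o : ℝ) - m - k - 1) / ((t + 1) * (t + 2)))) with hΨ
  have hΨrec : ∀ k : ℝ, (t + ((o : ℝ) - m - k)) * Ψ k =
      t * (T0 + T1 * k + T2 / 2 * k ^ 2) + ((o : ℝ) - m - k) * Ψ (k + 1) := by
    intro k
    simp only [hΨ]
    field_simp
    ring
  -- By `hs`, the loss from `z ^ (k + 1)` against `z ^ k` costs at most half of `t W z ^ k`; the
  -- other half is exactly the source term.
  have hWrec : ∀ k : ℕ, m + k ≤ o → (t * R + D) * z ^ k + ((o : ℝ) - m - k) * (W * z ^ (k + 1)) ≤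
      (t + ((o : ℝ) - m - k)) * (W * z ^ k) := by
    intro k _
    have h1 : ((o : ℝ) - m - k) * (z - 1) * 2 ≤ t := by
      refine le_trans ?_ hs
      have : (0 : ℝ) ≤ k := Nat.cast_nonneg k
      nlinarith
    have h2 : (((o : ℝ) - m - k) * (z - 1) * 2) * (W * z ^ k) ≤ t * (W * z ^ k) :=
      mul_le_mul_of_nonneg_right h1 (by positivity)
    have h3 : t * (W * z ^ k) = 2 * (t * R + D) * z ^ k := by rw [← hWt]; ring
    rw [pow_succ]
    linarith
  set Φ : ℕ → ℝ := fun k => Ψ k + W * z ^ k with hΦ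
  have hrec : ∀ k : ℕ, m + k ≤ o → G o (m + k) + (t - 1) * G (o + 1) (m + k + 1) +
      ((o : ℝ) - m - k) * Φ (k + 1) ≤ (t + ((o : ℝ) - m - k)) * Φ k := by
    intro k hk
    have h1 := hexit k hk
    have h2 : (t - 1) * G (o + 1) (m + k + 1) ≤
        (t - 1) * (T0 + T1 * k + T2 / 2 * (k : ℝ) ^ 2 + R * z ^ k) :=
      mul_le_mul_of_nonneg_left (hland k hk) (by linarith)
    have h3 := hΨrec k
    have h4 := hWrec k hk
    simp only [hΦ]
    push_cast
    linarith
  have hsuper : ∀ k : ℕ, m + k ≤ o → G o (m + k) + ((N : ℝ) - o) * G (o + 1) (m + k + 1) +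
      ((o : ℝ) - (m + k)) * Φ (k + 1) + ((m : ℝ) + k - 1) * Φ k ≤ N * Φ k := by
    intro k hk
    have h := hrec k hk
    have e1 : t - 1 = (N : ℝ) - o := by rw [ht]; ring
    have e2 : (t + ((o : ℝ) - m - k)) * Φ k = N * Φ k - ((m : ℝ) + k - 1) * Φ k := by rw [ht]; ring
    rw [e1, e2] at h
    have e3 : (o : ℝ) - (m + k) = o - m - k := by ring
    rw [e3]
    linarith
  -- The bound for a move comes from comparing the first jump with the recursion at `k = 0`: one
  -- landing of value `T0` is missing and one further `Φ 0` appears. Hence the factors `(N + 1) / N`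
  -- in the moments.
  have hstep := ev_step_le_of_forall (lam := lam) (η := η) (f := fun η => G (occ η) (act η))
    (a := T0 - T1 + T2 / 2 + R) (b := ((N + 1) * Φ 0 - T0) / N) (by omega)
    (fun x hx => by
      have h1 := occ_update_of_ne_empty (η := η) (x := x) (a := Site.asleep) (by simp [hx]) (by simp)
      have h2 := act_update_of_active (η := η) (x := x) (a := Site.asleep) hx (by simp)
      have h3 : act (Function.update η x Site.asleep) = m := by omega
      simp only [h1, ho, h3]
      exact hsleep)
    (fun x hx => by
      rw [le_div_iff₀' (by linarith)]
      refine (ev_move_le hx ho hm hsuper).trans ?_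
      have h1 := hexit 0 (by omega)
      have h2 : ((N : ℝ) - o - 1) * G (o + 1) (m + 1) ≤ ((N : ℝ) - o - 1) * (T0 + R) :=
        mul_le_mul_of_nonneg_left (by simpa using hland 0 (by omega)) (by linarith)
      have h3 := hΨrec 0
      have h4 := hWrec 0 (by omega)
      simp only [hΦ]
      simp only [Nat.cast_zero, Nat.cast_one, mul_zero, add_zero, pow_zero, mul_one, zero_add,
        pow_one, sub_zero, ne_eq, OfNat.ofNat_ne_zero, not_false_eq_true, zero_pow] at h1 h3 h4 ⊢
      have e : (N : ℝ) = t + o - 1 := by rw [ht]; ring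
      have e' : ((N : ℝ) - o - 1) = t - 2 := by rw [ht]; ring
      rw [e'] at h2 ⊢
      rw [e]
      linarith)
  refine hstep.trans ?_
  have hq : 0 < 1 + (lam : ℝ) := by positivity
  have e1 : ((N + 1) * Φ 0 - T0) / N = T0 + T1 * (((o : ℝ) - m) * (N + 1) / (N * (t + 1))) +
      T2 / 2 * ((((o : ℝ) - m) / (t + 1) + 2 * ((o : ℝ) - m) * ((o : ℝ) - m - 1) /
        ((t + 1) * (t + 2))) * ((N + 1) / N)) + (N + 1) / N * W := by
    simp only [hΦ, hΨ]
    field_simp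
    simp
    ring
  rw [e1]
  have et1 : (N : ℝ) - o + 2 = t + 1 := by rw [ht]; ring
  have et2 : (N : ℝ) - o + 3 = t + 2 := by rw [ht]; ring
  rw [stepMean, stepSecondMoment, et1, et2]
  have hNW : 1 / (1 + (lam : ℝ)) * ((N + 1) / N * W) ≤ 1 / (1 + (lam : ℝ)) * (2 * W) := by
    refine mul_le_mul_of_nonneg_left (mul_le_mul_of_nonneg_right ?_ hW0) (by positivity)
    rw [div_le_iff₀ (by linarith)]
    linarith
  have hpq : (lam : ℝ) / (1 + lam) = 1 - 1 / (1 + lam) := by field_simp; ring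
  have hq1 : 1 / (1 + (lam : ℝ)) ≤ 1 := by rw [div_le_one hq]; linarith [lam.coe_nonneg]
  have hDt : 0 ≤ D / t := by positivity
  have e5 : 4 * D / t = 4 * (D / t) := by ring
  have hW' : W = 2 * R + 2 * (D / t) := by rw [hW]; ring
  rw [hW'] at hNW
  rw [e5, hW', hpq]
  generalize 1 / (1 + (lam : ℝ)) = q at *
  linarith [mul_nonneg (sub_nonneg.2 hq1) hR, mul_nonneg (sub_nonneg.2 hq1) hDt]

end step

/-! ### The Ornstein-Uhlenbeck scale function and its Taylor bounds -/

/-- The reciprocal Gaussian weight `exp (w² / (2 l))`. -/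
def gaussInv (l w : ℝ) : ℝ := Real.exp (w ^ 2 / (2 * l))

/-- The primitive of `gaussInv l` that vanishes at `0`. -/
def scaleFun (l w : ℝ) : ℝ := ∫ v in (0 : ℝ)..w, gaussInv l v

section scale

variable {l : ℝ}

lemma continuous_gaussInv (l : ℝ) : Continuous (gaussInv l) := by
  unfold gaussInv
  fun_prop

lemma gaussInv_pos (l w : ℝ) : 0 < gaussInv l w := Real.exp_pos _

lemma one_le_gaussInv (hl : 0 < l) (w : ℝ) : 1 ≤ gaussInv l w :=
  Real.one_le_exp (by positivity)

lemma gaussInv_le_of_abs_le (hl : 0 < l) {v w : ℝ} (h : |v| ≤ |w|) :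
    gaussInv l v ≤ gaussInv l w :=
  Real.exp_le_exp.2 (div_le_div_of_nonneg_right (sq_le_sq.2 h) (by positivity))

lemma hasDerivAt_scaleFun (l w : ℝ) : HasDerivAt (scaleFun l) (gaussInv l w) w :=
  intervalIntegral.integral_hasDerivAt_right ((continuous_gaussInv l).intervalIntegrable _ _)
    ((continuous_gaussInv l).stronglyMeasurableAtFilter _ _) (continuous_gaussInv l).continuousAt

lemma scaleFun_zero (l : ℝ) : scaleFun l 0 = 0 := intervalIntegral.integral_same

lemma scaleFun_sub (l v w : ℝ) : scaleFun l w - scaleFun l v = ∫ x in v..w, gaussInv l x :=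
  intervalIntegral.integral_interval_sub_left ((continuous_gaussInv l).intervalIntegrable _ _)
    ((continuous_gaussInv l).intervalIntegrable _ _)

lemma scaleFun_mono (l : ℝ) : Monotone (scaleFun l) :=
  monotone_of_hasDerivAt_nonneg (hasDerivAt_scaleFun l) fun w => (gaussInv_pos l w).le

lemma scaleFun_sub_le {v w M : ℝ} (h : v ≤ w) (hM : ∀ x ∈ Set.Icc v w, gaussInv l x ≤ M) :
    scaleFun l w - scaleFun l v ≤ (w - v) * M := by
  rw [scaleFun_sub]
  have := intervalIntegral.integral_mono_on (μ := volume) h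
    ((continuous_gaussInv l).intervalIntegrable _ _)
    (continuous_const (y := M)).continuousOn.intervalIntegrable hM
  simpa using this

lemma le_scaleFun_sub {v w M : ℝ} (h : v ≤ w) (hM : ∀ x ∈ Set.Icc v w, M ≤ gaussInv l x) :
    (w - v) * M ≤ scaleFun l w - scaleFun l v := by
  rw [scaleFun_sub]
  have := intervalIntegral.integral_mono_on (μ := volume) h
    (continuous_const (y := M)).continuousOn.intervalIntegrable
    ((continuous_gaussInv l).intervalIntegrable _ _) hM
  simpa using this

lemma gaussInv_add (l w r : ℝ) :
    gaussInv l (w + r) = gaussInv l w * Real.exp ((2 * w * r + r ^ 2) / (2 * l)) := by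
  rw [gaussInv, gaussInv, ← Real.exp_add]
  congr 1
  ring

lemma le_gaussInv_add (hl : 0 < l) (w r : ℝ) :
    gaussInv l w * (1 + w * r / l) ≤ gaussInv l (w + r) := by
  rw [gaussInv_add]
  refine mul_le_mul_of_nonneg_left ?_ (gaussInv_pos l w).le
  have h1 := Real.add_one_le_exp ((2 * w * r + r ^ 2) / (2 * l))
  have h2 : (2 * w * r + r ^ 2) / (2 * l) = w * r / l + r ^ 2 / (2 * l) := by
    field_simp
  have h3 : 0 ≤ r ^ 2 / (2 * l) := by positivity
  linarith

lemma exp_le_one_add_add_sq {y : ℝ} (hy : y ≤ 1) : Real.exp y ≤ 1 + y + y ^ 2 := by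
  rcases le_total (-1) y with h | h
  · have := abs_le.1 (Real.abs_exp_sub_one_sub_id_le (abs_le.2 ⟨h, hy⟩))
    linarith [this.2]
  · have : Real.exp y ≤ 1 := Real.exp_le_one_iff.2 (by linarith)
    nlinarith

lemma gaussInv_add_le (hl : 0 < l) {w r : ℝ} (hr : |r| ≤ 1)
    (hwr : 2 * w * r + r ^ 2 ≤ 2 * l) :
    gaussInv l (w + r) ≤
      gaussInv l w * (1 + w * r / l + (1 / (2 * l) + 2 / l ^ 2) * (1 + w ^ 2) * r ^ 2) := by
  rw [gaussInv_add]
  refine mul_le_mul_of_nonneg_left ?_ (gaussInv_pos l w).le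
  refine (exp_le_one_add_add_sq ((div_le_one (by positivity)).2 hwr)).trans ?_
  have h2 : (2 * w * r + r ^ 2) / (2 * l) = w * r / l + r ^ 2 * (1 / (2 * l)) := by
    field_simp
  have h3 : ((2 * w * r + r ^ 2) / (2 * l)) ^ 2 ≤ 2 / l ^ 2 * (1 + w ^ 2) * r ^ 2 := by
    have e1 : ((2 * w * r + r ^ 2) / (2 * l)) ^ 2 = (2 * w + r) ^ 2 / 4 * (r ^ 2 / l ^ 2) := by
      field_simp
      ring
    have e2 : 2 / l ^ 2 * (1 + w ^ 2) * r ^ 2 = 2 * (1 + w ^ 2) * (r ^ 2 / l ^ 2) := by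
      field_simp
    rw [e1, e2]
    refine mul_le_mul_of_nonneg_right ?_ (by positivity)
    have : r ^ 2 ≤ 1 := (sq_le_one_iff_abs_le_one r).2 hr
    nlinarith [sq_nonneg (2 * w - r)]
  have h4 : r ^ 2 * (1 / (2 * l)) ≤ 1 / (2 * l) * (1 + w ^ 2) * r ^ 2 := by
    have : 0 ≤ r ^ 2 * (1 / (2 * l)) * w ^ 2 := by positivity
    linarith
  linarith

/-- The derivative is nonnegative by `1 + x ≤ exp x`. Comparison with `v = 0` gives a lower bound on
`scaleFun` for `v ≥ 0` and an upper bound for `v ≤ 0`, with no cubic error. -/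
lemma monotone_scaleFun_sub_quadratic (hl : 0 < l) (w : ℝ) :
    Monotone fun v => scaleFun l (w + v) - gaussInv l w * (v + w * v ^ 2 / (2 * l)) := by
  refine monotone_of_hasDerivAt_nonneg
    (f' := fun v => gaussInv l (w + v) - gaussInv l w * (1 + w * v / l)) (fun v => ?_)
    fun v => sub_nonneg.2 (le_gaussInv_add hl w v)
  have h1 : HasDerivAt (fun v => scaleFun l (w + v)) (gaussInv l (w + v)) v := by
    simpa using (hasDerivAt_scaleFun l (w + v)).comp_const_add w v
  have h2 : HasDerivAt (fun v : ℝ => v + w * v ^ 2 / (2 * l)) (1 + w * v / l) v := by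
    refine ((hasDerivAt_id' v).add
      (((hasDerivAt_pow 2 v).const_mul w).div_const (2 * l))).congr_deriv ?_
    push_cast
    field_simp
  exact h1.sub (h2.const_mul _)

lemma le_scaleFun_add (hl : 0 < l) (w : ℝ) {v : ℝ} (hv : 0 ≤ v) :
    scaleFun l w + gaussInv l w * (v + w * v ^ 2 / (2 * l)) ≤ scaleFun l (w + v) := by
  have := monotone_scaleFun_sub_quadratic hl w hv
  simp at this
  linarith

lemma scaleFun_add_le_of_nonpos (hl : 0 < l) (w : ℝ) {v : ℝ} (hv : v ≤ 0) :
    scaleFun l (w + v) ≤ scaleFun l w + gaussInv l w * (v + w * v ^ 2 / (2 * l)) := by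
  have := monotone_scaleFun_sub_quadratic hl w hv
  simp at this
  linarith

/-- The opposite Taylor bound needs `exp y ≤ 1 + y + y²`, valid for `y ≤ 1`; the condition on `r`
says precisely that the exponent stays below `1`. -/
lemma monotoneOn_cubic_sub_scaleFun (hl : 0 < l) {w a b : ℝ} (ha : -1 ≤ a) (hb : b ≤ 1)
    (h : ∀ r ∈ Set.Icc a b, 2 * w * r + r ^ 2 ≤ 2 * l) :
    MonotoneOn (fun v => gaussInv l w * (v + w * v ^ 2 / (2 * l) +
      (1 / (2 * l) + 2 / l ^ 2) * (1 + w ^ 2) * v ^ 3 / 3) - scaleFun l (w + v))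
      (Set.Icc a b) := by
  have hder : ∀ v, HasDerivAt (fun v => gaussInv l w * (v + w * v ^ 2 / (2 * l) +
      (1 / (2 * l) + 2 / l ^ 2) * (1 + w ^ 2) * v ^ 3 / 3) - scaleFun l (w + v))
      (gaussInv l w * (1 + w * v / l + (1 / (2 * l) + 2 / l ^ 2) * (1 + w ^ 2) * v ^ 2) -
        gaussInv l (w + v)) v := by
    intro v
    have h1 : HasDerivAt (fun v => scaleFun l (w + v)) (gaussInv l (w + v)) v := by
      simpa using (hasDerivAt_scaleFun l (w + v)).comp_const_add w v
    have h2 : HasDerivAt (fun v : ℝ => v + w * v ^ 2 / (2 * l) +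
        (1 / (2 * l) + 2 / l ^ 2) * (1 + w ^ 2) * v ^ 3 / 3)
        (1 + w * v / l + (1 / (2 * l) + 2 / l ^ 2) * (1 + w ^ 2) * v ^ 2) v := by
      refine (((hasDerivAt_id' v).add (((hasDerivAt_pow 2 v).const_mul w).div_const (2 * l))).add
        (((hasDerivAt_pow 3 v).const_mul
          ((1 / (2 * l) + 2 / l ^ 2) * (1 + w ^ 2))).div_const 3)).congr_deriv ?_
      push_cast
      field_simp
    exact (h2.const_mul _).sub h1
  refine monotoneOn_of_deriv_nonneg (convex_Icc a b)
    (fun v _ => (hder v).continuousAt.continuousWithinAt)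
    (fun v _ => (hder v).differentiableAt.differentiableWithinAt) fun v hv => ?_
  rw [(hder v).deriv]
  have hv' := interior_subset hv
  exact sub_nonneg.2 (gaussInv_add_le hl
    (abs_le.2 ⟨ha.trans hv'.1, hv'.2.trans hb⟩) (h v hv'))

lemma scaleFun_add_le (hl : 0 < l) {w v : ℝ} (hv : 0 ≤ v) (hv1 : v ≤ 1)
    (h : ∀ r ∈ Set.Icc 0 v, 2 * w * r + r ^ 2 ≤ 2 * l) :
    scaleFun l (w + v) ≤ scaleFun l w + gaussInv l w * (v + w * v ^ 2 / (2 * l) +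
      (1 / (2 * l) + 2 / l ^ 2) * (1 + w ^ 2) * v ^ 3 / 3) := by
  have := monotoneOn_cubic_sub_scaleFun hl (by norm_num) hv1 h (Set.left_mem_Icc.2 hv)
    (Set.right_mem_Icc.2 hv) hv
  simp only [add_zero, zero_pow two_ne_zero, zero_pow three_ne_zero, mul_zero, zero_div,
    zero_sub] at this
  linarith

lemma le_scaleFun_add_of_nonpos (hl : 0 < l) {w v : ℝ} (hv : v ≤ 0) (hv1 : -1 ≤ v)
    (h : ∀ r ∈ Set.Icc v 0, 2 * w * r + r ^ 2 ≤ 2 * l) :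
    scaleFun l w + gaussInv l w * (v + w * v ^ 2 / (2 * l) +
      (1 / (2 * l) + 2 / l ^ 2) * (1 + w ^ 2) * v ^ 3 / 3) ≤ scaleFun l (w + v) := by
  have := monotoneOn_cubic_sub_scaleFun hl hv1 (by norm_num) h (Set.left_mem_Icc.2 hv)
    (Set.right_mem_Icc.2 hv) hv
  simp only [add_zero, zero_pow two_ne_zero, zero_pow three_ne_zero, mul_zero, zero_div,
    zero_sub] at this
  linarith

/-- A coefficient for the cubic error terms. -/
lemma exists_min_scaleFun_add_le (hl : 0 < l) : ∃ K : ℝ, 0 ≤ K ∧ ∀ w ≤ 0, ∀ v, 0 ≤ v →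
    min (scaleFun l (w + v)) 0 ≤ scaleFun l w + gaussInv l w * (v + w * v ^ 2 / (2 * l)) +
      K * (1 + w ^ 2) * gaussInv l w * v ^ 3 := by
  -- For `w ≤ 0` the cross term `2 w r` is nonpositive, so `r ≤ √(2 l)` suffices for the Taylor
  -- bound up to `δ`.
  set δ : ℝ := min 1 (√(2 * l)) with hδ
  have hδ0 : 0 < δ := lt_min one_pos (Real.sqrt_pos.2 (by positivity))
  have hδ1 : δ ≤ 1 := min_le_left _ _
  have hδ2 : δ ^ 2 ≤ 2 * l := by
    rw [← Real.sq_sqrt (show 0 ≤ 2 * l by positivity)]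
    exact pow_le_pow_left₀ hδ0.le (min_le_right _ _) 2
  refine ⟨(1 / (2 * l) + 2 / l ^ 2) / 3 + (1 / δ ^ 3 + 1 / (2 * l * δ)), by positivity, ?_⟩
  intro w hw v hv
  have hE := gaussInv_pos l w
  rcases le_total v δ with h | h
  · refine (min_le_left _ _).trans ((scaleFun_add_le hl hv (h.trans hδ1) fun r hr => ?_).trans ?_)
    · have : r ^ 2 ≤ δ ^ 2 := pow_le_pow_left₀ hr.1 (hr.2.trans h) 2
      nlinarith [mul_nonneg (neg_nonneg.2 hw) hr.1]
    · have : 0 ≤ (1 / δ ^ 3 + 1 / (2 * l * δ)) * (1 + w ^ 2) * gaussInv l w * v ^ 3 := by positivity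
      linarith
  -- For a jump beyond `δ` the truncation at `0` suffices: both `-scaleFun w ≤ |w| gaussInv w` and
  -- the negative quadratic term are absorbed by a multiple of `v³`.
  · refine (min_le_right _ _).trans ?_
    have h1 : -scaleFun l w ≤ -w * gaussInv l w := by
      have := scaleFun_sub_le (l := l) (M := gaussInv l w) hw fun x hx =>
        gaussInv_le_of_abs_le hl (by rw [abs_of_nonpos hx.2, abs_of_nonpos hw]; linarith [hx.1])
      rw [scaleFun_zero] at this
      linarith
    have hw1 : -w ≤ 1 + w ^ 2 := by nlinarith [sq_nonneg (w + 1)]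
    have h2 : 1 ≤ 1 / δ ^ 3 * v ^ 3 := by
      rw [one_div_mul_eq_div, one_le_div (by positivity)]
      exact pow_le_pow_left₀ hδ0.le h 3
    have h3 : v ^ 2 / (2 * l) ≤ 1 / (2 * l * δ) * v ^ 3 := by
      rw [one_div_mul_eq_div, div_le_div_iff₀ (by positivity) (by positivity)]
      nlinarith [mul_le_mul_of_nonneg_left h (show 0 ≤ v ^ 2 * (2 * l) by positivity)]
    have h4 : -w * 1 ≤ (1 + w ^ 2) * (1 / δ ^ 3 * v ^ 3) :=
      mul_le_mul hw1 h2 zero_le_one (by positivity)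
    have h5 : -w * (v ^ 2 / (2 * l)) ≤ (1 + w ^ 2) * (1 / (2 * l * δ) * v ^ 3) :=
      mul_le_mul hw1 h3 (by positivity) (by positivity)
    have h6 := mul_le_mul_of_nonneg_left (add_le_add h4 h5) hE.le
    have h7 : 0 ≤ gaussInv l w * v := by positivity
    have h8 : 0 ≤ (1 / (2 * l) + 2 / l ^ 2) / 3 * (1 + w ^ 2) * gaussInv l w * v ^ 3 := by positivity
    have e : gaussInv l w * (v + w * v ^ 2 / (2 * l)) =
        gaussInv l w * v - gaussInv l w * (-w * (v ^ 2 / (2 * l))) := by ring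
    rw [e]
    linarith

/-- As `w ≤ 2`, truncation at `3` can take effect only after a jump `v ≥ 1`, for which the cubic
term dominates. Downward jumps need the small-exponent condition; only a particle falling asleep
produces them. -/
lemma exists_max_sub_scaleFun_add_le (hl : 0 < l) : ∃ K : ℝ, 0 ≤ K ∧ ∀ w ≤ 2, ∀ v,
    (0 ≤ v ∨ (v ≤ 0 ∧ -1 ≤ v ∧ ∀ r ∈ Set.Icc v 0, 2 * w * r + r ^ 2 ≤ 2 * l)) →
    max (scaleFun l 3 - scaleFun l (w + v)) 0 ≤
      scaleFun l 3 - scaleFun l w - gaussInv l w * (v + w * v ^ 2 / (2 * l)) +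
        K * (1 + w ^ 2) * gaussInv l w * |v| ^ 3 := by
  refine ⟨(1 / (2 * l) + 2 / l ^ 2) / 3 + (1 + 1 / (2 * l)), by positivity, ?_⟩
  intro w hw v hv
  have hE := gaussInv_pos l w
  have hw1 : |w| ≤ 1 + w ^ 2 := by
    rw [← sq_abs]
    nlinarith [sq_nonneg (|w| - 1), abs_nonneg w]
  have h0 : 0 ≤ (1 / (2 * l) + 2 / l ^ 2) / 3 * (1 + w ^ 2) * gaussInv l w * |v| ^ 3 := by
    positivity
  have h0' : 0 ≤ (1 + 1 / (2 * l)) * (1 + w ^ 2) * gaussInv l w * |v| ^ 3 := by positivity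
  rcases hv with hv | ⟨hv, hv1, h⟩
  · rcases le_total (w + v) 3 with h3 | h3
    · rw [max_eq_left (sub_nonneg.2 (scaleFun_mono l h3))]
      linarith [le_scaleFun_add hl w hv]
    · rw [max_eq_right (sub_nonpos.2 (scaleFun_mono l h3)), abs_of_nonneg hv]
      rw [abs_of_nonneg hv] at h0
      have hv1 : 1 ≤ v := by linarith
      have h4 : 0 ≤ scaleFun l 3 - scaleFun l w := sub_nonneg.2 (scaleFun_mono l (by linarith))
      have h5 : v ^ 2 ≤ v ^ 3 := pow_le_pow_right₀ hv1 (by norm_num)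
      have h6 : v ≤ (1 + w ^ 2) * v ^ 3 := by
        have : v ≤ v ^ 3 := le_self_pow₀ hv1 (by norm_num)
        nlinarith [mul_nonneg (sq_nonneg w) (pow_nonneg hv 3)]
      have h7 : w * v ^ 2 ≤ (1 + w ^ 2) * v ^ 3 :=
        mul_le_mul ((le_abs_self w).trans hw1) h5 (by positivity) (by positivity)
      have h8 : w * v ^ 2 / (2 * l) ≤ 1 / (2 * l) * ((1 + w ^ 2) * v ^ 3) := by
        rw [one_div_mul_eq_div]
        exact div_le_div_of_nonneg_right h7 (by positivity)
      have h9 := mul_le_mul_of_nonneg_left (add_le_add h6 h8) hE.le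
      linarith
  · rw [max_eq_left (sub_nonneg.2 (scaleFun_mono l (by linarith)))]
    have := le_scaleFun_add_of_nonpos hl hv hv1 h
    have e : |v| ^ 3 = -v ^ 3 := by rw [abs_of_nonpos hv]; ring
    rw [e] at h0' ⊢
    linarith

end scale

/-! ### Asymptotics of the first two moments of a step -/

section moments

variable {lam : ℝ≥0} {N o m : ℕ}

/-- The critical line is visible here: the numerator is `-S` up to a bounded correction and the
denominator is `N` up to the excess over the critical density. -/
lemma stepMean_eq (hN : 0 < N) (hoN : o + 1 ≤ N) :
    stepMean lam N o m = (-dev lam N (o + 1) (m + 1) + (((o : ℝ) - m) / N - 3 * lam)) /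
      (N - ((1 + (lam : ℝ)) * (o + 1) - lam * N) + 3 * (1 + lam)) := by
  have ho : (o : ℝ) + 1 ≤ N := by exact_mod_cast hoN
  have ht : (N : ℝ) - o + 2 ≠ 0 := by linarith
  have hD : (N : ℝ) - ((1 + (lam : ℝ)) * (o + 1) - lam * N) + 3 * (1 + lam) =
      (1 + lam) * (N - o + 2) := by ring
  rw [hD, stepMean, dev]
  push_cast
  field_simp
  ring

/-- Linear restoring drift: replacing the denominator of `stepMean_eq` by `N` costs the product of
deviation and excess, each of order `√N ℓ`, divided by `N²`. -/
lemma abs_mul_stepMean_add_le {P ℓ : ℝ} (hN : 0 < N) (hoN : o + 1 ≤ N) (hmo : m ≤ o) (hP : 0 ≤ P)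
    (hℓ : 1 ≤ ℓ) (hS : |dev lam N (o + 1) (m + 1)| ≤ P * √(N : ℝ) * ℓ)
    (hb : |(1 + (lam : ℝ)) * (o + 1) - lam * N| ≤ P * √(N : ℝ) * ℓ)
    (hPN : P * √(N : ℝ) * ℓ ≤ N / 2) :
    |√(N : ℝ) * stepMean lam N o m + dev lam N (o + 1) (m + 1) / √(N : ℝ)| ≤
      2 * (1 + 3 * lam + P ^ 2 + 3 * P * (1 + lam)) * ℓ ^ 2 / √(N : ℝ) := by
  rw [stepMean_eq hN hoN]
  set S := dev lam N (o + 1) (m + 1)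
  set b := (1 + (lam : ℝ)) * (o + 1) - lam * N
  set n := √(N : ℝ) with hn
  have hN1 : (1 : ℝ) ≤ N := by exact_mod_cast hN
  have hnn : n * n = N := Real.mul_self_sqrt (by linarith)
  have hn1 : 1 ≤ n := Real.one_le_sqrt.2 hN1
  have hδ : |((o : ℝ) - m) / N - 3 * lam| ≤ 1 + 3 * lam := by
    have h1 : (m : ℝ) ≤ o := by exact_mod_cast hmo
    have h2 : (o : ℝ) + 1 ≤ N := by exact_mod_cast hoN
    have h3 : 0 ≤ ((o : ℝ) - m) / N := div_nonneg (by linarith) (by linarith)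
    have h4 : ((o : ℝ) - m) / N ≤ 1 := by
      rw [div_le_one (by linarith)]
      have : (0 : ℝ) ≤ m := Nat.cast_nonneg m
      linarith
    rw [abs_le]
    constructor <;> linarith
  generalize ((o : ℝ) - m) / N - 3 * lam = δ at *
  set D := (N : ℝ) - b + 3 * (1 + lam) with hD
  have hDN : (N : ℝ) / 2 ≤ D := by linarith [le_abs_self b]
  have hD0 : 0 < D := by linarith
  have e : n * ((-S + δ) / D) + S / n = (N * δ + S * (3 * (1 + lam) - b)) / (n * D) := by
    rw [← hnn] at hD ⊢
    field_simp
    rw [hD]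
    ring
  rw [e, abs_div, abs_of_pos (by positivity : 0 < n * D), div_le_div_iff₀ (by positivity)
    (by positivity)]
  have h1 : |(N : ℝ) * δ + S * (3 * (1 + lam) - b)| ≤
      N * (1 + 3 * lam) + P * n * ℓ * (3 * (1 + lam) + P * n * ℓ) := by
    refine (abs_add_le _ _).trans (add_le_add ?_ ?_)
    · rw [abs_mul, abs_of_pos (by linarith : (0 : ℝ) < N)]
      exact mul_le_mul_of_nonneg_left hδ (by linarith)
    · rw [abs_mul]
      refine mul_le_mul hS ?_ (abs_nonneg _) (by positivity)
      refine (abs_sub _ _).trans (add_le_add (abs_of_nonneg (by positivity)).le hb)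
  have h2 : (N : ℝ) * (1 + 3 * lam) + P * n * ℓ * (3 * (1 + lam) + P * n * ℓ) ≤
      N * ((1 + 3 * lam + P ^ 2 + 3 * P * (1 + lam)) * ℓ ^ 2) := by
    rw [← hnn]
    have a1 : n * n * (1 + 3 * lam) * 1 ≤ n * n * (1 + 3 * lam) * ℓ ^ 2 :=
      mul_le_mul_of_nonneg_left (one_le_pow₀ hℓ) (by positivity)
    have a2 : P * 3 * (1 + lam) * (n * ℓ * 1) ≤ P * 3 * (1 + lam) * (n * ℓ * (n * ℓ)) := by
      refine mul_le_mul_of_nonneg_left (mul_le_mul_of_nonneg_left ?_ (by positivity))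
        (by positivity)
      nlinarith
    linarith
  calc _ ≤ N * ((1 + 3 * lam + P ^ 2 + 3 * P * (1 + lam)) * ℓ ^ 2) * n :=
        mul_le_mul_of_nonneg_right (h1.trans h2) (by linarith)
    _ = 2 * (1 + 3 * lam + P ^ 2 + 3 * P * (1 + lam)) * ℓ ^ 2 * (n * (N / 2)) := by ring
    _ ≤ _ := mul_le_mul_of_nonneg_left (mul_le_mul_of_nonneg_left hDN (by linarith)) (by positivity)

/-- Near criticality there are about `λ` sleepers for each empty vertex; `dev` measures the defect
in this proportion. -/
lemma abs_ratio_sub_le {P ℓ : ℝ} (hN : 0 < N) (hoN : o + 1 ≤ N) (hP : 0 ≤ P)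
    (hℓ : 1 ≤ ℓ) (hS : |dev lam N (o + 1) (m + 1)| ≤ P * √(N : ℝ) * ℓ)
    (hb : |(1 + (lam : ℝ)) * (o + 1) - lam * N| ≤ P * √(N : ℝ) * ℓ)
    (hPN : P * √(N : ℝ) * ℓ ≤ N / 2) :
    |((o : ℝ) - m) / ((N : ℝ) - o + 2) - lam| ≤
      2 * (1 + lam) * (3 * lam + P) * (ℓ / √(N : ℝ)) := by
  have hl : (0 : ℝ) ≤ lam := lam.coe_nonneg
  have ho : (o : ℝ) + 1 ≤ N := by exact_mod_cast hoN
  have ht : (0 : ℝ) < (N : ℝ) - o + 2 := by linarith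
  set n := √(N : ℝ) with hn
  have hN1 : (1 : ℝ) ≤ N := by exact_mod_cast hN
  have hnn : n * n = N := Real.mul_self_sqrt (by linarith)
  have hn1 : 1 ≤ n := Real.one_le_sqrt.2 hN1
  have hDN : (N : ℝ) / 2 ≤ (1 + lam) * (N - o + 2) := by
    have := le_abs_self ((1 + (lam : ℝ)) * (o + 1) - lam * N)
    linarith
  have e : ((o : ℝ) - m) / ((N : ℝ) - o + 2) - lam =
      ((1 + lam) * (-3 * lam - dev lam N (o + 1) (m + 1))) / ((1 + lam) * (N - o + 2)) := by
    rw [dev]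
    push_cast
    field_simp
    ring
  rw [e, abs_div, abs_of_pos (by positivity : (0 : ℝ) < (1 + lam) * (N - o + 2)),
    div_le_iff₀ (by positivity), abs_mul, abs_of_pos (by positivity : (0 : ℝ) < 1 + lam)]
  have h1 : |-3 * (lam : ℝ) - dev lam N (o + 1) (m + 1)| ≤ (3 * lam + P) * (n * ℓ) := by
    refine (abs_sub _ _).trans ?_
    have : |-3 * (lam : ℝ)| = 3 * lam := by rw [abs_mul, abs_of_nonneg hl]; norm_num
    rw [this]
    nlinarith [mul_nonneg hl (show 0 ≤ n * ℓ - 1 by nlinarith)]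
  calc (1 + (lam : ℝ)) * |-3 * (lam : ℝ) - dev lam N (o + 1) (m + 1)|
      ≤ (1 + lam) * ((3 * lam + P) * (n * ℓ)) := mul_le_mul_of_nonneg_left h1 (by positivity)
    _ = 2 * (1 + lam) * (3 * lam + P) * (ℓ / n) * (N / 2) := by
        rw [← hnn]
        field_simp
    _ ≤ _ := mul_le_mul_of_nonneg_left hDN (by positivity)

/-- Here `r` and `y` are the ratios of sleepers to stopping vertices in the two factors of the
second moment, `ν` is `1 / N` and `x` the small parameter `ℓ / √N`. -/
lemma abs_secondMoment_aux {r y l Q C x ν : ℝ} (hl : 0 ≤ l) (hlQ : l ≤ Q) (hQ1 : 1 ≤ Q)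
    (hC1 : 1 ≤ C) (hx0 : 0 ≤ x) (hx1 : x ≤ 1) (hr0 : 0 ≤ r) (hrle : r ≤ 3 * Q * C)
    (hr1 : |r - l| ≤ 2 * Q * C * x) (hy1 : |y - l| ≤ 10 * Q ^ 2 * C * x)
    (hν : 0 ≤ ν) (hNx : ν ≤ x) :
    |(r - l) + 2 * (r * (y - l) + l * (r - l)) + (r + 2 * r * y) * ν| ≤ 150 * Q ^ 5 * C ^ 2 * x := by
  have hyle : |y| ≤ 11 * Q ^ 2 * C := by
    have h1 : |y| ≤ |y - l| + l := by
      have := abs_add_le (y - l) l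
      rw [sub_add_cancel, abs_of_nonneg hl] at this
      exact this
    have h2 : 10 * Q ^ 2 * C * x ≤ 10 * Q ^ 2 * C * 1 :=
      mul_le_mul_of_nonneg_left hx1 (by positivity)
    have h3 : l ≤ Q ^ 2 * C := by
      have hQC : 1 ≤ Q * C := by nlinarith
      have : Q * 1 ≤ Q ^ 2 * C := by
        rw [pow_two, mul_assoc]
        exact mul_le_mul_of_nonneg_left hQC (by linarith)
      linarith
    linarith
  have b1 : |r * (y - l)| ≤ 3 * Q * C * (10 * Q ^ 2 * C * x) := by
    rw [abs_mul, abs_of_nonneg hr0]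
    exact mul_le_mul hrle hy1 (abs_nonneg _) (by positivity)
  have b2 : |l * (r - l)| ≤ Q * (2 * Q * C * x) := by
    rw [abs_mul, abs_of_nonneg hl]
    exact mul_le_mul hlQ hr1 (abs_nonneg _) (by positivity)
  have b3 : |(r + 2 * r * y) * ν| ≤ (3 * Q * C + 2 * (3 * Q * C) * (11 * Q ^ 2 * C)) * x := by
    rw [abs_mul, abs_of_nonneg hν]
    refine mul_le_mul ((abs_add_le _ _).trans ?_) hNx hν (by positivity)
    rw [abs_of_nonneg hr0, abs_mul, abs_of_nonneg (by linarith : 0 ≤ 2 * r)]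
    refine add_le_add hrle (mul_le_mul (by linarith) hyle (abs_nonneg _) (by positivity))
  have b4 : |(r - l) + 2 * (r * (y - l) + l * (r - l)) + (r + 2 * r * y) * ν| ≤
      2 * Q * C * x + 2 * (3 * Q * C * (10 * Q ^ 2 * C * x) + Q * (2 * Q * C * x)) +
        (3 * Q * C + 2 * (3 * Q * C) * (11 * Q ^ 2 * C)) * x := by
    refine (abs_add_le _ _).trans (add_le_add ((abs_add_le _ _).trans (add_le_add hr1 ?_)) b3)
    rw [abs_mul, abs_of_pos (by norm_num : (0 : ℝ) < 2)]
    exact mul_le_mul_of_nonneg_left ((abs_add_le _ _).trans (add_le_add b1 b2)) (by norm_num)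
  refine b4.trans ?_
  have c1 : Q * C * x ≤ Q ^ 3 * C ^ 2 * x := by
    refine mul_le_mul_of_nonneg_right ?_ hx0
    exact mul_le_mul (le_self_pow₀ hQ1 (by norm_num)) (le_self_pow₀ hC1 (by norm_num))
      (by linarith) (by positivity)
  have c2 : Q ^ 2 * C * x ≤ Q ^ 3 * C ^ 2 * x := by
    refine mul_le_mul_of_nonneg_right ?_ hx0
    exact mul_le_mul (pow_le_pow_right₀ hQ1 (by norm_num)) (le_self_pow₀ hC1 (by norm_num))
      (by linarith) (by positivity)
  have c3 : Q ^ 3 * C ^ 2 * x ≤ Q ^ 5 * C ^ 2 * x := by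
    refine mul_le_mul_of_nonneg_right ?_ hx0
    exact mul_le_mul_of_nonneg_right (pow_le_pow_right₀ hQ1 (by norm_num)) (by positivity)
  have c4 : 0 ≤ Q ^ 5 * C ^ 2 * x := by positivity
  linarith

-- With all ratios equal to `λ` the second moment is `(λ + λ + 2 λ²) / (1 + λ) = 2 λ`; the ratios
-- differ from `λ` by `O(ℓ / √N)`.
set_option maxHeartbeats 800000 in
lemma abs_stepSecondMoment_sub_le {P ℓ : ℝ} (hN : 0 < N) (hoN : o + 1 ≤ N) (hmo : m ≤ o)
    (hP : 0 ≤ P) (hℓ : 1 ≤ ℓ) (hℓn : ℓ ≤ √(N : ℝ))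
    (hS : |dev lam N (o + 1) (m + 1)| ≤ P * √(N : ℝ) * ℓ)
    (hb : |(1 + (lam : ℝ)) * (o + 1) - lam * N| ≤ P * √(N : ℝ) * ℓ)
    (hPN : P * √(N : ℝ) * ℓ ≤ N / 2) :
    |stepSecondMoment lam N o m - 2 * lam| ≤
      150 * (1 + lam) ^ 4 * (3 * lam + P + 1) ^ 2 * (ℓ / √(N : ℝ)) := by
  have hl : (0 : ℝ) ≤ lam := lam.coe_nonneg
  have hr := abs_ratio_sub_le hN hoN hP hℓ hS hb hPN
  have ho : (o : ℝ) + 1 ≤ N := by exact_mod_cast hoN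
  have hmo' : (m : ℝ) ≤ o := by exact_mod_cast hmo
  have ht : (0 : ℝ) < (N : ℝ) - o + 2 := by linarith
  set n := √(N : ℝ) with hn
  have hnn : n * n = N := Real.mul_self_sqrt (by linarith)
  have hDN : (N : ℝ) / 2 ≤ (1 + lam) * (N - o + 2) := by
    have := le_abs_self ((1 + (lam : ℝ)) * (o + 1) - lam * N)
    linarith
  set x := ℓ / n with hx
  have hx0 : 0 ≤ x := by positivity
  have hx1 : x ≤ 1 := (div_le_one (by linarith)).2 hℓn
  have hNx : 1 / (N : ℝ) ≤ x := by
    rw [hx, div_le_div_iff₀ (by linarith) (by linarith), ← hnn]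
    nlinarith [mul_nonneg (show 0 ≤ n by linarith) (show 0 ≤ n - 1 by linarith),
      mul_nonneg (mul_nonneg (show 0 ≤ n by linarith) (show 0 ≤ n by linarith))
        (show 0 ≤ ℓ - 1 by linarith)]
  set t := (N : ℝ) - o + 2 with htdef
  have et : (N : ℝ) - o + 3 = t + 1 := by rw [htdef]; ring
  have htinv : 1 / (t + 1) ≤ 2 * (1 + lam) * x := by
    have : 1 / (t + 1) ≤ 2 * (1 + lam) * (1 / (N : ℝ)) := by
      rw [div_le_iff₀ (by linarith), mul_one_div, div_mul_eq_mul_div, le_div_iff₀ (by linarith)]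
      nlinarith
    exact this.trans (mul_le_mul_of_nonneg_left hNx (by positivity))
  set Q : ℝ := 1 + lam with hQ
  set C : ℝ := 3 * lam + P + 1 with hC
  have hQ1 : 1 ≤ Q := by linarith
  have hC1 : 1 ≤ C := by linarith
  have hr1 : |((o : ℝ) - m) / t - lam| ≤ 2 * Q * C * x := by
    refine hr.trans (mul_le_mul_of_nonneg_right ?_ hx0)
    exact mul_le_mul_of_nonneg_left (by linarith) (by linarith)
  set r := ((o : ℝ) - m) / t with hrdef
  have hr0 : 0 ≤ r := div_nonneg (by linarith) ht.le
  have hrle : r ≤ 3 * Q * C := by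
    have h1 := (abs_le.1 hr1).2
    nlinarith
  set y := ((o : ℝ) - m - 1) / (t + 1) with hydef
  have hyr : y - r = -(1 + r) * (1 / (t + 1)) := by
    have : (o : ℝ) - m = r * t := by rw [hrdef]; field_simp
    rw [hydef, this]
    field_simp
    ring
  have hQC : 1 ≤ Q * C := by nlinarith
  have hyr' : |y - r| ≤ 8 * Q ^ 2 * C * x := by
    rw [hyr, abs_mul, abs_neg, abs_of_nonneg (by linarith : 0 ≤ 1 + r),
      abs_of_nonneg (by positivity : 0 ≤ 1 / (t + 1))]
    calc (1 + r) * (1 / (t + 1)) ≤ (4 * Q * C) * (2 * Q * x) :=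
          mul_le_mul (by linarith) htinv (by positivity) (by positivity)
      _ = 8 * Q ^ 2 * C * x := by ring
  have hQ2 : Q * C * x ≤ Q ^ 2 * C * x := by
    have : Q ≤ Q ^ 2 := by nlinarith
    exact mul_le_mul_of_nonneg_right (mul_le_mul_of_nonneg_right this (by linarith)) hx0
  have hy1 : |y - lam| ≤ 10 * Q ^ 2 * C * x := by
    have := abs_sub_le y r lam
    linarith
  have em : stepSecondMoment lam N o m - 2 * lam = 1 / Q * ((r - lam) + 2 * (r * (y - lam) +
      lam * (r - lam)) + (r + 2 * r * y) * (1 / N)) := by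
    have h1 : 2 * ((o : ℝ) - m) * ((o : ℝ) - m - 1) / (t * (t + 1)) = 2 * r * y := by
      rw [hrdef, hydef]
      field_simp
    rw [stepSecondMoment, et, h1, ← hQ]
    have : (lam : ℝ) = Q - 1 := by rw [hQ]; ring
    rw [this]
    field_simp
    ring
  rw [em, abs_mul, abs_of_nonneg (by positivity : 0 ≤ 1 / Q), one_div_mul_eq_div,
    div_le_iff₀ (by linarith)]
  refine (abs_secondMoment_aux hl (by linarith) hQ1 hC1 hx0 hx1 hr0 hrle hr1 hy1
    (by positivity) hNx).trans_eq ?_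
  ring

end moments

/-! ### Logarithmic scale and growth comparisons -/

/-- The order of magnitude `1 + √(log N)` of the deviation on the scale `√N`. -/
def logScale (N : ℕ) : ℝ := 1 + √(Real.log N)

lemma one_le_logScale (N : ℕ) : 1 ≤ logScale N := by
  rw [logScale]
  linarith [Real.sqrt_nonneg (Real.log N)]

lemma exists_mul_logScale_sq_le (C : ℝ) :
    ∃ N₀ : ℕ, 1 ≤ N₀ ∧ ∀ N : ℕ, N₀ ≤ N → C * logScale N ^ 2 ≤ √(N : ℝ) := by
  have h1 : (fun x : ℝ => Real.log x) =o[Filter.atTop] fun x => x ^ (1 / 2 : ℝ) :=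
    isLittleO_log_rpow_atTop (by norm_num)
  have h2 := h1.def (show (0 : ℝ) < 1 / (4 * (|C| + 1)) by positivity)
  have h3 : ∀ᶠ x : ℝ in Filter.atTop, 4 * |C| ≤ x ^ (1 / 2 : ℝ) :=
    (tendsto_rpow_atTop (by norm_num)).eventually_ge_atTop _
  have h4 := (tendsto_natCast_atTop_atTop (R := ℝ)).eventually (h2.and h3)
  obtain ⟨N₀, hN₀⟩ := Filter.eventually_atTop.1 h4
  refine ⟨N₀ + 1, by omega, fun N hN => ?_⟩
  obtain ⟨ha, hb⟩ := hN₀ N (by omega)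
  have hN1 : (1 : ℝ) ≤ N := by exact_mod_cast (show 1 ≤ N by omega)
  have hlog : 0 ≤ Real.log N := Real.log_nonneg hN1
  rw [← Real.sqrt_eq_rpow] at ha hb
  rw [Real.norm_of_nonneg hlog, Real.norm_of_nonneg (Real.sqrt_nonneg _), one_div_mul_eq_div,
    le_div_iff₀ (by positivity)] at ha
  have h5 : logScale N ^ 2 ≤ 2 + 2 * Real.log N := by
    rw [logScale]
    nlinarith [Real.sq_sqrt hlog, sq_nonneg (√(Real.log N) - 1)]
  calc C * logScale N ^ 2 ≤ |C| * (2 + 2 * Real.log N) :=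
        mul_le_mul (le_abs_self C) h5 (by positivity) (abs_nonneg C)
    _ ≤ √(N : ℝ) := by nlinarith [abs_nonneg C]

/-- Converts cubic Taylor errors into the exponential errors `R z ^ k` that `ev_step_le` can
propagate; `l` leaves room for the shift by `λ` when a particle is lost. -/
lemma exists_cube_le_mul_pow {z l : ℝ} (hz : 1 < z) (hl : 0 ≤ l) :
    ∃ K : ℝ, 1 ≤ K ∧ ∀ k : ℕ, ((k : ℝ) + l) ^ 3 ≤ K * z ^ k := by
  obtain ⟨M, hM⟩ := (tendsto_pow_const_div_const_pow_of_one_lt 3 hz).bddAbove_range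
  refine ⟨max 1 (4 * (M + l ^ 3)), le_max_left _ _, fun k => ?_⟩
  have hzk : 1 ≤ z ^ k := one_le_pow₀ hz.le
  have h1 : (k : ℝ) ^ 3 ≤ M * z ^ k := by
    rw [← div_le_iff₀ (by linarith)]
    exact hM ⟨k, rfl⟩
  have h2 : ((k : ℝ) + l) ^ 3 ≤ 4 * ((k : ℝ) ^ 3 + l ^ 3) := by
    have := add_pow_le (Nat.cast_nonneg k : (0 : ℝ) ≤ k) hl 3
    norm_num at this
    exact this
  have h3 : l ^ 3 ≤ l ^ 3 * z ^ k := le_mul_of_one_le_right (by positivity) hzk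
  calc ((k : ℝ) + l) ^ 3 ≤ 4 * (M + l ^ 3) * z ^ k := by linarith
    _ ≤ _ := mul_le_mul_of_nonneg_right (le_max_right _ _) (by linarith)

/-! ### Negative drift of the shifted scale function -/

section drift

variable {lam : ℝ≥0}

/-- The counts `x`, `y` are at most of order `√(N log N)` away from the critical line, and the
deviation has not reached `√N`. -/
structure IsModerate (lam : ℝ≥0) (B : ℝ) (N x y : ℕ) : Prop where
  dev_lt : dev lam N x y < √(N : ℝ)
  excess_le : (1 + (lam : ℝ)) * x - lam * N ≤ B * √(N : ℝ) * logScale N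

lemma IsModerate.abs_dev_le {B : ℝ} (hB : 0 ≤ B) {N x y : ℕ} (h : IsModerate lam B N x y) :
    |dev lam N x y| ≤ (1 + B) * √(N : ℝ) * logScale N := by
  have h1 := h.dev_lt
  have h2 := h.excess_le
  have h3 : √(N : ℝ) ≤ √(N : ℝ) * logScale N :=
    le_mul_of_one_le_right (Real.sqrt_nonneg _) (one_le_logScale N)
  have h5 : 0 ≤ B * √(N : ℝ) * logScale N :=
    mul_nonneg (mul_nonneg hB (Real.sqrt_nonneg _)) (zero_le_one.trans (one_le_logScale N))
  have h6 := Real.sqrt_nonneg (N : ℝ)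
  rw [abs_le]
  constructor
  · rw [dev]
    linarith
  · linarith

lemma IsModerate.abs_excess_le {B : ℝ} (hB : 0 ≤ B) {N x y : ℕ} (h : IsModerate lam B N x y) :
    |(1 + (lam : ℝ)) * x - lam * N| ≤ (1 + B) * √(N : ℝ) * logScale N := by
  have h1 := h.dev_lt
  have h2 := h.excess_le
  have h3 : √(N : ℝ) ≤ √(N : ℝ) * logScale N :=
    le_mul_of_one_le_right (Real.sqrt_nonneg _) (one_le_logScale N)
  have h5 : 0 ≤ B * √(N : ℝ) * logScale N :=
    mul_nonneg (mul_nonneg hB (Real.sqrt_nonneg _)) (zero_le_one.trans (one_le_logScale N))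
  have h6 := Real.sqrt_nonneg (N : ℝ)
  rw [dev] at h1
  rw [abs_le]
  constructor <;> linarith

lemma IsModerate.abs_div_sub_le {B : ℝ} (hB : 0 ≤ B) {N x y : ℕ} (h : IsModerate lam B N x y)
    (hN : 0 < N) {σ : ℝ} (hσ : |σ| = 1) :
    |dev lam N x y / √(N : ℝ) - σ| ≤ (2 + B) * logScale N := by
  have hn : 0 < √(N : ℝ) := Real.sqrt_pos.2 (by exact_mod_cast hN)
  have h1 := h.abs_dev_le hB
  have h2 := one_le_logScale N
  refine (abs_sub _ _).trans ?_
  rw [abs_div, abs_of_pos hn, hσ]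
  have : |dev lam N x y| / √(N : ℝ) ≤ (1 + B) * logScale N := by
    rw [div_le_iff₀ hn]
    linarith
  linarith

set_option maxHeartbeats 1000000 in
/-- For a moderate state the quadratic terms of a step of a scale function are negative and dominate
the error terms. -/
lemma exists_drift_nonpos (hlam : 0 < lam) {B K : ℝ} (hB : 0 ≤ B) (hK : 0 ≤ K) :
    ∃ N₀ : ℕ, 1 ≤ N₀ ∧ ∀ N : ℕ, N₀ ≤ N → ∀ o m : ℕ, m ≤ o → o + 1 ≤ N →
      IsModerate lam B N (o + 1) (m + 1) →
      2 * ((o : ℝ) - m) * ((1 + 1 / (4 * (lam : ℝ))) - 1) ≤ (N : ℝ) - o + 1 ∧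
      ∀ σ w E R D : ℝ, |σ| = 1 → w = dev lam N (o + 1) (m + 1) / √(N : ℝ) - σ → 0 ≤ E →
        R ≤ K * logScale N ^ 2 * E / √(N : ℝ) ^ 3 → D ≤ K * logScale N ^ 2 * E / √(N : ℝ) →
        σ * E / √(N : ℝ) * stepMean lam N o m +
          σ * w * E / (lam * √(N : ℝ) ^ 2) / 2 * stepSecondMoment lam N o m + 4 * R +
          4 * D / ((N : ℝ) - o + 1) ≤ 0 := by
  have hl : (0 : ℝ) < lam := by exact_mod_cast hlam
  set P : ℝ := 1 + B with hP
  have hP0 : 0 ≤ P := by linarith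
  set C1 : ℝ := 2 * (1 + 3 * lam + P ^ 2 + 3 * P * (1 + lam)) with hC1
  set C2 : ℝ := 150 * (1 + lam) ^ 4 * (3 * lam + P + 1) ^ 2 with hC2
  set C3 : ℝ := 2 * (1 + lam) * (3 * lam + P) with hC3
  set C : ℝ := C1 + (1 + P) * (C2 / (2 * lam)) + 4 * K + 12 * K * (1 + lam) with hC
  -- The four summands are needed, in turn, for the total error, the excess below `N / 2`, `ℓ ≤ √N`,
  -- and the ratio of sleepers to stops within `λ / 4` of `λ`.
  obtain ⟨N₀, h1, hN₀⟩ := exists_mul_logScale_sq_le (C + 2 * P + 1 + 4 / lam * C3)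
  refine ⟨N₀, h1, fun N hN o m hmo hoN hmod => ?_⟩
  have hNpos : 0 < N := by omega
  have hbig := hN₀ N hN
  set n := √(N : ℝ) with hn
  set ℓ := logScale N with hℓ
  have hℓ1 : 1 ≤ ℓ := one_le_logScale N
  have hN1 : (1 : ℝ) ≤ N := by exact_mod_cast hNpos
  have hnn : n * n = N := Real.mul_self_sqrt (by linarith)
  have hn1 : 1 ≤ n := Real.one_le_sqrt.2 hN1
  have hℓ2 : ℓ ≤ ℓ ^ 2 := le_self_pow₀ hℓ1 (by norm_num)
  have q1 : C * ℓ ^ 2 ≤ n := by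
    have : 0 ≤ (2 * P + 1 + 4 / lam * C3) * ℓ ^ 2 := by positivity
    linarith
  have q2 : 2 * P * ℓ ≤ n := by
    have : 0 ≤ (C + 1 + 4 / lam * C3) * ℓ ^ 2 := by positivity
    have : 2 * P * ℓ ≤ 2 * P * ℓ ^ 2 := mul_le_mul_of_nonneg_left hℓ2 (by positivity)
    linarith
  have q3 : ℓ ≤ n := by
    have : 0 ≤ (C + 2 * P + 4 / lam * C3) * ℓ ^ 2 := by positivity
    linarith
  have q4 : 4 / lam * C3 * ℓ ≤ n := by
    have : 0 ≤ (C + 2 * P + 1) * ℓ ^ 2 := by positivity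
    have : 4 / lam * C3 * ℓ ≤ 4 / lam * C3 * ℓ ^ 2 := mul_le_mul_of_nonneg_left hℓ2 (by positivity)
    linarith
  have hPN : P * n * ℓ ≤ N / 2 := by
    rw [← hnn]
    linarith [mul_le_mul_of_nonneg_right q2 (show 0 ≤ n by linarith)]
  have hS := hmod.abs_dev_le hB
  have hb := hmod.abs_excess_le hB
  push_cast at hb
  have m1 := abs_mul_stepMean_add_le hNpos hoN hmo hP0 hℓ1 hS hb hPN
  have m2 := abs_stepSecondMoment_sub_le hNpos hoN hmo hP0 hℓ1 q3 hS hb hPN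
  have m3 := abs_ratio_sub_le hNpos hoN hP0 hℓ1 hS hb hPN
  rw [← hC1] at m1
  rw [← hC2] at m2
  rw [← hC3] at m3
  have ho : (o : ℝ) + 1 ≤ N := by exact_mod_cast hoN
  constructor
  · have h4 : C3 * (ℓ / n) ≤ lam / 4 := by
      rw [mul_div_assoc', div_le_iff₀ (by linarith)]
      calc C3 * ℓ = lam / 4 * (4 / lam * C3 * ℓ) := by field_simp
        _ ≤ lam / 4 * n := mul_le_mul_of_nonneg_left q4 (by positivity)
    have h5 := (abs_le.1 (m3.trans h4)).2
    have h6 : ((o : ℝ) - m) / ((N : ℝ) - o + 2) ≤ 5 / 4 * lam := by linarith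
    rw [div_le_iff₀ (by linarith)] at h6
    have e : 2 * ((o : ℝ) - m) * ((1 + 1 / (4 * (lam : ℝ))) - 1) = ((o : ℝ) - m) / (2 * lam) := by
      field_simp
      ring
    rw [e, div_le_iff₀ (by positivity)]
    linarith [mul_nonneg hl.le (show 0 ≤ (N : ℝ) - o - 1 by linarith)]
  · intro σ w E R D hσ hw hE hR hD
    have hwle : |w| ≤ (1 + P) * ℓ := by
      rw [hw]
      exact (hmod.abs_div_sub_le hB hNpos hσ).trans_eq (by rw [hP, hℓ]; ring)
    have hσ2 : σ * σ = 1 := by rw [← abs_mul_abs_self, hσ, one_mul]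
    have hT : (N : ℝ) ≤ 3 * (1 + lam) * (N - o + 1) := by
      have := le_abs_self ((1 + (lam : ℝ)) * (o + 1) - lam * N)
      linarith [mul_nonneg hl.le (show 0 ≤ (N : ℝ) - o - 1 by linarith)]
    have hT0 : 0 < (N : ℝ) - o + 1 := by linarith
    set μ1 := stepMean lam N o m
    set μ2 := stepSecondMoment lam N o m
    set S := dev lam N (o + 1) (m + 1)
    have s1 : σ * (n * μ1 + S / n) ≤ C1 * ℓ ^ 2 / n := by
      refine (le_abs_self _).trans ?_
      rw [abs_mul, hσ, one_mul]
      exact m1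
    have s2 : σ * (w * ((μ2 - 2 * lam) / (2 * lam))) ≤ (1 + P) * (C2 / (2 * lam)) * ℓ ^ 2 / n := by
      refine (le_abs_self _).trans ?_
      rw [abs_mul, hσ, one_mul, abs_mul, abs_div, abs_of_pos (by positivity : 0 < 2 * (lam : ℝ))]
      calc |w| * (|μ2 - 2 * lam| / (2 * lam)) ≤ ((1 + P) * ℓ) * (C2 * (ℓ / n) / (2 * lam)) :=
            mul_le_mul hwle (div_le_div_of_nonneg_right m2 (by positivity)) (by positivity)
              (by positivity)
        _ = _ := by field_simp
    have s3 : N * (4 * R) ≤ 4 * K * ℓ ^ 2 / n * E := by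
      calc N * (4 * R) ≤ N * (4 * (K * ℓ ^ 2 * E / n ^ 3)) := by gcongr
        _ = 4 * K * ℓ ^ 2 / n * E := by
          rw [← hnn]
          field_simp
    have s4 : N * (4 * D / ((N : ℝ) - o + 1)) ≤ 12 * K * (1 + lam) * ℓ ^ 2 / n * E := by
      have hD' : 4 * D / ((N : ℝ) - o + 1) ≤ 4 * (K * ℓ ^ 2 * E / n) / ((N : ℝ) - o + 1) := by
        gcongr
      calc N * (4 * D / ((N : ℝ) - o + 1))
          ≤ (3 * (1 + lam) * (N - o + 1)) * (4 * (K * ℓ ^ 2 * E / n) / ((N : ℝ) - o + 1)) :=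
            (mul_le_mul_of_nonneg_left hD' (by linarith)).trans
              (mul_le_mul_of_nonneg_right hT (by positivity))
        _ = _ := by
          field_simp
          ring
    have s5 : C * ℓ ^ 2 / n ≤ 1 := (div_le_one (by linarith)).2 q1
    -- With `S / n = w + σ`, the leading terms `-σ w` and `+σ w` cancel, which is harmonicity of the
    -- scale function. The shift leaves `-σ² = -1`, the margin that pays for the errors.
    have key : N * (σ * E / n * μ1 + σ * w * E / (lam * n ^ 2) / 2 * μ2) =
        E * (σ * (n * μ1 + S / n) + σ * (w * ((μ2 - 2 * lam) / (2 * lam))) - 1) := by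
      have hS' : S / n = w + σ := by rw [hw]; ring
      rw [hS', ← hnn]
      have : E * (σ * (n * μ1 + (w + σ)) + σ * (w * ((μ2 - 2 * lam) / (2 * lam))) - 1) =
          E * (σ * n * μ1 + σ * w * μ2 / (2 * lam) + (σ * σ - 1)) := by
        field_simp
        ring
      rw [this, hσ2]
      field_simp
      ring
    have hsum : C * ℓ ^ 2 / n = C1 * ℓ ^ 2 / n + (1 + P) * (C2 / (2 * lam)) * ℓ ^ 2 / n +
        4 * K * ℓ ^ 2 / n + 12 * K * (1 + lam) * ℓ ^ 2 / n := by rw [hC]; ring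
    have hfin : N * (σ * E / n * μ1 + σ * w * E / (lam * n ^ 2) / 2 * μ2 + 4 * R +
        4 * D / ((N : ℝ) - o + 1)) ≤ 0 := by
      have := mul_le_mul_of_nonneg_left (add_le_add s1 s2) hE
      have := mul_le_mul_of_nonneg_left s5 hE
      rw [hsum] at this
      linarith
    exact nonpos_of_mul_nonpos_right hfin (by linarith)

end drift

/-! ### The two superharmonic functions -/

section superharmonic

variable {lam : ℝ≥0}

/-- With centre `+1` the truncation at `0` sits at `S = √N`, so the function is untruncated as long
as the chain runs and overshoots only lower it. -/
lemma exists_ev_step_min_le (hlam : 0 < lam) {B : ℝ} (hB : 0 ≤ B) :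
    ∃ N₀ : ℕ, 1 ≤ N₀ ∧ ∀ N : ℕ, N₀ ≤ N → ∀ η : Config N, act η ≠ 0 →
      IsModerate lam B N (occ η) (act η) → ∀ (G : ℕ → ℕ → ℝ) (a c : ℝ), 0 ≤ c →
      (∀ x ≤ occ η, ∀ y, G x y =
        a + c * min (scaleFun lam (dev lam N x y / √(N : ℝ) - 1)) 0) →
      ev (step lam η) (fun ζ => G (occ ζ) (act ζ)) ≤ G (occ η) (act η) := by
  have hl : (0 : ℝ) < lam := by exact_mod_cast hlam
  set z : ℝ := 1 + 1 / (4 * (lam : ℝ)) with hz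
  have hz1 : 1 < z := by
    have : 0 < 1 / (4 * (lam : ℝ)) := by positivity
    linarith
  obtain ⟨Kz, hKz1, hKz⟩ := exists_cube_le_mul_pow hz1 hl.le
  obtain ⟨K, hK0, hK⟩ := exists_min_scaleFun_add_le hl
  obtain ⟨N₀, hN₀1, hN₀⟩ := exists_drift_nonpos hlam hB
    (K := K * Kz * (1 + (2 + B) ^ 2) + lam) (by positivity)
  refine ⟨N₀, hN₀1, fun N hN η hact hmod G a c hc hG => ?_⟩
  have hNpos : 0 < N := by omega
  obtain ⟨m, hm⟩ : ∃ m, act η = m + 1 := ⟨act η - 1, by omega⟩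
  obtain ⟨o, ho⟩ : ∃ o, occ η = o + 1 := ⟨occ η - 1, by have := act_le_occ η; omega⟩
  have hmo : m ≤ o := by have := act_le_occ η; omega
  have hoN : o + 1 ≤ N := ho ▸ occ_le η
  rw [ho, hm] at hmod
  obtain ⟨hs, hdrift⟩ := hN₀ N hN o m hmo hoN hmod
  have hw2 := hmod.abs_div_sub_le hB hNpos (σ := 1) abs_one
  have hdlt := hmod.dev_lt
  set n := √(N : ℝ) with hn
  have hn1 : 1 ≤ n := Real.one_le_sqrt.2 (by exact_mod_cast hNpos)
  have hn0 : 0 < n := by linarith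
  set S := dev lam N (o + 1) (m + 1) with hS
  set w := S / n - 1 with hw
  have hw0 : w ≤ 0 := by
    rw [hw, sub_nonpos, div_le_one hn0]
    exact hdlt.le
  have hℓ1 := one_le_logScale N
  set ℓ := logScale N with hℓ
  set g := gaussInv lam w with hg
  have hg0 : 0 < g := gaussInv_pos _ _
  set R : ℝ := c * (K * Kz * (1 + w ^ 2) * g / n ^ 3) with hR
  set D : ℝ := c * (g * lam / n) with hD
  have hw3 : 1 + w ^ 2 ≤ (1 + (2 + B) ^ 2) * ℓ ^ 2 := by
    have : w ^ 2 ≤ ((2 + B) * ℓ) ^ 2 := by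
      rw [← sq_abs]
      exact pow_le_pow_left₀ (abs_nonneg _) hw2 2
    nlinarith
  have hR0 : 0 ≤ R := by positivity
  have hD0 : 0 ≤ D := by positivity
  have hRle : R ≤ (K * Kz * (1 + (2 + B) ^ 2) + lam) * ℓ ^ 2 * (c * g) / n ^ 3 := by
    have h1 : K * Kz * (1 + w ^ 2) ≤ (K * Kz * (1 + (2 + B) ^ 2) + lam) * ℓ ^ 2 := by
      have := mul_le_mul_of_nonneg_left hw3 (show 0 ≤ K * Kz by positivity)
      have : 0 ≤ (lam : ℝ) * ℓ ^ 2 := by positivity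
      linarith
    calc R = K * Kz * (1 + w ^ 2) * (c * g) / n ^ 3 := by rw [hR]; ring
      _ ≤ _ := by gcongr
  have hDle : D ≤ (K * Kz * (1 + (2 + B) ^ 2) + lam) * ℓ ^ 2 * (c * g) / n := by
    have h1 : (lam : ℝ) ≤ (K * Kz * (1 + (2 + B) ^ 2) + lam) * ℓ ^ 2 := by
      have h2 : (lam : ℝ) * 1 ≤ lam * ℓ ^ 2 :=
        mul_le_mul_of_nonneg_left (one_le_pow₀ hℓ1) hl.le
      have : 0 ≤ (K * Kz * (1 + (2 + B) ^ 2)) * ℓ ^ 2 := by positivity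
      linarith
    calc D = lam * (c * g) / n := by rw [hD]; ring
      _ ≤ _ := by gcongr
  have hfin := hdrift 1 w (c * g) R D abs_one rfl (by positivity) hRle hDle
  have hG1 : ∀ y, G (o + 1) y = a + c * min (scaleFun lam (dev lam N (o + 1) y / n - 1)) 0 :=
    hG (o + 1) ho.ge
  have hG0 : ∀ y, G o y = a + c * min (scaleFun lam (dev lam N o y / n - 1)) 0 :=
    hG o (by omega)
  have hup : ∀ v : ℝ, 0 ≤ v → a + c * min (scaleFun lam ((S + v) / n - 1)) 0 ≤
      a + c * scaleFun lam w + 1 * (c * g) / n * v + 1 * w * (c * g) / (lam * n ^ 2) / 2 * v ^ 2 +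
        c * (K * (1 + w ^ 2) * g / n ^ 3) * v ^ 3 := by
    intro v hv
    have h1 := hK w hw0 (v / n) (by positivity)
    have e : (S + v) / n - 1 = w + v / n := by rw [hw]; ring
    rw [e]
    have h2 := mul_le_mul_of_nonneg_left h1 hc
    refine (add_le_add_right h2 a).trans_eq ?_
    rw [← hg]
    field_simp
    ring
  have hmain := ev_step_le (lam := lam) ho hm (G := G) (T0 := a + c * scaleFun lam w)
    (T1 := 1 * (c * g) / n) (T2 := 1 * w * (c * g) / (lam * n ^ 2)) hR0 hD0 hz1.le hs ?_ ?_ ?_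
  · rw [ho, hm, hG1, ← hS, ← hw, min_eq_left ((scaleFun_mono lam hw0).trans_eq (scaleFun_zero lam))]
    linarith
  · have e : dev lam N (o + 1) m / n - 1 = w + -(1 / n) := by
      rw [hw, hS, dev, dev]
      push_cast
      ring
    rw [hG1, e]
    have h1 := (min_le_left _ 0).trans (scaleFun_add_le_of_nonpos hl w
      (neg_nonpos.2 (by positivity : 0 ≤ 1 / n)))
    have h2 := mul_le_mul_of_nonneg_left h1 hc
    refine (add_le_add_right h2 a).trans (le_of_le_of_eq (le_add_of_nonneg_right hR0) ?_)
    rw [← hg]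
    field_simp
    ring
  · intro k _
    have e : dev lam N (o + 1) (m + k + 1) = S + k := by
      rw [hS, dev, dev]
      push_cast
      ring
    rw [hG1, e]
    refine (hup k (Nat.cast_nonneg k)).trans ?_
    have h1 : (k : ℝ) ^ 3 ≤ Kz * z ^ k :=
      (pow_le_pow_left₀ (Nat.cast_nonneg k) (by linarith) 3).trans (hKz k)
    have h2 : c * (K * (1 + w ^ 2) * g / n ^ 3) * (k : ℝ) ^ 3 ≤ R * z ^ k := by
      refine (mul_le_mul_of_nonneg_left h1 (by positivity)).trans_eq ?_
      rw [hR]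
      ring
    linarith
  · intro k _
    -- Removal at the boundary raises `dev` by `1 + λ` and costs one active particle, a net `λ`
    -- beyond the `k` sleepers woken. The linear effect of `λ` is what `D` pays for.
    have e : dev lam N o (m + k) = S + (k + lam) := by
      rw [hS, dev, dev]
      push_cast
      ring
    rw [hG0, e]
    refine (hup (k + lam) (by positivity)).trans ?_
    have h2 : c * (K * (1 + w ^ 2) * g / n ^ 3) * ((k : ℝ) + lam) ^ 3 ≤ R * z ^ k := by
      refine (mul_le_mul_of_nonneg_left (hKz k) (by positivity)).trans_eq ?_
      rw [hR]
      ring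
    have h3 : D ≤ D * z ^ k := le_mul_of_one_le_right hD0 (one_le_pow₀ hz1.le)
    have h4 : 1 * (c * g) / n * ((k : ℝ) + lam) = 1 * (c * g) / n * k + D := by rw [hD]; ring
    -- The quadratic coefficient is nonpositive since `w ≤ 0`, so the shift by `λ` may be dropped
    -- there.
    have h5 : 1 * w * (c * g) / (lam * n ^ 2) / 2 * ((k : ℝ) + lam) ^ 2 ≤
        1 * w * (c * g) / (lam * n ^ 2) / 2 * (k : ℝ) ^ 2 := by
      refine mul_le_mul_of_nonpos_left (pow_le_pow_left₀ (Nat.cast_nonneg k) (by linarith) 2) ?_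
      have : 0 ≤ -w * (c * g) / (lam * n ^ 2) / 2 := by
        have : 0 ≤ -w := by linarith
        positivity
      linarith [show 1 * w * (c * g) / (lam * n ^ 2) / 2 = -(-w * (c * g) / (lam * n ^ 2) / 2) by ring]
    linarith

/-- The weight on `[w, b]` is at most its value at one of the endpoints, and both endpoint weights
are at least `1`. -/
lemma scaleFun_sub_le_mul {l w b : ℝ} (hl : 0 < l) (hw : w ≤ b) :
    scaleFun l b - scaleFun l w ≤ (b - w) * (gaussInv l b * gaussInv l w) := by
  refine scaleFun_sub_le hw fun x hx => ?_
  rcases le_or_gt |x| |b| with h | h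
  · exact (gaussInv_le_of_abs_le hl h).trans
      (le_mul_of_one_le_right (gaussInv_pos _ _).le (one_le_gaussInv hl w))
  · refine (gaussInv_le_of_abs_le hl ?_).trans
      (le_mul_of_one_le_left (gaussInv_pos _ _).le (one_le_gaussInv hl b))
    rcases le_total x 0 with h' | h'
    · rw [abs_of_nonpos h', abs_of_nonpos (hx.1.trans h')]
      linarith [hx.1]
    · rw [abs_of_nonneg h', abs_of_nonneg (h'.trans hx.2)] at h
      linarith [hx.2]

-- Losing a particle multiplies the function by `exp γ`. This costs about `γ (3 - w) gaussInv w =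
-- O(ℓ² / √N) gaussInv w`, to be weighted by the boundary probability of order `1 / N`, hence less
-- than the drift margin. The accompanying shift by `λ` only lowers the function.
set_option maxHeartbeats 1000000 in
lemma exists_ev_step_max_le (hlam : 0 < lam) {B Γ : ℝ} (hB : 0 ≤ B) (hΓ : 0 ≤ Γ) :
    ∃ N₀ : ℕ, 1 ≤ N₀ ∧ ∀ N : ℕ, N₀ ≤ N → ∀ η : Config N, act η ≠ 0 →
      IsModerate lam B N (occ η) (act η) → ∀ (G : ℕ → ℕ → ℝ) (c γ : ℝ), 0 ≤ c → 0 ≤ γ →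
      γ ≤ Γ * logScale N / √(N : ℝ) →
      (∀ y, G (occ η) y =
        c * max (scaleFun lam 3 - scaleFun lam (dev lam N (occ η) y / √(N : ℝ) + 1)) 0) →
      (∀ x, x + 1 = occ η → ∀ y, G x y = c * Real.exp γ *
        max (scaleFun lam 3 - scaleFun lam (dev lam N x y / √(N : ℝ) + 1)) 0) →
      ev (step lam η) (fun ζ => G (occ ζ) (act ζ)) ≤ G (occ η) (act η) := by
  have hl : (0 : ℝ) < lam := by exact_mod_cast hlam
  set z : ℝ := 1 + 1 / (4 * (lam : ℝ)) with hz
  have hz1 : 1 < z := by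
    have : 0 < 1 / (4 * (lam : ℝ)) := by positivity
    linarith
  obtain ⟨Kz, hKz1, hKz⟩ := exists_cube_le_mul_pow hz1 le_rfl
  obtain ⟨K, hK0, hK⟩ := exists_max_sub_scaleFun_add_le hl
  set K₁ : ℝ := 2 * Γ * (5 + B) * gaussInv lam 3 with hK₁
  have hK₁0 : 0 ≤ K₁ := by
    have := gaussInv_pos lam 3
    positivity
  obtain ⟨N₀, hN₀1, hN₀⟩ := exists_drift_nonpos hlam hB
    (K := K * Kz * (1 + (2 + B) ^ 2) + K₁) (by positivity)
  obtain ⟨N₁, hN₁1, hN₁⟩ := exists_mul_logScale_sq_le (Γ + (2 * (2 + B) + 1) / (2 * lam) + 1)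
  refine ⟨max N₀ N₁, hN₀1.trans (le_max_left _ _), fun N hN' η hact hmod G c γ hc hγ0 hγ hG1 hG0 => ?_⟩
  have hN : N₀ ≤ N := (le_max_left _ _).trans hN'
  have hbig := hN₁ N ((le_max_right _ _).trans hN')
  have hNpos : 0 < N := by omega
  obtain ⟨m, hm⟩ : ∃ m, act η = m + 1 := ⟨act η - 1, by omega⟩
  obtain ⟨o, ho⟩ : ∃ o, occ η = o + 1 := ⟨occ η - 1, by have := act_le_occ η; omega⟩
  have hmo : m ≤ o := by have := act_le_occ η; omega
  have hoN : o + 1 ≤ N := ho ▸ occ_le η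
  rw [ho] at hG1 hG0
  rw [ho, hm] at hmod
  obtain ⟨hs, hdrift⟩ := hN₀ N hN o m hmo hoN hmod
  have hw2 := hmod.abs_div_sub_le hB hNpos (σ := -1) (by simp)
  have hdlt := hmod.dev_lt
  have hn1 : 1 ≤ √(N : ℝ) := Real.one_le_sqrt.2 (by exact_mod_cast hNpos)
  set n := √(N : ℝ) with hn
  have hn0 : 0 < n := by linarith
  set S := dev lam N (o + 1) (m + 1) with hS
  rw [sub_neg_eq_add] at hw2
  set w := S / n + 1 with hw
  have hw0 : w ≤ 2 := by
    have : S / n ≤ 1 := (div_le_one hn0).2 hdlt.le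
    linarith
  have hℓ1 := one_le_logScale N
  set ℓ := logScale N with hℓ
  have hℓ2 : ℓ ≤ ℓ ^ 2 := le_self_pow₀ hℓ1 (by norm_num)
  set g := gaussInv lam w with hg
  have hg0 : 0 < g := gaussInv_pos _ _
  set M := scaleFun lam 3 with hM
  have hMw : 0 ≤ M - scaleFun lam w := sub_nonneg.2 (scaleFun_mono lam (by linarith))
  set R : ℝ := c * (K * Kz * (1 + w ^ 2) * g / n ^ 3) with hR
  set D : ℝ := c * (Real.exp γ - 1) * (M - scaleFun lam w) with hD
  have hw3 : 1 + w ^ 2 ≤ (1 + (2 + B) ^ 2) * ℓ ^ 2 := by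
    have : w ^ 2 ≤ ((2 + B) * ℓ) ^ 2 := by
      rw [← sq_abs]
      exact pow_le_pow_left₀ (abs_nonneg _) hw2 2
    nlinarith
  have hexp0 : 0 ≤ Real.exp γ - 1 := sub_nonneg.2 (Real.one_le_exp hγ0)
  have hR0 : 0 ≤ R := by positivity
  have hD0 : 0 ≤ D := by positivity
  have hRle : R ≤ (K * Kz * (1 + (2 + B) ^ 2) + K₁) * ℓ ^ 2 * (c * g) / n ^ 3 := by
    have h1 : K * Kz * (1 + w ^ 2) ≤ (K * Kz * (1 + (2 + B) ^ 2) + K₁) * ℓ ^ 2 := by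
      have := mul_le_mul_of_nonneg_left hw3 (show 0 ≤ K * Kz by positivity)
      have : 0 ≤ K₁ * ℓ ^ 2 := by positivity
      linarith
    calc R = K * Kz * (1 + w ^ 2) * (c * g) / n ^ 3 := by rw [hR]; ring
      _ ≤ _ := by gcongr
  have hbig1 : Γ * ℓ ≤ n := by
    have h1 : Γ * ℓ ≤ Γ * ℓ ^ 2 := mul_le_mul_of_nonneg_left hℓ2 hΓ
    have h2 : 0 ≤ ((2 * (2 + B) + 1) / (2 * lam) + 1) * ℓ ^ 2 := by positivity
    linarith
  have hbig2 : (2 * (2 + B) + 1) / (2 * lam) * ℓ ≤ n := by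
    have h1 : (2 * (2 + B) + 1) / (2 * lam) * ℓ ≤ (2 * (2 + B) + 1) / (2 * lam) * ℓ ^ 2 :=
      mul_le_mul_of_nonneg_left hℓ2 (by positivity)
    have h2 : 0 ≤ (Γ + 1) * ℓ ^ 2 := by positivity
    linarith
  have hDle : D ≤ (K * Kz * (1 + (2 + B) ^ 2) + K₁) * ℓ ^ 2 * (c * g) / n := by
    have hγ1 : γ ≤ 1 := hγ.trans ((div_le_one hn0).2 hbig1)
    have h1 : Real.exp γ - 1 ≤ 2 * (Γ * ℓ / n) := by
      have := exp_le_one_add_add_sq hγ1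
      nlinarith
    have h2 : M - scaleFun lam w ≤ (3 - w) * (gaussInv lam 3 * g) :=
      scaleFun_sub_le_mul hl (by linarith)
    have h3 : 3 - w ≤ (5 + B) * ℓ := by
      have := neg_abs_le w
      linarith
    have h4 : D ≤ K₁ * ℓ ^ 2 * (c * g) / n := by
      calc D ≤ c * (2 * (Γ * ℓ / n)) * ((5 + B) * ℓ * (gaussInv lam 3 * g)) := by
            refine mul_le_mul (mul_le_mul_of_nonneg_left h1 hc) (h2.trans ?_) hMw (by positivity)
            exact mul_le_mul_of_nonneg_right h3 (mul_nonneg (gaussInv_pos _ _).le hg0.le)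
        _ = _ := by
            rw [hK₁]
            field_simp
    refine h4.trans ?_
    have : 0 ≤ K * Kz * (1 + (2 + B) ^ 2) := by positivity
    gcongr
    linarith
  have hfin := hdrift (-1) w (c * g) R D (by simp) (by rw [hw]; ring) (by positivity) hRle hDle
  have hanti : ∀ {u v : ℝ}, u ≤ v → max (M - scaleFun lam v) 0 ≤ max (M - scaleFun lam u) 0 :=
    fun h => max_le_max (sub_le_sub_left (scaleFun_mono lam h) M) le_rfl
  have hup : ∀ k : ℕ, c * max (M - scaleFun lam ((S + k) / n + 1)) 0 ≤
      c * (M - scaleFun lam w) + -1 * (c * g) / n * k +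
        -1 * w * (c * g) / (lam * n ^ 2) / 2 * (k : ℝ) ^ 2 + R * z ^ k := by
    intro k
    have h1 := hK w hw0 (k / n) (Or.inl (by positivity))
    have e : (S + k) / n + 1 = w + k / n := by rw [hw]; ring
    rw [e]
    refine (mul_le_mul_of_nonneg_left h1 hc).trans ?_
    rw [abs_of_nonneg (by positivity : 0 ≤ (k : ℝ) / n), ← hg]
    have h3 : (k : ℝ) ^ 3 ≤ Kz * z ^ k := by simpa using hKz k
    have h2 : c * (K * (1 + w ^ 2) * g / n ^ 3) * (k : ℝ) ^ 3 ≤ R * z ^ k := by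
      refine (mul_le_mul_of_nonneg_left h3 (by positivity)).trans_eq ?_
      rw [hR]
      ring
    refine le_trans (le_of_eq ?_) (add_le_add_right h2 _)
    field_simp
    ring
  have hmain := ev_step_le (lam := lam) ho hm (G := G) (T0 := c * (M - scaleFun lam w))
    (T1 := -1 * (c * g) / n) (T2 := -1 * w * (c * g) / (lam * n ^ 2)) hR0 hD0 hz1.le hs ?_ ?_ ?_
  · rw [ho, hm, hG1, ← hS, ← hw, max_eq_left hMw]
    linarith
  · have e : dev lam N (o + 1) m / n + 1 = w + -(1 / n) := by
      rw [hw, hS, dev, dev]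
      push_cast
      ring
    rw [hG1, e]
    have hn1' : 1 / n ≤ 1 := (div_le_one hn0).2 hn1
    have hinv : 0 < 1 / n := by positivity
    have h1 := hK w hw0 (-(1 / n)) (Or.inr ⟨by linarith, by linarith, fun r hr => by
      have h5 : -r ≤ 1 / n := by linarith [hr.1]
      have h6 : 2 * w * r ≤ 2 * ((2 + B) * ℓ) * (1 / n) := by
        calc 2 * w * r = 2 * (-w * -r) := by ring
          _ ≤ 2 * (|w| * (1 / n)) := by
            refine mul_le_mul_of_nonneg_left ?_ (by norm_num)
            exact mul_le_mul (neg_le_abs w) h5 (by linarith [hr.2]) (abs_nonneg w)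
          _ ≤ _ := by
            rw [← mul_assoc]
            exact mul_le_mul_of_nonneg_right (mul_le_mul_of_nonneg_left hw2 (by norm_num)) hinv.le
      have h7 : r ^ 2 ≤ ℓ * (1 / n) := by
        have : -r * -r ≤ 1 * (1 / n) := mul_le_mul (h5.trans hn1') h5 (by linarith [hr.2]) zero_le_one
        have : 1 * (1 / n) ≤ ℓ * (1 / n) := mul_le_mul_of_nonneg_right hℓ1 hinv.le
        nlinarith
      have h8 : (2 * (2 + B) + 1) * ℓ * (1 / n) ≤ 2 * lam := by
        rw [mul_one_div, div_le_iff₀ hn0]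
        calc (2 * (2 + B) + 1) * ℓ = 2 * lam * ((2 * (2 + B) + 1) / (2 * lam) * ℓ) := by field_simp
          _ ≤ _ := mul_le_mul_of_nonneg_left hbig2 (by positivity)
      linarith⟩)
    refine (mul_le_mul_of_nonneg_left h1 hc).trans ?_
    have h2 : c * (K * (1 + w ^ 2) * g / n ^ 3) ≤ R := by
      calc c * (K * (1 + w ^ 2) * g / n ^ 3) = c * (K * 1 * (1 + w ^ 2) * g / n ^ 3) := by ring
        _ ≤ R := by rw [hR]; gcongr
    refine le_trans (le_of_eq ?_) (add_le_add_right h2 _)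
    rw [← hg, abs_neg, abs_of_pos hinv]
    field_simp
    ring
  · intro k _
    have e : dev lam N (o + 1) (m + k + 1) = S + k := by
      rw [hS, dev, dev]
      push_cast
      ring
    rw [hG1, e]
    exact hup k
  · intro k _
    have e : dev lam N o (m + k) = S + k + lam := by
      rw [hS, dev, dev]
      push_cast
      ring
    have hle1 : (S + k) / n + 1 ≤ (S + k + lam) / n + 1 :=
      add_le_add_left (div_le_div_of_nonneg_right (by linarith) hn0.le) 1
    have hle2 : w ≤ (S + k) / n + 1 := add_le_add_left (div_le_div_of_nonneg_right
      (by linarith [(Nat.cast_nonneg k : (0 : ℝ) ≤ k)]) hn0.le) 1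
    rw [hG0 o rfl, e]
    have h1 : max (M - scaleFun lam ((S + k) / n + 1)) 0 ≤ M - scaleFun lam w :=
      (hanti hle2).trans_eq (max_eq_left hMw)
    have h3 : D ≤ D * z ^ k := le_mul_of_one_le_right hD0 (one_le_pow₀ hz1.le)
    calc c * Real.exp γ * max (M - scaleFun lam ((S + k + lam) / n + 1)) 0
        ≤ c * Real.exp γ * max (M - scaleFun lam ((S + k) / n + 1)) 0 :=
          mul_le_mul_of_nonneg_left (hanti hle1) (by positivity)
      _ = c * max (M - scaleFun lam ((S + k) / n + 1)) 0 +
          c * (Real.exp γ - 1) * max (M - scaleFun lam ((S + k) / n + 1)) 0 := by ring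
      _ ≤ _ + D := add_le_add (hup k) (mul_le_mul_of_nonneg_left h1 (by positivity))
      _ ≤ _ := by linarith

end superharmonic

/-! ### Comparison of the absorption probability with the superharmonic functions -/

section absorption

variable {lam : ℝ≥0}

lemma neg_excess_le_dev (N x y : ℕ) :
    -((1 + (lam : ℝ)) * x - lam * N) ≤ dev lam N x y := by
  rw [dev]
  linarith [(Nat.cast_nonneg y : (0 : ℝ) ≤ y)]

lemma excess_mono {x x' : ℕ} (h : x ≤ x') (N : ℕ) :
    (1 + (lam : ℝ)) * x - lam * N ≤ (1 + (lam : ℝ)) * x' - lam * N := by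
  have : (x : ℝ) ≤ x' := by exact_mod_cast h
  gcongr

/-- The chain stops after a geometric time. -/
lemma ev_step_two_sub_pow_le {N : ℕ} {η : Config N} (hη : act η ≠ 0) {r : ℝ}
    (hr : r = (lam : ℝ) / (1 + lam) / 2) :
    ev (step lam η) (fun ζ => 2 - r ^ act ζ) ≤ (1 - r ^ N / 2) * (2 - r ^ act η) := by
  have hr0 : 0 ≤ r := by rw [hr]; positivity
  have hp : (lam : ℝ) / (1 + lam) ≤ 1 := by
    rw [div_le_one (by positivity)]
    linarith
  have hr1 : r ≤ 1 := by rw [hr]; linarith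
  obtain ⟨m, hm⟩ : ∃ m, act η = m + 1 := ⟨act η - 1, by omega⟩
  have h1 := ev_step_le_of_forall (lam := lam) hη (f := fun ζ => 2 - r ^ act ζ)
    (a := 2 - r ^ m) (b := 2)
    (fun x hx => by
      have h2 := act_update_of_active (η := η) (x := x) (a := Site.asleep) hx (by simp)
      have h3 : act (Function.update η x Site.asleep) = m := by omega
      simp only [h3]
      exact le_rfl)
    (fun x _ => ev_le_of_forall_le _ fun ζ => by linarith [pow_nonneg hr0 (act ζ)])
  refine h1.trans ?_
  have h2 : r ^ N ≤ r ^ act η := pow_le_pow_of_le_one hr0 hr1 ((act_le_occ η).trans (occ_le η))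
  -- The choice of `r` as half the sleep probability makes the sleeping branch alone double `r ^
  -- act`, which gives the contraction.
  have h3 : (lam : ℝ) / (1 + lam) * r ^ m = 2 * r ^ act η := by
    rw [hm, pow_succ, hr]
    ring
  have h4 : (lam : ℝ) / (1 + lam) * 2 + 1 / (1 + lam) * 2 = 2 := by
    field_simp
    ring
  have h5 : 0 ≤ r ^ N * r ^ act η := by positivity
  linarith

/-- Optional stopping with a function that is `1` when `S` reaches `√N` and nonnegative at
absorption: up to chains still running at time `n`, it dominates the probability of not being
absorbed. -/
lemma exists_le_absorbProb (hlam : 0 < lam) {B : ℝ} (hB : 0 ≤ B) :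
    ∃ N₀ : ℕ, 1 ≤ N₀ ∧ ∀ N : ℕ, N₀ ≤ N → ∃ ρ : ℝ, 0 ≤ ρ ∧ ρ < 1 ∧
      ∀ (x₀ : ℕ) (β : ℝ), 0 ≤ β → β ≤ B * logScale N →
      (1 + (lam : ℝ)) * x₀ - lam * N ≤ β * √(N : ℝ) → ∀ (n : ℕ) (η : Config N), occ η ≤ x₀ →
        min (scaleFun lam (dev lam N (occ η) (act η) / √(N : ℝ) - 1)) 0 /
          scaleFun lam (-β - 1) - 2 * ρ ^ n ≤ absorbProb lam n η := by
  have hl : (0 : ℝ) < lam := by exact_mod_cast hlam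
  obtain ⟨N₀, hN₀1, hN₀⟩ := exists_ev_step_min_le hlam hB
  refine ⟨N₀, hN₀1, fun N hN => ?_⟩
  have hNpos : 0 < N := by omega
  have hn0 : 0 < √(N : ℝ) := Real.sqrt_pos.2 (by exact_mod_cast hNpos)
  set r : ℝ := (lam : ℝ) / (1 + lam) / 2 with hr
  have hr0 : 0 < r := by positivity
  have hp : (lam : ℝ) / (1 + lam) ≤ 1 := by
    rw [div_le_one (by positivity)]
    linarith
  have hr1 : r ≤ 1 := by linarith
  have hrN : r ^ N ≤ 1 := pow_le_one₀ hr0.le hr1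
  have hrN0 : 0 < r ^ N := by positivity
  refine ⟨1 - r ^ N / 2, by linarith, by linarith, fun x₀ β hβ0 hβ hx₀ => ?_⟩
  set ρ : ℝ := 1 - r ^ N / 2 with hρ
  have hρ0 : 0 ≤ ρ := by linarith
  set H : ℝ := -scaleFun lam (-β - 1) with hH
  have hH0 : 0 < H := by
    have := le_scaleFun_sub (l := lam) (M := 1) (show -β - 1 ≤ 0 by linarith)
      fun x _ => one_le_gaussInv hl x
    rw [scaleFun_zero] at this
    linarith
  set J : ℕ → ℕ → ℝ := fun x y => min (scaleFun lam (dev lam N x y / √(N : ℝ) - 1)) 0 with hJ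
  -- The normalisation makes `G` nonnegative at the lowest deviation `-β √N` possible with at most
  -- `x₀` particles. Above `x₀` the value `1` makes the claim trivial, so the induction can run over
  -- all configurations.
  set G : ℕ → ℕ → ℝ := fun x y => if x ≤ x₀ then 1 + 1 / H * J x y else 1 with hG
  have hJ0 : ∀ x ≤ x₀, ∀ y, -H ≤ J x y := by
    intro x hx y
    refine le_min ?_ (by linarith)
    rw [hH, neg_neg]
    refine scaleFun_mono _ (sub_le_sub_right ?_ 1)
    rw [le_div_iff₀ hn0]
    have := neg_excess_le_dev (lam := lam) N x y
    have := excess_mono (lam := lam) hx N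
    linarith
  have hG0 : ∀ x y, 0 ≤ G x y := by
    intro x y
    simp only [hG]
    split_ifs with h
    · have := mul_le_mul_of_nonneg_left (hJ0 x h y) (by positivity : 0 ≤ 1 / H)
      have e : 1 / H * -H = -1 := by field_simp
      linarith
    · exact zero_le_one
  have hpow : ∀ k : ℕ, 1 ≤ 2 - r ^ k := fun k => by linarith [pow_le_one₀ hr0.le hr1 (n := k)]
  have main : ∀ (n : ℕ) (η : Config N),
      1 - absorbProb lam n η ≤ G (occ η) (act η) + ρ ^ n * (2 - r ^ act η) := by
    intro n
    induction n with
    | zero =>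
      intro η
      have h1 := absorbProb_nonneg lam 0 η
      have h2 := hG0 (occ η) (act η)
      have h3 := hpow (act η)
      rw [pow_zero]
      linarith
    | succ n ih =>
      intro η
      have hrem : 0 ≤ ρ ^ (n + 1) * (2 - r ^ act η) :=
        mul_nonneg (by positivity) (by linarith [hpow (act η)])
      rcases lt_or_ge x₀ (occ η) with hx | hx
      · have : G (occ η) (act η) = 1 := if_neg (by omega)
        linarith [absorbProb_nonneg lam (n + 1) η]
      rw [absorbProb]
      split_ifs with h1 h2
      · have : G (occ η) (act η) = 1 := by
          simp only [hG, if_pos hx, hJ]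
          have h3 : 1 ≤ dev lam N (occ η) (act η) / √(N : ℝ) := (one_le_div hn0).2 h1
          rw [min_eq_right, mul_zero, add_zero]
          exact (scaleFun_zero lam).symm.trans_le (scaleFun_mono _ (by linarith))
        linarith
      · linarith [hG0 (occ η) (act η)]
      · have hmod : IsModerate lam B N (occ η) (act η) := by
          refine ⟨not_le.1 h1, ?_⟩
          have := excess_mono (lam := lam) hx N
          have := mul_le_mul_of_nonneg_right hβ hn0.le
          linarith
        have h3 := hN₀ N hN η h2 hmod G 1 (1 / H) (by positivity) fun x hx' y => by
          simp only [hG, if_pos (hx'.trans hx), hJ]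
        have h4 := ev_step_two_sub_pow_le (lam := lam) h2 hr
        have h5 : 1 - ev (step lam η) (absorbProb lam n) =
            ev (step lam η) (fun ζ => 1 - absorbProb lam n ζ) := by
          rw [ev_sub, ev_const]
        rw [h5]
        refine (ev_mono _ ih).trans ?_
        rw [ev_add, ev_mul_left, pow_succ, mul_assoc]
        exact add_le_add h3 (mul_le_mul_of_nonneg_left h4 (by positivity))
  intro n η hx
  have h1 := main n η
  simp only [hG, if_pos hx] at h1
  have h2 : J (occ η) (act η) / scaleFun lam (-β - 1) = -(1 / H * J (occ η) (act η)) := by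
    have : scaleFun lam (-β - 1) = -H := by rw [hH, neg_neg]
    rw [this]
    field_simp
  have h3 : ρ ^ n * (2 - r ^ act η) ≤ ρ ^ n * 2 :=
    mul_le_mul_of_nonneg_left (by linarith [pow_nonneg hr0.le (act η)]) (by positivity)
  change J (occ η) (act η) / _ - _ ≤ _
  rw [h2]
  linarith

/-- One way to be absorbed is that the active particles fall asleep one after another; this only
lowers the deviation. It serves the finitely many small `N`. -/
lemma pow_act_le_absorbProb {N : ℕ} (n : ℕ) : ∀ η : Config N, act η ≤ n →
    dev lam N (occ η) (act η) < √(N : ℝ) →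
    ((lam : ℝ) / (1 + lam)) ^ act η ≤ absorbProb lam n η := by
  induction n with
  | zero =>
    intro η hη hS
    have h0 : act η = 0 := by omega
    rw [absorbProb, if_neg (not_le.2 hS), if_pos h0, h0, pow_zero]
  | succ n ih =>
    intro η hη hS
    rw [absorbProb, if_neg (not_le.2 hS)]
    split_ifs with h0
    · rw [h0, pow_zero]
    obtain ⟨m, hm⟩ : ∃ m, act η = m + 1 := ⟨act η - 1, by omega⟩
    have h1 := ev_step_le_of_forall (lam := lam) h0 (f := fun ζ => -absorbProb lam n ζ)
      (a := -((lam : ℝ) / (1 + lam)) ^ m) (b := 0)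
      (fun x hx => by
        have h2 := act_update_of_active (η := η) (x := x) (a := Site.asleep) hx (by simp)
        have h3 : act (Function.update η x Site.asleep) = m := by omega
        have h4 := occ_update_of_ne_empty (η := η) (x := x) (a := Site.asleep) (by simp [hx])
          (by simp)
        have h5 := ih (Function.update η x Site.asleep) (by omega) (by
          rw [h3, h4]
          refine lt_of_le_of_lt ?_ hS
          rw [dev, dev, hm]
          push_cast
          linarith)
        rw [h3] at h5
        exact neg_le_neg h5)
      (fun x _ => ev_le_of_forall_le _ fun ζ => neg_nonpos.2 (absorbProb_nonneg lam n ζ))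
    have h6 : ev (step lam η) (fun ζ => -absorbProb lam n ζ) =
        -ev (step lam η) (absorbProb lam n) := by
      have := ev_mul_left (step lam η) (-1) (absorbProb lam n)
      simpa using this
    rw [h6] at h1
    rw [hm, pow_succ]
    linarith

/-- Optional stopping with a function that is at least `1` at every absorbing state with at most
`x₀` particles, however many particles have been lost. -/
lemma exists_absorbProb_le (hlam : 0 < lam) {B : ℝ} (hB : 0 ≤ B) :
    ∃ N₀ : ℕ, 1 ≤ N₀ ∧ ∀ N : ℕ, N₀ ≤ N → ∀ (x₀ : ℕ) (β : ℝ), 0 ≤ β → β ≤ B * logScale N →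
      (1 + (lam : ℝ)) * x₀ - lam * N = β * √(N : ℝ) →
      ∀ (n : ℕ) (η : Config N), occ η = x₀ → absorbProb lam n η ≤
        max (scaleFun lam 3 - scaleFun lam (dev lam N (occ η) (act η) / √(N : ℝ) + 1)) 0 /
          Real.exp (max (β - 2) 0 ^ 2 / (2 * lam)) := by
  obtain ⟨N₀, hN₀1, hN₀⟩ := exists_ev_step_max_le hlam hB (Γ := (1 + lam) * B / lam)
    (by positivity)
  refine ⟨N₀, hN₀1, fun N hN x₀ β hβ0 hβ hx₀ => ?_⟩
  have hNpos : 0 < N := by omega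
  have hn0 : 0 < √(N : ℝ) := Real.sqrt_pos.2 (by exact_mod_cast hNpos)
  set Q : ℝ := Real.exp (max (β - 2) 0 ^ 2 / (2 * lam)) with hQ
  have hQ0 : 0 < Q := Real.exp_pos _
  -- One lost particle lowers the excess by `(1 + λ) / √N` in units of `√N`, and `β / λ` is the
  -- slope of `β² / (2λ)`.
  set γ : ℝ := (1 + lam) * β / lam / √(N : ℝ) with hγ
  have hγ0 : 0 ≤ γ := by positivity
  set J : ℕ → ℕ → ℝ := fun x y =>
    max (scaleFun lam 3 - scaleFun lam (dev lam N x y / √(N : ℝ) + 1)) 0 with hJ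
  set G : ℕ → ℕ → ℝ := fun x y =>
    if x ≤ x₀ then Real.exp (γ * ((x₀ : ℝ) - x)) / Q * J x y else 1 with hG
  have hJ0 : ∀ x y, 0 ≤ J x y := fun x y => le_max_right _ _
  have hG0 : ∀ x y, 0 ≤ G x y := by
    intro x y
    simp only [hG]
    split_ifs with h
    · exact mul_nonneg (by positivity) (hJ0 x y)
    · exact zero_le_one
  have main : ∀ (n : ℕ) (η : Config N), absorbProb lam n η ≤ G (occ η) (act η) := by
    have habs : ∀ η : Config N, occ η ≤ x₀ → act η = 0 →
        dev lam N (occ η) (act η) < √(N : ℝ) → 1 ≤ G (occ η) (act η) := by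
      intro η hx h0 hS
      set x := occ η
      set b : ℝ := ((1 + (lam : ℝ)) * x - lam * N) / √(N : ℝ) with hb
      have hS' : dev lam N x (act η) / √(N : ℝ) = -b := by
        rw [hb, dev, h0]
        push_cast
        ring
      have hb1 : -b < 1 := by
        rw [← hS', div_lt_one hn0]
        exact hS
      have hd : γ * ((x₀ : ℝ) - x) = β * (β - b) / lam := by
        have e : (1 + (lam : ℝ)) * ((x₀ : ℝ) - x) = (β - b) * √(N : ℝ) := by
          rw [sub_mul, ← hx₀, hb, div_mul_cancel₀ _ hn0.ne']
          ring
        calc γ * ((x₀ : ℝ) - x) = β / lam / √(N : ℝ) * ((1 + (lam : ℝ)) * ((x₀ : ℝ) - x)) := by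
              rw [hγ]; ring
          _ = _ := by rw [e]; field_simp
      have hbβ : b ≤ β := by
        rw [hb, div_le_iff₀ hn0, ← hx₀]
        exact excess_mono hx N
      -- The interval `[1 - b, 2 - b]` has length `1` and lies below `3` because `b > -1`; on it the
      -- weight is at least this exponential.
      have hJlow : Real.exp (max (b - 2) 0 ^ 2 / (2 * lam)) ≤ J x (act η) := by
        refine le_max_of_le_left ?_
        rw [hS']
        have h1 : scaleFun lam (2 - b) ≤ scaleFun lam 3 := scaleFun_mono _ (by linarith)
        have h2 := le_scaleFun_sub (l := lam) (M := Real.exp (max (b - 2) 0 ^ 2 / (2 * lam)))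
          (show -b + 1 ≤ 2 - b by linarith) fun y hy => by
            refine Real.exp_le_exp.2 (div_le_div_of_nonneg_right ?_ (by positivity))
            rcases le_total (b - 2) 0 with h | h
            · rw [max_eq_right h, zero_pow two_ne_zero]
              exact sq_nonneg y
            · rw [max_eq_left h]
              nlinarith [hy.2]
        linarith
      simp only [hG, if_pos hx]
      rw [div_mul_eq_mul_div, one_le_div hQ0]
      refine le_trans ?_ (mul_le_mul_of_nonneg_left hJlow (Real.exp_pos _).le)
      rw [← Real.exp_add, hQ, hd]
      refine Real.exp_le_exp.2 ?_
      have e : β * (β - b) / lam + max (b - 2) 0 ^ 2 / (2 * lam) =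
          (2 * β * (β - b) + max (b - 2) 0 ^ 2) / (2 * lam) := by
        field_simp
      rw [e]
      refine div_le_div_of_nonneg_right ?_ (by positivity)
      -- Convexity of the squared positive part: its tangent at `β` has slope at most `2 β`, so the
      -- weight compensates for the drop from `β` to `b`.
      rcases le_total (β - 2) 0 with h | h
      · rw [max_eq_right h]
        nlinarith [sq_nonneg (max (b - 2) 0)]
      · rw [max_eq_left h]
        rcases le_total (b - 2) 0 with h' | h'
        · rw [max_eq_right h']
          nlinarith
        · rw [max_eq_left h']
          nlinarith
    intro n
    induction n with
    | zero =>
      intro η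
      rcases lt_or_ge x₀ (occ η) with hx | hx
      · have : G (occ η) (act η) = 1 := if_neg (by omega)
        linarith [absorbProb_le_one lam 0 η]
      rw [absorbProb]
      split_ifs with h1 h2
      · exact hG0 _ _
      · exact habs η hx h2 (not_le.1 h1)
      · exact hG0 _ _
    | succ n ih =>
      intro η
      rcases lt_or_ge x₀ (occ η) with hx | hx
      · have : G (occ η) (act η) = 1 := if_neg (by omega)
        linarith [absorbProb_le_one lam (n + 1) η]
      rw [absorbProb]
      split_ifs with h1 h2
      · exact hG0 _ _
      · exact habs η hx h2 (not_le.1 h1)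
      · have hmod : IsModerate lam B N (occ η) (act η) := by
          refine ⟨not_le.1 h1, ?_⟩
          have := excess_mono (lam := lam) hx N
          have := mul_le_mul_of_nonneg_right hβ hn0.le
          linarith
        refine (ev_mono _ ih).trans (hN₀ N hN η h2 hmod G (Real.exp (γ * ((x₀ : ℝ) - occ η)) / Q) γ
          (by positivity) hγ0 ?_ (fun y => ?_) (fun x hx' y => ?_))
        · calc γ = (1 + lam) / lam / √(N : ℝ) * β := by rw [hγ]; ring
            _ ≤ (1 + lam) / lam / √(N : ℝ) * (B * logScale N) :=
              mul_le_mul_of_nonneg_left hβ (by positivity)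
            _ = _ := by ring
        · simp only [hG, if_pos hx, hJ]
        · have e : γ * ((x₀ : ℝ) - x) = γ * ((x₀ : ℝ) - occ η) + γ := by
            rw [← hx']
            push_cast
            ring
          simp only [hG, if_pos (show x ≤ x₀ by omega), hJ]
          rw [e, Real.exp_add]
          ring
  intro n η hx
  have h1 := main n η
  simp only [hG, hx, sub_self, mul_zero, Real.exp_zero, le_refl, if_true] at h1
  rw [hx]
  rwa [one_div_mul_eq_div] at h1

end absorption

/-- All losses of the form `exp (O(√(log N)))` are smaller than any power of `N`, by completing a
square in `√(log N)`. -/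
lemma exists_exp_mul_logScale_le (C : ℝ) {δ : ℝ} (hδ : 0 < δ) :
    ∃ K : ℝ, 0 < K ∧ ∀ N : ℕ, 1 ≤ N → Real.exp (C * logScale N) ≤ K * (N : ℝ) ^ δ := by
  refine ⟨Real.exp (C + C ^ 2 / (4 * δ)), Real.exp_pos _, fun N hN => ?_⟩
  have hN' : (1 : ℝ) ≤ N := by exact_mod_cast hN
  rw [Real.rpow_def_of_pos (by linarith), ← Real.exp_add]
  refine Real.exp_le_exp.2 ?_
  have hs := Real.sq_sqrt (Real.log_nonneg hN')
  rw [logScale]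
  set s := √(Real.log N)
  rw [← hs]
  have h : 0 ≤ (2 * δ * s - C) ^ 2 / (4 * δ) := by positivity
  have e : (2 * δ * s - C) ^ 2 / (4 * δ) = s ^ 2 * δ - C * s + C ^ 2 / (4 * δ) := by
    field_simp
    ring
  linarith

/-- For `y ≤ β` one has `β² - (y - β)² = y (2 β - y) ≥ y² ≥ k²`: having at least `k` active
particles, in units of `√N`, gains a factor `exp (-k² / (2λ))` even if the deviation is far below
zero. The remaining terms are linear in `β`. -/
lemma sq_add_one_le {β y k : ℝ} (hk0 : 0 ≤ k) (hkβ : k ≤ β) (hky : k ≤ y) (hu : y - β ≤ 1) :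
    (y - β + 1) ^ 2 ≤ 4 * β + 4 + max (β - 2) 0 ^ 2 - k ^ 2 := by
  have h2 : β ^ 2 - 4 * β ≤ max (β - 2) 0 ^ 2 := by
    rcases le_total (β - 2) 0 with h | h
    · rw [max_eq_right h]
      nlinarith
    · rw [max_eq_left h]
      nlinarith
  have h3 : k ^ 2 ≤ y ^ 2 := pow_le_pow_left₀ hk0 hky 2
  have h4 : k ^ 2 ≤ β ^ 2 := pow_le_pow_left₀ hk0 hkβ 2
  rcases le_total y β with h | h
  · have h5 := mul_nonneg (hk0.trans hky) (sub_nonneg.2 h)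
    linarith
  · have h5 : (y - β + 1) ^ 2 ≤ 2 ^ 2 := pow_le_pow_left₀ (by linarith) (by linarith) 2
    linarith

/-! ### Power bounds in `N` -/

section bounds

variable {lam : ℝ≥0}

/-- The start lies at least `1/2` below the upper barrier in scaled units, while the scale distance
to absorption is at most about `exp (β² / (2λ)) = N ^ (κ² / 2)` for `β = κ √(λ log N)`. -/
lemma exists_rpow_le_absorbProb (hlam : 0 < lam) {κ δ : ℝ} (hκ0 : 0 ≤ κ) (hκ1 : κ ≤ 1)
    (hδ : 0 < δ) :
    ∃ (c : ℝ) (N₀ : ℕ), 0 < c ∧ 1 ≤ N₀ ∧ ∀ N : ℕ, N₀ ≤ N → ∃ ρ : ℝ, 0 ≤ ρ ∧ ρ < 1 ∧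
      ∀ (n : ℕ) (η : Config N),
        (1 + (lam : ℝ)) * occ η - lam * N ≤ κ * √(lam : ℝ) * √(Real.log N) * √(N : ℝ) →
        dev lam N (occ η) (act η) ≤ 4 * lam + 2 →
        c * (N : ℝ) ^ (-(κ ^ 2 / 2 + δ)) - 2 * ρ ^ n ≤ absorbProb lam n η := by
  have hl : (0 : ℝ) < lam := by exact_mod_cast hlam
  set q := √(lam : ℝ) with hq
  have hq0 : 0 < q := Real.sqrt_pos.2 hl
  have hqq : q ^ 2 = lam := Real.sq_sqrt hl.le
  obtain ⟨N₁, hN₁1, hN₁⟩ := exists_le_absorbProb hlam hq0.le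
  obtain ⟨N₂, hN₂1, hN₂⟩ := exists_mul_logScale_sq_le (2 * (4 * lam + 2))
  obtain ⟨K, hK0, hK⟩ := exists_exp_mul_logScale_le (1 + κ / q) hδ
  set A : ℝ := (1 + q) * (Real.exp (1 / (2 * lam)) * K) with hA
  have hA0 : 0 < A := by positivity
  refine ⟨1 / 2 / A, max N₁ N₂, by positivity, hN₁1.trans (le_max_left _ _), fun N hN => ?_⟩
  obtain ⟨ρ, hρ0, hρ1, hρ⟩ := hN₁ N ((le_max_left _ _).trans hN)
  refine ⟨ρ, hρ0, hρ1, fun n η hx hS => ?_⟩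
  have hNpos : 1 ≤ N := hN₁1.trans ((le_max_left _ _).trans hN)
  have hN' : (1 : ℝ) ≤ N := by exact_mod_cast hNpos
  have hn0 : 0 < √(N : ℝ) := Real.sqrt_pos.2 (by linarith)
  have hbig := hN₂ N ((le_max_right _ _).trans hN)
  have hℓ1 := one_le_logScale N
  set s := √(Real.log N) with hs
  have hss : s ^ 2 = Real.log N := Real.sq_sqrt (Real.log_nonneg hN')
  have hℓ : logScale N = 1 + s := rfl
  set β : ℝ := κ * q * s with hβ
  have hβ0 : 0 ≤ β := by positivity
  have hβq : β ≤ q * logScale N := by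
    rw [hℓ, hβ]
    have : κ * (q * s) ≤ 1 * (q * s) := mul_le_mul_of_nonneg_right hκ1 (by positivity)
    linarith
  have h1 := hρ (occ η) β hβ0 hβq hx n η le_rfl
  refine le_trans (sub_le_sub_right ?_ _) h1
  have hu : dev lam N (occ η) (act η) / √(N : ℝ) ≤ 1 / 2 := by
    rw [div_le_iff₀ hn0]
    have : 2 * (4 * (lam : ℝ) + 2) * 1 ≤ 2 * (4 * lam + 2) * logScale N ^ 2 :=
      mul_le_mul_of_nonneg_left (one_le_pow₀ hℓ1) (by positivity)
    linarith
  have hnum : min (scaleFun lam (dev lam N (occ η) (act η) / √(N : ℝ) - 1)) 0 ≤ -(1 / 2) := by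
    refine (min_le_left _ _).trans ?_
    have h2 := le_scaleFun_sub (l := lam) (M := 1)
      (show dev lam N (occ η) (act η) / √(N : ℝ) - 1 ≤ 0 by linarith)
      fun x _ => one_le_gaussInv hl x
    rw [scaleFun_zero] at h2
    linarith
  have hH0 : 0 < -scaleFun lam (-β - 1) := by
    have := le_scaleFun_sub (l := lam) (M := 1) (show -β - 1 ≤ 0 by linarith)
      fun x _ => one_le_gaussInv hl x
    rw [scaleFun_zero] at this
    linarith
  have hH : -scaleFun lam (-β - 1) ≤ A * (N : ℝ) ^ (κ ^ 2 / 2 + δ) := by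
    have h2 := scaleFun_sub_le (l := lam) (M := gaussInv lam (-β - 1))
      (show -β - 1 ≤ 0 by linarith) fun x hx => gaussInv_le_of_abs_le hl (by
        rw [abs_of_nonpos hx.2, abs_of_nonpos (hx.1.trans hx.2)]
        linarith [hx.1])
    rw [scaleFun_zero] at h2
    have h3 : β + 1 ≤ (1 + q) * Real.exp (logScale N) := by
      have h4 : logScale N ≤ Real.exp (logScale N) := by
        linarith [Real.add_one_le_exp (logScale N)]
      have h5 : β + 1 ≤ (1 + q) * logScale N := by linarith
      exact h5.trans (mul_le_mul_of_nonneg_left h4 (by positivity))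
    have h6 : gaussInv lam (-β - 1) ≤
        Real.exp (1 / (2 * lam)) * Real.exp (κ / q * logScale N) * (N : ℝ) ^ (κ ^ 2 / 2) := by
      rw [gaussInv, Real.rpow_def_of_pos (by linarith), ← Real.exp_add, ← Real.exp_add]
      refine Real.exp_le_exp.2 ?_
      have e : (-β - 1) ^ 2 / (2 * lam) = 1 / (2 * lam) + κ / q * s + Real.log N * (κ ^ 2 / 2) := by
        rw [hβ, ← hqq, ← hss]
        field_simp
        ring
      rw [e, hℓ]
      have : 0 ≤ κ / q := by positivity
      linarith
    calc -scaleFun lam (-β - 1) ≤ (β + 1) * gaussInv lam (-β - 1) := by linarith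
      _ ≤ ((1 + q) * Real.exp (logScale N)) *
          (Real.exp (1 / (2 * lam)) * Real.exp (κ / q * logScale N) * (N : ℝ) ^ (κ ^ 2 / 2)) :=
        mul_le_mul h3 h6 (gaussInv_pos _ _).le (by positivity)
      _ = (1 + q) * Real.exp (1 / (2 * lam)) * Real.exp ((1 + κ / q) * logScale N) *
          (N : ℝ) ^ (κ ^ 2 / 2) := by
        rw [show Real.exp ((1 + κ / q) * logScale N) = _ from by rw [add_mul, one_mul, Real.exp_add]]
        ring
      _ ≤ (1 + q) * Real.exp (1 / (2 * lam)) * (K * (N : ℝ) ^ δ) * (N : ℝ) ^ (κ ^ 2 / 2) := by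
        gcongr
        exact hK N hNpos
      _ = A * (N : ℝ) ^ (κ ^ 2 / 2 + δ) := by
        rw [Real.rpow_add (by linarith), hA]
        ring
  have e : min (scaleFun lam (dev lam N (occ η) (act η) / √(N : ℝ) - 1)) 0 /
      scaleFun lam (-β - 1) = -min (scaleFun lam (dev lam N (occ η) (act η) / √(N : ℝ) - 1)) 0 /
        -scaleFun lam (-β - 1) := (neg_div_neg_eq _ _).symm
  rw [e, le_div_iff₀ hH0, Real.rpow_neg (by linarith)]
  calc 1 / 2 / A * ((N : ℝ) ^ (κ ^ 2 / 2 + δ))⁻¹ * -scaleFun lam (-β - 1)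
      ≤ 1 / 2 / A * ((N : ℝ) ^ (κ ^ 2 / 2 + δ))⁻¹ * (A * (N : ℝ) ^ (κ ^ 2 / 2 + δ)) :=
        mul_le_mul_of_nonneg_left hH (by positivity)
    _ = 1 / 2 := by field_simp
    _ ≤ _ := by linarith

/-- `sq_add_one_le` with `k = (1 + ε) √(λ log N)` gives `N ^ (-(1 + ε)² / 2)`; a factor `N ^ (ε /
2)` covers the subpolynomial losses, and `(1 + ε)² / 2 - ε / 2 ≥ 1/2 + ε / 2`. -/
lemma exists_absorbProb_le_rpow (hlam : 0 < lam) {ε B : ℝ} (hε : 0 < ε) (hB : 0 ≤ B) :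
    ∃ (C : ℝ) (N₀ : ℕ), 0 < C ∧ 1 ≤ N₀ ∧ ∀ N : ℕ, N₀ ≤ N → ∀ (n : ℕ) (η : Config N),
      √(lam : ℝ) * (1 + ε) * √(Real.log N) * √(N : ℝ) ≤ (1 + (lam : ℝ)) * occ η - lam * N →
      (1 + (lam : ℝ)) * occ η - lam * N ≤ B * √(Real.log N) * √(N : ℝ) →
      dev lam N (occ η) (act η) ≤ 4 * lam + 2 →
      √(lam : ℝ) * (1 + ε) * √(Real.log N) * √(N : ℝ) ≤ act η →
      absorbProb lam n η ≤ C * (N : ℝ) ^ (-(1 / 2 : ℝ) - ε / 2) := by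
  have hl : (0 : ℝ) < lam := by exact_mod_cast hlam
  set q := √(lam : ℝ) with hq
  have hq0 : 0 < q := Real.sqrt_pos.2 hl
  have hqq : q ^ 2 = lam := Real.sq_sqrt hl.le
  obtain ⟨N₁, hN₁1, hN₁⟩ := exists_absorbProb_le hlam hB
  obtain ⟨N₂, hN₂1, hN₂⟩ := exists_mul_logScale_sq_le (4 * lam + 2)
  obtain ⟨K, hK0, hK⟩ := exists_exp_mul_logScale_le (1 + 2 * B / lam) (half_pos hε)
  have hg3 := gaussInv_pos (lam : ℝ) 3
  refine ⟨(2 + B) * gaussInv lam 3 * Real.exp (2 / lam) * K, max N₁ N₂, by positivity,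
    hN₁1.trans (le_max_left _ _), fun N hN n η hxl hxu hS hy => ?_⟩
  have hNpos : 1 ≤ N := hN₁1.trans ((le_max_left _ _).trans hN)
  have hN' : (1 : ℝ) ≤ N := by exact_mod_cast hNpos
  have hn0 : 0 < √(N : ℝ) := Real.sqrt_pos.2 (by linarith)
  have hbig := hN₂ N ((le_max_right _ _).trans hN)
  have hℓ1 := one_le_logScale N
  set s := √(Real.log N) with hs
  have hss : s ^ 2 = Real.log N := Real.sq_sqrt (Real.log_nonneg hN')
  have hℓ : logScale N = 1 + s := rfl
  set b := (1 + (lam : ℝ)) * occ η - lam * N with hb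
  set β : ℝ := b / √(N : ℝ) with hβ
  set y : ℝ := act η / √(N : ℝ) with hydef
  set k : ℝ := q * (1 + ε) * s with hk
  have hk0 : 0 ≤ k := by positivity
  have hkβ : k ≤ β := (le_div_iff₀ hn0).2 hxl
  have hky : k ≤ y := (le_div_iff₀ hn0).2 hy
  have hβB : β ≤ B * s := (div_le_iff₀ hn0).2 hxu
  have hβℓ : β ≤ B * logScale N := by
    rw [hℓ]
    linarith
  have h1 := hN₁ N ((le_max_left _ _).trans hN) (occ η) β (hk0.trans hkβ) hβℓ
    (div_mul_cancel₀ _ hn0.ne').symm n η rfl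
  refine h1.trans ?_
  have hu : dev lam N (occ η) (act η) / √(N : ℝ) = y - β := by
    rw [dev, ← hb, sub_div]
  have hu1 : y - β ≤ 1 := by
    rw [← hu, div_le_one hn0]
    have : (4 * (lam : ℝ) + 2) * 1 ≤ (4 * lam + 2) * logScale N ^ 2 :=
      mul_le_mul_of_nonneg_left (one_le_pow₀ hℓ1) (by positivity)
    linarith
  rw [hu, max_eq_left (sub_nonneg.2 (scaleFun_mono _ (by linarith))), div_le_iff₀ (Real.exp_pos _)]
  refine (scaleFun_sub_le_mul hl (by linarith)).trans ?_
  have hfac : 3 - (y - β + 1) ≤ (2 + B) * Real.exp (logScale N) := by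
    have h4 : logScale N ≤ Real.exp (logScale N) := by
      linarith [Real.add_one_le_exp (logScale N)]
    have h5 : 3 - (y - β + 1) ≤ (2 + B) * logScale N := by linarith
    exact h5.trans (mul_le_mul_of_nonneg_left h4 (by positivity))
  have hsq := sq_add_one_le hk0 hkβ hky hu1
  have hexp : gaussInv lam (y - β + 1) ≤ Real.exp (2 / lam) * Real.exp (2 * B / lam * logScale N) *
      (N : ℝ) ^ (-((1 + ε) ^ 2 / 2)) * Real.exp (max (β - 2) 0 ^ 2 / (2 * lam)) := by
    rw [gaussInv, Real.rpow_def_of_pos (by linarith), ← Real.exp_add, ← Real.exp_add,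
      ← Real.exp_add]
    refine Real.exp_le_exp.2 ?_
    have h2 : (y - β + 1) ^ 2 / (2 * lam) ≤
        (4 * (B * logScale N) + 4 + max (β - 2) 0 ^ 2 - k ^ 2) / (2 * lam) :=
      div_le_div_of_nonneg_right (by linarith) (by positivity)
    refine h2.trans_eq ?_
    rw [hk, ← hqq, ← hss]
    field_simp
    ring
  have hpow : (N : ℝ) ^ (ε / 2) * (N : ℝ) ^ (-((1 + ε) ^ 2 / 2)) ≤
      (N : ℝ) ^ (-(1 / 2 : ℝ) - ε / 2) := by
    rw [← Real.rpow_add (by linarith)]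
    exact Real.rpow_le_rpow_of_exponent_le hN' (by nlinarith)
  set Z := Real.exp (max (β - 2) 0 ^ 2 / (2 * lam)) with hZ
  calc (3 - (y - β + 1)) * (gaussInv lam 3 * gaussInv lam (y - β + 1))
      ≤ ((2 + B) * Real.exp (logScale N)) * (gaussInv lam 3 * (Real.exp (2 / lam) *
        Real.exp (2 * B / lam * logScale N) * (N : ℝ) ^ (-((1 + ε) ^ 2 / 2)) * Z)) :=
        mul_le_mul hfac (mul_le_mul_of_nonneg_left hexp hg3.le)
          (mul_nonneg hg3.le (gaussInv_pos _ _).le) (by positivity)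
    _ = (2 + B) * gaussInv lam 3 * Real.exp (2 / lam) *
        Real.exp ((1 + 2 * B / lam) * logScale N) * (N : ℝ) ^ (-((1 + ε) ^ 2 / 2)) * Z := by
        rw [show Real.exp ((1 + 2 * B / lam) * logScale N) = _ from by rw [add_mul, one_mul, Real.exp_add]]
        ring
    _ ≤ (2 + B) * gaussInv lam 3 * Real.exp (2 / lam) *
        (K * (N : ℝ) ^ (ε / 2)) * (N : ℝ) ^ (-((1 + ε) ^ 2 / 2)) * Z := by
        gcongr
        exact hK N hNpos
    _ = (2 + B) * gaussInv lam 3 * Real.exp (2 / lam) * K *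
        ((N : ℝ) ^ (ε / 2) * (N : ℝ) ^ (-((1 + ε) ^ 2 / 2))) * Z := by ring
    _ ≤ _ := by gcongr

end bounds

/-! ### Conditional probabilities and uniformity of the exponents -/

section conditional

variable {lam : ℝ≥0}

lemma excess_eq (N x : ℕ) :
    (1 + (lam : ℝ)) * x - lam * N = (1 + lam) * ((x : ℝ) - rhoc lam * N) := by
  rw [rhoc]
  field_simp

/-- This inequality makes the exponents independent of `λ`: after multiplication by `1 + λ`, a
density offset `ε` is a relative offset of at least `2 ε` from `√λ`. -/
lemma two_sqrt_le (lam : ℝ≥0) : 2 * √(lam : ℝ) ≤ 1 + lam := by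
  nlinarith [Real.sq_sqrt lam.coe_nonneg, sq_nonneg (√(lam : ℝ) - 1)]

lemma one_add_mul_aConst : (1 + (lam : ℝ)) * aConst lam = √(lam : ℝ) := by
  rw [aConst]
  field_simp

theorem exists_le_condProbAbsorbedFirst {ε : ℝ} (hε : 0 < ε) :
    ∃ η₁ : ℝ, 0 < η₁ ∧ ∀ lam : ℝ≥0, 0 < lam → ∃ c : ℝ, 0 < c ∧
      ∀ N : ℕ, 4 * (lam : ℝ) + 2 < √(N : ℝ) →
      ∀ (T : Path N → WithTop ℕ) (hT : IsStoppingTime (canonicalFiltration N) T),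
      ∀ᵐ ω ∂(law N lam), ∀ t : ℕ, T ω = (t : WithTop ℕ) →
        (X t ω : ℝ) ≤ rhoc lam * N + (aConst lam - ε) * √((N : ℝ) * Real.log N) →
        S lam t ω ≤ 4 * (lam : ℝ) + 2 →
        c * (N : ℝ) ^ (-(1 / 2 : ℝ) + η₁) ≤ condProbAbsorbedFirst lam hT ω := by
  -- The cap keeps `κ = 1 - 2 e` nonnegative and gives `κ² / 2 + e / 2 ≤ 1/2 - e / 2`.
  set e : ℝ := min ε (1 / 2) with he
  have he0 : 0 < e := lt_min hε (by norm_num)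
  have heε : e ≤ ε := min_le_left _ _
  have he2 : e ≤ 1 / 2 := min_le_right _ _
  refine ⟨e / 2, by positivity, fun lam hlam => ?_⟩
  obtain ⟨c, N₀, hc0, hN₀1, hN₀⟩ := exists_rpow_le_absorbProb hlam (κ := 1 - 2 * e) (δ := e / 2)
    (by linarith) (by linarith) (by positivity)
  set p : ℝ := (lam : ℝ) / (1 + lam) with hp
  have hp0 : 0 < p := by positivity
  have hp1 : p ≤ 1 := by
    rw [hp, div_le_one (by positivity)]
    linarith
  refine ⟨min c (p ^ N₀), lt_min hc0 (by positivity), fun N hN T hT => ?_⟩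
  have hNpos : 0 < N := by
    rcases Nat.eq_zero_or_pos N with h | h
    · rw [h, Nat.cast_zero, Real.sqrt_zero] at hN
      linarith
    · exact h
  have hN1 : (1 : ℝ) ≤ N := by exact_mod_cast hNpos
  have hNp : 0 < (N : ℝ) ^ (-(1 / 2 : ℝ) + e / 2) := by positivity
  rw [ae_all_iff]
  intro t
  set K : ℕ → ℕ → Prop := fun x y =>
    (x : ℝ) ≤ rhoc lam * N + (aConst lam - ε) * √((N : ℝ) * Real.log N) ∧
      dev lam N x y ≤ 4 * lam + 2
  suffices h : ∃ a : ℕ → ℝ, Filter.Tendsto a Filter.atTop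
      (nhds (min c (p ^ N₀) * (N : ℝ) ^ (-(1 / 2 : ℝ) + e / 2))) ∧
      ∀ᶠ n in Filter.atTop, ∀ η : Config N, K (occ η) (act η) → a n ≤ absorbProb lam n η by
    obtain ⟨a, ha, h⟩ := h
    filter_upwards [le_condProb hT ha h t] with ω hω hTω hX hS
    exact hω hTω ⟨hX, hS⟩
  rcases le_or_gt N₀ N with h | h
  · obtain ⟨ρ, hρ0, hρ1, hρ⟩ := hN₀ N h
    refine ⟨fun n => min c (p ^ N₀) * (N : ℝ) ^ (-(1 / 2 : ℝ) + e / 2) - 2 * ρ ^ n, ?_,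
      Filter.Eventually.of_forall fun n η hK => ?_⟩
    · have := (tendsto_pow_atTop_nhds_zero_of_lt_one hρ0 hρ1).const_mul 2
      simpa using this.const_sub (min c (p ^ N₀) * (N : ℝ) ^ (-(1 / 2 : ℝ) + e / 2))
    · refine le_trans (sub_le_sub_right ?_ _) (hρ n η ?_ hK.2)
      · refine mul_le_mul (min_le_left _ _) ?_ hNp.le hc0.le
        exact Real.rpow_le_rpow_of_exponent_le hN1 (by nlinarith)
      · rw [excess_eq]
        have h1 : (occ η : ℝ) - rhoc lam * N ≤
            (aConst lam - ε) * √((N : ℝ) * Real.log N) := by linarith [hK.1]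
        have h2 := mul_le_mul_of_nonneg_left h1 (by positivity : (0 : ℝ) ≤ 1 + lam)
        refine h2.trans ?_
        rw [Real.sqrt_mul (Nat.cast_nonneg N)]
        have h3 : (1 + (lam : ℝ)) * (aConst lam - ε) ≤ (1 - 2 * e) * √(lam : ℝ) := by
          rw [mul_sub, one_add_mul_aConst]
          have h4 := mul_le_mul (two_sqrt_le lam) heε he0.le (by positivity)
          linarith
        calc (1 + (lam : ℝ)) * ((aConst lam - ε) * (√(N : ℝ) * √(Real.log N)))
            = (1 + (lam : ℝ)) * (aConst lam - ε) * (√(N : ℝ) * √(Real.log N)) := by ring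
          _ ≤ (1 - 2 * e) * √(lam : ℝ) * (√(N : ℝ) * √(Real.log N)) :=
            mul_le_mul_of_nonneg_right h3 (by positivity)
          _ = _ := by ring
  -- For `N < N₀` a constant is enough. Here `√N > 4 λ + 2` ensures that the chain has not already
  -- reached the upper barrier.
  · refine ⟨fun _ => min c (p ^ N₀) * (N : ℝ) ^ (-(1 / 2 : ℝ) + e / 2), tendsto_const_nhds, ?_⟩
    filter_upwards [Filter.eventually_ge_atTop N] with n hn η hK
    have hact : act η ≤ N := (act_le_occ η).trans (occ_le η)
    refine le_trans ?_ (pow_act_le_absorbProb n η (hact.trans hn) (hK.2.trans_lt hN))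
    calc min c (p ^ N₀) * (N : ℝ) ^ (-(1 / 2 : ℝ) + e / 2) ≤ p ^ N₀ * 1 :=
          mul_le_mul (min_le_right _ _) (Real.rpow_le_one_of_one_le_of_nonpos hN1 (by linarith))
            hNp.le (by positivity)
      _ ≤ p ^ act η := by
          rw [mul_one]
          exact pow_le_pow_of_le_one hp0.le hp1 (hact.trans h.le)

theorem exists_condProbAbsorbedFirst_le {ε : ℝ} (hε : 0 < ε) :
    ∃ η₂ : ℝ, 0 < η₂ ∧ ∀ lam : ℝ≥0, 0 < lam → ∀ A : ℝ, ∃ C : ℝ, 0 < C ∧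
      ∀ N : ℕ, 1 ≤ N →
      ∀ (T : Path N → WithTop ℕ) (hT : IsStoppingTime (canonicalFiltration N) T),
      ∀ᵐ ω ∂(law N lam), ∀ t : ℕ, T ω = (t : WithTop ℕ) →
        rhoc lam * N + (aConst lam + ε) * √((N : ℝ) * Real.log N) ≤ (X t ω : ℝ) →
        (X t ω : ℝ) ≤ rhoc lam * N + (2 * A + 1) * √((N : ℝ) * Real.log N) →
        S lam t ω ≤ 4 * (lam : ℝ) + 2 →
        (1 + (lam : ℝ)) * (aConst lam + ε / 2) * √((N : ℝ) * Real.log N) ≤ (Y t ω : ℝ) →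
        condProbAbsorbedFirst lam hT ω ≤ C * (N : ℝ) ^ (-(1 / 2 : ℝ) - η₂) := by
  refine ⟨ε / 2, by positivity, fun lam hlam A => ?_⟩
  obtain ⟨C, N₀, hC0, hN₀1, hN₀⟩ := exists_absorbProb_le_rpow hlam hε
    (B := (1 + lam) * |2 * A + 1|) (by positivity)
  have hN₀' : (0 : ℝ) < N₀ := by exact_mod_cast hN₀1
  refine ⟨max C ((N₀ : ℝ) ^ (1 / 2 + ε / 2)), lt_max_of_lt_left hC0, fun N hN T hT => ?_⟩
  rw [ae_all_iff]
  intro t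
  set K : ℕ → ℕ → Prop := fun x y =>
    rhoc lam * N + (aConst lam + ε) * √((N : ℝ) * Real.log N) ≤ (x : ℝ) ∧
    (x : ℝ) ≤ rhoc lam * N + (2 * A + 1) * √((N : ℝ) * Real.log N) ∧
    dev lam N x y ≤ 4 * lam + 2 ∧
    (1 + (lam : ℝ)) * (aConst lam + ε / 2) * √((N : ℝ) * Real.log N) ≤ (y : ℝ)
  have key : ∀ n (η : Config N), K (occ η) (act η) → absorbProb lam n η ≤
      max C ((N₀ : ℝ) ^ (1 / 2 + ε / 2)) * (N : ℝ) ^ (-(1 / 2 : ℝ) - ε / 2) := by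
    intro n η ⟨h1, h2, h3, h4⟩
    rcases le_or_gt N₀ N with h | h
    · rw [Real.sqrt_mul (Nat.cast_nonneg N)] at h1 h2 h4
      have h5 : √(lam : ℝ) * (1 + ε) ≤ (1 + (lam : ℝ)) * (aConst lam + ε / 2) := by
        rw [mul_add (1 + (lam : ℝ)), one_add_mul_aConst]
        linarith [mul_le_mul_of_nonneg_right (two_sqrt_le lam) hε.le]
      have hns : 0 ≤ √(N : ℝ) * √(Real.log N) := by positivity
      refine (hN₀ N h n η ?_ ?_ h3 ?_).trans
        (mul_le_mul_of_nonneg_right (le_max_left _ _) (by positivity))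
      · rw [excess_eq]
        calc √(lam : ℝ) * (1 + ε) * √(Real.log N) * √(N : ℝ)
            = √(lam : ℝ) * (1 + ε) * (√(N : ℝ) * √(Real.log N)) := by ring
          _ ≤ (1 + (lam : ℝ)) * (aConst lam + ε / 2) * (√(N : ℝ) * √(Real.log N)) :=
            mul_le_mul_of_nonneg_right h5 hns
          _ ≤ (1 + (lam : ℝ)) * (aConst lam + ε) * (√(N : ℝ) * √(Real.log N)) := by
            gcongr
            linarith
          _ = (1 + (lam : ℝ)) * ((aConst lam + ε) * (√(N : ℝ) * √(Real.log N))) := by ring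
          _ ≤ _ := mul_le_mul_of_nonneg_left (by linarith) (by positivity)
      · rw [excess_eq]
        have h6 : (occ η : ℝ) - rhoc lam * N ≤ |2 * A + 1| * (√(N : ℝ) * √(Real.log N)) := by
          have := mul_le_mul_of_nonneg_right (le_abs_self (2 * A + 1)) hns
          linarith
        calc (1 + (lam : ℝ)) * ((occ η : ℝ) - rhoc lam * N)
            ≤ (1 + (lam : ℝ)) * (|2 * A + 1| * (√(N : ℝ) * √(Real.log N))) :=
              mul_le_mul_of_nonneg_left h6 (by positivity)
          _ = _ := by ring
      · refine le_trans ?_ h4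
        calc √(lam : ℝ) * (1 + ε) * √(Real.log N) * √(N : ℝ)
            = √(lam : ℝ) * (1 + ε) * (√(N : ℝ) * √(Real.log N)) := by ring
          _ ≤ _ := mul_le_mul_of_nonneg_right h5 hns
    -- For `N < N₀` the constant is large enough for the right-hand side to be at least `1`.
    · refine (absorbProb_le_one lam n η).trans ?_
      have hle : (N : ℝ) ≤ N₀ := by exact_mod_cast h.le
      have e : (N : ℝ) ^ (-(1 / 2 : ℝ) - ε / 2) = ((N : ℝ) ^ (1 / 2 + ε / 2))⁻¹ := by
        rw [← Real.rpow_neg (by linarith)]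
        congr 1
        ring
      rw [e, ← div_eq_mul_inv, one_le_div (by positivity)]
      exact (Real.rpow_le_rpow (by linarith) hle (by positivity)).trans (le_max_right _ _)
  filter_upwards [condProb_le hT key t] with ω hω hTω h1 h2 h3 h4
  exact hω hTω ⟨h1, h2, h3, h4⟩

end conditional

end ARW

end

theorem mainTheorem5 :
    (∀ ε : ℝ, 0 < ε → ∃ η₁ : ℝ, 0 < η₁ ∧ ∀ lam : ℝ≥0, 0 < lam → ∃ c : ℝ, 0 < c ∧
      ∀ N : ℕ, 4 * (lam : ℝ) + 2 < √(N : ℝ) →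
      ∀ (t₂ : ARW.Path N → WithTop ℕ)
        (ht₂ : MeasureTheory.IsStoppingTime (ARW.canonicalFiltration N) t₂),
      ∀ᵐ ω ∂(ARW.law N lam), ∀ t : ℕ, t₂ ω = (t : WithTop ℕ) →
        ARW.rhoc lam * N + (ARW.aConst lam - 2 * ε) * √((N : ℝ) * Real.log N)
            ≤ (ARW.X t ω : ℝ) →
        (ARW.X t ω : ℝ)
            ≤ ARW.rhoc lam * N + (ARW.aConst lam - ε) * √((N : ℝ) * Real.log N) →
        ARW.S lam t ω ≤ 4 * (lam : ℝ) + 2 →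
        c * (N : ℝ) ^ (-(1 / 2 : ℝ) + η₁) ≤ ARW.condProbAbsorbedFirst lam ht₂ ω)
    ∧
    (∀ ε : ℝ, 0 < ε → ∃ η₂ : ℝ, 0 < η₂ ∧ ∀ lam : ℝ≥0, 0 < lam → ∀ A : ℝ, ∃ C : ℝ, 0 < C ∧
      ∀ N : ℕ, 1 ≤ N →
      ∀ (t₂ : ARW.Path N → WithTop ℕ)
        (ht₂ : MeasureTheory.IsStoppingTime (ARW.canonicalFiltration N) t₂),
      ∀ᵐ ω ∂(ARW.law N lam), ∀ t : ℕ, t₂ ω = (t : WithTop ℕ) →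
        ARW.rhoc lam * N + (ARW.aConst lam + ε) * √((N : ℝ) * Real.log N)
            ≤ (ARW.X t ω : ℝ) →
        (ARW.X t ω : ℝ)
            ≤ ARW.rhoc lam * N + (2 * A + 1) * √((N : ℝ) * Real.log N) →
        ARW.S lam t ω ≤ 4 * (lam : ℝ) + 2 →
        (1 + (lam : ℝ)) * (ARW.aConst lam + ε / 2) * √((N : ℝ) * Real.log N)
            ≤ (ARW.Y t ω : ℝ) →
        ARW.condProbAbsorbedFirst lam ht₂ ω ≤ C * (N : ℝ) ^ (-(1 / 2 : ℝ) - η₂)) := by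
  refine ⟨fun ε hε => ?_, fun ε hε => ARW.exists_condProbAbsorbedFirst_le hε⟩
  obtain ⟨η₁, hη₁, h⟩ := ARW.exists_le_condProbAbsorbedFirst hε
  refine ⟨η₁, hη₁, fun lam hlam => ?_⟩
  obtain ⟨c, hc, h⟩ := h lam hlam
  refine ⟨c, hc, fun N hN t₂ ht₂ => ?_⟩
  filter_upwards [h N hN t₂ ht₂] with ω hω t ht _ hX hS
  exact hω t ht hX hS
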